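/- Let $Q\in\mathbb R$ and let $\mathbb D\subset\mathbb C$ be the open unit disk. Let $\alpha_n,\beta_n$ ($n>0$) be i.i.d. $N(0,1)$ with joint law $d\mathbb P(\varphi)$, and put $\varphi_n=\frac{1}{2\sqrt n}(\alpha_n+i\beta_n)$, $\varphi_{-n}=\overline{\varphi_n}$ and $(P\varphi)(z)=\sum_{n>0}(\varphi_n\bar z^n+\varphi_{-n}z^n)$ for $z\in\mathbb D$. Let $\Phi_{\mathbb D}$ be the Dirichlet Gaussian free field on $\mathbb D$, i.e. the centred Gaussian field with covariance $G_{\mathbb D}(z,z')=\log\frac{|1-z\bar z'|}{|z-z'|}$, with expectation $\mathbb E_{\mathbb D}$. For a complex functional $F$ of the field $\phi$, measurable with respect to the $\sigma$-algebra generated by the variables $\int\phi f$, $f\in C_0^\infty(\mathbb D)$ real, put $$(UF)(c,\varphi)=e^{-Qc}\,\mathbb E_{\mathbb D}F(c+\Phi_{\mathbb D}+P\varphi),\qquad (S_qF)(\phi)=F\big(\phi(q\,\cdot)+Q\log|q|\big)\quad(0<|q|\le 1),$$ and call $F$ admissible if $\int_{\mathbb R} e^{-2Qc}\int\big(\mathbb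 E_{\mathbb D}|F(c+\Phi_{\mathbb D}+P\varphi)|\big)^2d\mathbb P(\varphi)\,dc<\infty$. For $n>0$ let, with Wirtinger derivatives $\frac{\partial}{\partial\varphi_{\pm n}}=\sqrt n(\partial_{\alpha_n}\mp i\partial_{\beta_n})$, $$a_n=\tfrac12\tfrac{\partial}{\partial\varphi_{-n}},\quad a_{-n}=n\varphi_{-n}-\tfrac12\tfrac{\partial}{\partial\varphi_n},\quad \tilde a_n=\tfrac12\tfrac{\partial}{\partial\varphi_n},\quad \tilde a_{-n}=n\varphi_n-\tfrac12\tfrac{\partial}{\partial\varphi_{-n}}.$$ Let $\mathcal D\subset L^2(d\mathbb P(\varphi)dc)$ be the linear span of the functions $u(c)\,p(\varphi)$ with $u$ a Schwartz function and $p$ a polynomial in finitely many of the variables $\alpha_n,\beta_n$. (1) For every $t\ge 0$, $S_{e^{-t}}$ maps admissible functionals to admissible functionals, and there is exactly one bounded operator $T_t$ on $L^2(d\mathbb P(\varphi)dc)$ such that $US_{e^{-t}}F=T_tUF$ for all admissible $F$. The family $(T_t)_{t\ge0}$ is a strongly continuous contraction semigroup, $T_t=e^{-tH}$ with $H\ge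 0$ self-adjoint, and the generator $H$ (the Hamiltonian) is the closure of the operator $$H=\tfrac12\Big(-\frac{d^2}{dc^2}+Q^2\Big)+2\sum_{n>0}(a_{-n}a_n+\tilde a_{-n}\tilde a_n)\quad\text{on }\mathcal D.$$ (2) For every $\alpha\in\mathbb R$, $S_{e^{i\alpha}}$ maps admissible functionals to admissible functionals, and there is exactly one bounded operator $V_\alpha$ on $L^2(d\mathbb P(\varphi)dc)$ such that $US_{e^{i\alpha}}F=V_\alpha UF$ for all admissible $F$. The family $(V_\alpha)_{\alpha\in\mathbb R}$ is a strongly continuous unitary group, $V_\alpha=e^{i\alpha P}$ with $P$ self-adjoint, and the generator $P$ (the momentum) is the closure of the operator $$P=2\sum_{n>0}(a_{-n}a_n-\tilde a_{-n}\tilde a_n)\quad\text{on }\mathcal D.$$ -/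

import Mathlib

open MeasureTheory ProbabilityTheory Filter Topology
open scoped NNReal ENNReal

namespace QFreeField

noncomputable section

/-! ### Fields on the unit disk -/

/-- The open unit disk `𝔻` of `ℂ`. -/
def unitDisk : TopologicalSpace.Opens ℂ := ⟨Metric.ball 0 1, Metric.isOpen_ball⟩

/-- Real test functions: smooth functions with compact support in the open unit disk. -/
abbrev TestFun : Type := TestFunction unitDisk ℝ ⊤

/-- A (generalised) field `φ` on the disk is recorded by its smeared values `φ(f) = ∫ φ f`.
As a product, this type carries the σ-algebra generated by the evaluations `φ ↦ φ(f)` with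
`supp f ⊆ 𝔻`, so that the `𝓕_𝔻`-measurable functionals are the measurable functions on it. -/
abbrev DiskField : Type := TestFun → ℝ

/-- The nonzero complex numbers `q` with `|q| ≤ 1`. -/
abbrev Dilation : Type := {q : ℂ // q ≠ 0 ∧ ‖q‖ ≤ 1}

/-- The dilation parameter `q = e^{-t}`, `t ≥ 0`. -/
def dil (t : ℝ≥0) : Dilation :=
  ⟨Complex.exp (-(t : ℝ)), Complex.exp_ne_zero _, by
    rw [Complex.norm_exp]
    simp⟩

/-- The rotation parameter `q = e^{iα}`. -/
def rot (α : ℝ) : Dilation :=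
  ⟨Complex.exp (α * Complex.I), Complex.exp_ne_zero _, by
    rw [Complex.norm_exp_ofReal_mul_I]⟩

/-- `f_q(z) = |q|⁻² f(z / q)`, the test function with `∫ φ(qz) f(z) dz = ∫ φ(z) f_q(z) dz`. -/
def scale (q : Dilation) (f : TestFun) : TestFun where
  toFun z := (‖q.1‖ ^ 2)⁻¹ * f (z / q.1)
  contDiff' := by
    have h : ContDiff ℝ ((⊤ : ℕ∞) : WithTop ℕ∞) (fun z : ℂ => z / q.1) := contDiff_id.div_const _
    exact contDiff_const.mul (f.contDiff.comp h)
  hasCompactSupport' := by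
    have h := f.hasCompactSupport.comp_homeomorph (Homeomorph.mulRight₀ (q.1)⁻¹
      (inv_ne_zero q.2.1))
    have h' : HasCompactSupport (fun z : ℂ => f (z / q.1)) := by
      simpa [Function.comp_def, div_eq_mul_inv] using h
    exact h'.mul_left (f := fun _ => (‖q.1‖ ^ 2)⁻¹)
  tsupport_subset' := by
    have h1 : tsupport (fun z : ℂ => (‖q.1‖ ^ 2)⁻¹ * f (z / q.1)) ⊆
        (fun z : ℂ => z / q.1) ⁻¹' tsupport f := by
      refine closure_minimal ?_ ((isClosed_tsupport f).preimage (by fun_prop))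
      intro z hz
      apply subset_tsupport
      simp only [Function.mem_support] at hz ⊢
      exact right_ne_zero_of_mul hz
    intro z hz
    have h2 : z / q.1 ∈ Metric.ball (0 : ℂ) 1 := f.tsupport_subset (h1 hz)
    have hq : 0 < ‖q.1‖ := norm_pos_iff.2 q.2.1
    rw [mem_ball_zero_iff, norm_div, div_lt_one hq] at h2
    exact mem_ball_zero_iff.2 (h2.trans_le q.2.2)

/-- `S_q F(φ) = F(s_q φ + Q log|q|)` with `(s_q φ)(z) = φ(qz)`. -/
def dilate (Q : ℝ) (q : Dilation) (F : DiskField → ℂ) : DiskField → ℂ :=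
  fun φ => F (fun f => φ (scale q f) + Q * Real.log ‖q.1‖ * ∫ z, f z)

/-! ### The Dirichlet Gaussian free field -/

/-- The Dirichlet Green function of the disk. -/
def greenDisk (z w : ℂ) : ℝ :=
  Real.log (‖1 - z * (starRingEnd ℂ) w‖ / ‖z - w‖)

/-- `Φ` is a Dirichlet Gaussian free field on the disk: a centred Gaussian random field with
covariance `𝔼 Φ(z) Φ(w) = G_𝔻(z, w)`. -/
structure IsDirichletGFF {Ω : Type*} [MeasurableSpace Ω] (Φ : Ω → DiskField) (μ : Measure Ω) :
    Prop where
  measurable : ∀ f, Measurable (fun ω => Φ ω f)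
  gaussian : IsGaussianProcess (fun (f : TestFun) (ω : Ω) => Φ ω f) μ
  mean : ∀ f, ∫ ω, Φ ω f ∂μ = 0
  covariance : ∀ f g, ∫ ω, Φ ω f * Φ ω g ∂μ = ∫ z, ∫ w, f z * greenDisk z w * g w

/-! ### The field on the circle and the state space -/

/-- Values of the real coordinates: `x (n, 0) = α_n` and `x (n, 1) = β_n`, `n > 0`. -/
abbrev Modes : Type := ℕ+ × Fin 2 → ℝ

/-- The law under which all `α_n, β_n` are i.i.d. `N(0, 1)`. -/
def modesLaw : Measure Modes := Measure.infinitePi (fun _ => gaussianReal 0 1)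

/-- `φ_n = (α_n + i β_n) / (2 √n)`, `n > 0`. -/
def phiPos (n : ℕ+) (x : Modes) : ℂ :=
  ((x (n, 0) : ℂ) + Complex.I * (x (n, 1) : ℂ)) / (2 * (Real.sqrt n : ℂ))

/-- `φ_{-n}`, the complex conjugate of `φ_n`, `n > 0`. -/
def phiNeg (n : ℕ+) (x : Modes) : ℂ := (starRingEnd ℂ) (phiPos n x)

/-- The harmonic extension `(Pφ)(z) = ∑_{n > 0} (φ_n z̄ⁿ + φ_{-n} zⁿ)`; the sum is real, and
for almost every `φ` it converges absolutely at every point of the open disk. -/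
def harmonicExt (x : Modes) (z : ℂ) : ℝ :=
  (∑' n : ℕ+, (phiPos n x * (starRingEnd ℂ) z ^ (n : ℕ) + phiNeg n x * z ^ (n : ℕ))).re

/-- Points `(c, φ)`. -/
abbrev Config : Type := ℝ × Modes

/-- The measure `dℙ(φ) dc`. -/
def configMeasure : Measure Config := (volume : Measure ℝ).prod modesLaw

/-- The Hilbert space `L²(dℙ(φ) dc)`. -/
abbrev StateSpace : Type := Lp ℂ 2 configMeasure

section Representation

variable {Ω : Type*} [MeasurableSpace Ω]

/-- The field `c + Φ_𝔻 + Pφ` on the disk. -/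
def totalField (Φ : Ω → DiskField) (p : Config) (ω : Ω) : DiskField :=
  fun f => p.1 * (∫ z, f z) + Φ ω f + ∫ z, harmonicExt p.2 z * f z

/-- The `𝓕_𝔻`-measurable functionals `F` for which `(F, F) = ⟨(ΘF) F⟩` is an absolutely
convergent integral, that is, `∫ dc e^{-2Qc} 𝔼_φ (𝔼_𝔻 |F(c + Φ_𝔻 + Pφ)|)² < ∞`. -/
def Admissible (μ : Measure Ω) (Φ : Ω → DiskField) (Q : ℝ) (F : DiskField → ℂ) : Prop :=
  Measurable F ∧
    ∫⁻ p, (ENNReal.ofReal (Real.exp (-Q * p.1)) * ∫⁻ ω, ‖F (totalField Φ p ω)‖ₑ ∂μ) ^ 2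
      ∂configMeasure < ∞

/-- `(UF)(c, φ) = e^{-Qc} 𝔼_𝔻 F(c + Φ_𝔻 + Pφ)`. -/
def U (μ : Measure Ω) (Φ : Ω → DiskField) (Q : ℝ) (F : DiskField → ℂ) : Config → ℂ :=
  fun p => Real.exp (-Q * p.1) * ∫ ω, F (totalField Φ p ω) ∂μ

/-- The bounded operator `A` on `L²(dℙ(φ) dc)` is induced by `S_q`: for all admissible `F`,
`S_q F` is admissible and `U S_q F = A U F`. -/
def IsInduced (μ : Measure Ω) (Φ : Ω → DiskField) (Q : ℝ) (q : Dilation)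
    (A : StateSpace →L[ℂ] StateSpace) : Prop :=
  ∀ F, Admissible μ Φ Q F → Admissible μ Φ Q (dilate Q q F) ∧
    ∃ (h : MemLp (U μ Φ Q F) 2 configMeasure)
      (h' : MemLp (U μ Φ Q (dilate Q q F)) 2 configMeasure),
      A (h.toLp (U μ Φ Q F)) = h'.toLp (U μ Φ Q (dilate Q q F))

end Representation

/-! ### Semigroups, unitary groups and their generators -/

section Generators

variable {E : Type*} [NormedAddCommGroup E] [InnerProductSpace ℂ E]

/-- Strongly continuous contraction semigroups. -/
structure IsContractionSemigroup (T : ℝ≥0 → E →L[ℂ] E) : Prop where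
  zero : T 0 = ContinuousLinearMap.id ℂ E
  add : ∀ s t, T (s + t) = (T s).comp (T t)
  contraction : ∀ t ψ, ‖T t ψ‖ ≤ ‖ψ‖
  continuous : ∀ ψ, Continuous (fun t => T t ψ)

/-- Strongly continuous one-parameter unitary groups. -/
structure IsUnitaryGroup (V : ℝ → E ≃ₗᵢ[ℂ] E) : Prop where
  zero : V 0 = LinearIsometryEquiv.refl ℂ E
  add : ∀ s t ψ, V (s + t) ψ = V s (V t ψ)
  continuous : ∀ ψ, Continuous (fun t => V t ψ)

/-- `T t = e^{-tH}`: the domain of `H` consists of all `ψ` for which `(ψ - T_t ψ) / t` converges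
as `t ↓ 0`, and `H ψ` is the limit. -/
def GeneratesSemigroup (H : E →ₗ.[ℂ] E) (T : ℝ≥0 → E →L[ℂ] E) : Prop :=
  ∀ ψ χ : E, (ψ, χ) ∈ H.graph ↔
    Tendsto (fun t : ℝ≥0 => (((t : ℝ) : ℂ)⁻¹) • (ψ - T t ψ)) (𝓝[>] 0) (𝓝 χ)

/-- `V α = e^{iαP}`: the domain of `P` consists of all `ψ` for which `(V_α ψ - ψ) / (iα)`
converges as `α → 0`, and `P ψ` is the limit. -/
def GeneratesGroup (P : E →ₗ.[ℂ] E) (V : ℝ → E ≃ₗᵢ[ℂ] E) : Prop :=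
  ∀ ψ χ : E, (ψ, χ) ∈ P.graph ↔
    Tendsto (fun α : ℝ => ((Complex.I * (α : ℂ))⁻¹) • (V α ψ - ψ)) (𝓝[≠] 0) (𝓝 χ)

end Generators

/-! ### Creation and annihilation operators -/

/-- The partial derivative in the coordinate `α_n` (`i = (n, 0)`) or `β_n` (`i = (n, 1)`). -/
def dCoord (i : ℕ+ × Fin 2) (f : Config → ℂ) : Config → ℂ :=
  fun p => deriv (fun s : ℝ => f (p.1, Function.update p.2 i s)) (p.2 i)

/-- The partial derivative `d/dc`. -/
def dC (f : Config → ℂ) : Config → ℂ :=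
  fun p => deriv (fun s : ℝ => f (s, p.2)) p.1

/-- The Wirtinger derivative `∂/∂φ_n = √n (∂_{α_n} - i ∂_{β_n})`, `n > 0`. -/
def dPhiPos (n : ℕ+) (f : Config → ℂ) : Config → ℂ :=
  fun p => (Real.sqrt n : ℂ) * (dCoord (n, 0) f p - Complex.I * dCoord (n, 1) f p)

/-- The Wirtinger derivative `∂/∂φ_{-n} = √n (∂_{α_n} + i ∂_{β_n})`, `n > 0`. -/
def dPhiNeg (n : ℕ+) (f : Config → ℂ) : Config → ℂ :=
  fun p => (Real.sqrt n : ℂ) * (dCoord (n, 0) f p + Complex.I * dCoord (n, 1) f p)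

/-- `a_n = ½ ∂/∂φ_{-n}`, `n > 0`. -/
def ann (n : ℕ+) (f : Config → ℂ) : Config → ℂ :=
  fun p => (1 / 2) * dPhiNeg n f p

/-- `a_{-n} = n φ_{-n} - ½ ∂/∂φ_n`, `n > 0`. -/
def cre (n : ℕ+) (f : Config → ℂ) : Config → ℂ :=
  fun p => (n : ℂ) * phiNeg n p.2 * f p - (1 / 2) * dPhiPos n f p

/-- `ã_n = ½ ∂/∂φ_n`, `n > 0`. -/
def annTilde (n : ℕ+) (f : Config → ℂ) : Config → ℂ :=
  fun p => (1 / 2) * dPhiPos n f p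

/-- `ã_{-n} = n φ_n - ½ ∂/∂φ_{-n}`, `n > 0`. -/
def creTilde (n : ℕ+) (f : Config → ℂ) : Config → ℂ :=
  fun p => (n : ℂ) * phiPos n p.2 * f p - (1 / 2) * dPhiNeg n f p

/-- `½ (-d²/dc² + Q²) + 2 ∑_{n > 0} (a_{-n} a_n + ã_{-n} ã_n)` as a differential expression. -/
def hamiltonianExpr (Q : ℝ) (f : Config → ℂ) : Config → ℂ :=
  fun p => (1 / 2) * (-dC (dC f) p + (Q : ℂ) ^ 2 * f p) +
    2 * ∑' n : ℕ+, (cre n (ann n f) p + creTilde n (annTilde n f) p)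

/-- `2 ∑_{n > 0} (a_{-n} a_n - ã_{-n} ã_n)` as a differential expression. -/
def momentumExpr (f : Config → ℂ) : Config → ℂ :=
  fun p => 2 * ∑' n : ℕ+, (cre n (ann n f) p - creTilde n (annTilde n f) p)

/-- The finite-particle domain: the linear span of the functions `u(c) p(φ)` with `u` a Schwartz
function and `p` a polynomial in finitely many of the coordinates `α_n, β_n` (equivalently, in
finitely many of the `φ_n`, `φ_{-n}`). For such functions the sums over `n` in the two
expressions above are finite. -/
def finiteParticle : Submodule ℂ (Config → ℂ) :=
  Submodule.span ℂ {f | ∃ (u : SchwartzMap ℝ ℂ) (p : MvPolynomial (ℕ+ × Fin 2) ℂ),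
    f = fun y => u y.1 * MvPolynomial.eval (fun i => (y.2 i : ℂ)) p}

/-- The graph in `L²(dℙ(φ) dc)` of an expression `L` on the finite-particle domain. -/
def graphOn (L : (Config → ℂ) → Config → ℂ) : Set (StateSpace × StateSpace) :=
  {y | ∃ f ∈ finiteParticle, y.1 =ᵐ[configMeasure] f ∧ y.2 =ᵐ[configMeasure] L f}

end

end QFreeField

open QFreeField

/-!
A state `(c, φ)` determines the field `c + Φ + Pφ` on the disk. Dilating this field by `q = e^{-t+iα}`
and adding the drift `-Qt` gives a field whose law is again of this form, averaged over a random
move of the state: the constant mode makes a step of Brownian motion of duration `t` with drift `-Q`,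
every mode makes an Ornstein-Uhlenbeck step, in which `φₙ` is damped by `e^{-nt}`, and the modes are
rotated by `α` (`map_dilatedField`). All the fields being Gaussian, this is an identity of
characteristic functionals. It comes down to the scaling relation of the Green function
`G(qz, qw) = G(z, w) + t + Σ (1 - e^{-2nt}) / n * Re (z^n conj w^n)`, integrated against test functions
(`greenForm_scale`). Removing the drift by the Cameron-Martin formula absorbs the weights `e^{-Qc}`
and leaves the factor `e^{-Q² t/2}`. Hence the operator that averages over the driftless move and
multiplies by this factor is induced by the dilation (`isInduced_of_isPolar`), and for `t = 0` it is
the rotation of the modes.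

The move preserves the product of Lebesgue measure and the Gaussian law, so the operators are
contractions. They are symmetric for `α = 0` because the move is reversible in time. They are the
only ones induced by the dilations because the images under `U` of the admissible functionals are
total in the state space (`isInduced_unique`): with test functions dual to the constant and to the
modes, these images contain a Gaussian in `c` times every character of `c` and of finitely many modes.

The closures of the formal expressions are identified by the basic criterion of essential
self-adjointness: a symmetric relation `A` for which `A + 1`, or `A + i` and `A - i`, has dense range
has self-adjoint closure (`closure_eq_adjoint`). If the difference quotients of the semigroup or of the
unitary group converge to `A`, this closure is the generator (`exists_generator_of_semigroup`,
`exists_generator_of_unitaryGroup`). For the momentum, the polynomials that are homogeneous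
of some weight under the rotations of every single mode diagonalise both the group and the
expression. For the Hamiltonian the products of Hermite
polynomials do so in the modes, and what remains on the constant mode is the Fourier multiplier
with symbol `2π²k² + Q²/2 + E`, where `E` is the energy of the Hermite polynomial. The reciprocal of
this symbol plus one has temperate growth, so the expression plus one maps Schwartz functions onto
Schwartz functions (`exists_zeroModeHamiltonian_add_eq`), and the density of the range is the density
of the finite-particle domain (`dense_of_tensorLp_mem`).
-/

namespace QFreeField

/-! ### Symmetric relations, semigroups and unitary groups -/

section FunctionalAnalysis

variable {E : Type*} [NormedAddCommGroup E] [InnerProductSpace ℂ E]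

lemma closure_subset_adjoint (G : Submodule ℂ (E × E))
    (hsym : ∀ a b a' b', (a, b) ∈ G → (a', b') ∈ G → inner ℂ b a' = inner ℂ a b') :
    closure (G : Set (E × E)) ⊆ G.adjoint := by
  intro y hy
  rw [SetLike.mem_coe, Submodule.mem_adjoint_iff]
  intro a b hab
  have hclosed : IsClosed {y : E × E | inner ℂ b y.1 - inner ℂ a y.2 = 0} :=
    isClosed_eq (by fun_prop) continuous_const
  refine closure_minimal (fun y' hy' => ?_) hclosed hy
  exact sub_eq_zero.2 (hsym a b y'.1 y'.2 hab hy')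

/-- If `a` has right derivative `b` at `0` along a contraction semigroup `T`, then
`T_t a - a - t b = ∫₀ᵗ (T_s b - b) ds`; the bound below is what remains after taking norms. -/
lemma norm_semigroup_sub_le {T : ℝ → E →L[ℂ] E} (hadd : ∀ s t, 0 ≤ s → 0 ≤ t →
      T (s + t) = (T s).comp (T t))
    (hcont : ∀ ψ, ContinuousOn (fun t => T t ψ) (Set.Ici 0)) (h0 : T 0 = ContinuousLinearMap.id ℂ E)
    {a b : E} (hab : Tendsto (fun h : ℝ => h⁻¹ • (T h a - a)) (𝓝[>] 0) (𝓝 b)) {t ε : ℝ}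
    (ht : 0 ≤ t) (hε : ∀ s ∈ Set.Icc 0 t, ‖T s b - b‖ ≤ ε) : ‖T t a - a - t • b‖ ≤ ε * t := by
  have key := norm_image_sub_le_of_norm_deriv_right_le_segment (a := 0) (b := t) (C := ε)
    (f := fun s => T s a - s • b) (f' := fun s => T s b - b) ?_ ?_ ?_ t ⟨ht, le_rfl⟩
  · simpa [h0, sub_right_comm] using key
  · exact (((hcont a).mono Set.Icc_subset_Ici_self).sub (by fun_prop))
  · intro s hs
    refine HasDerivWithinAt.sub ?_ ?_
    · rw [← hasDerivWithinAt_Ioi_iff_Ici, hasDerivWithinAt_iff_tendsto_slope' (by simp)]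
      have h1 : Tendsto (fun x : ℝ => x - s) (𝓝[>] s) (𝓝[>] 0) := by
        refine tendsto_nhdsWithin_iff.2 ⟨?_, ?_⟩
        · have : Tendsto (fun x : ℝ => x - s) (𝓝 s) (𝓝 (s - s)) := by
            exact (continuous_id.sub continuous_const).tendsto s
          rw [sub_self] at this
          exact this.mono_left nhdsWithin_le_nhds
        · filter_upwards [self_mem_nhdsWithin] with x hx
          exact sub_pos.2 (Set.mem_Ioi.1 hx)
      have h2 := ((T s).continuous.tendsto b).comp (hab.comp h1)
      refine h2.congr' ?_
      filter_upwards [self_mem_nhdsWithin] with x hx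
      have hxs : 0 ≤ x - s := (sub_pos.2 (Set.mem_Ioi.1 hx)).le
      have : T x = (T s).comp (T (x - s)) := by
        rw [← hadd s (x - s) hs.1 hxs]; congr 1; ring
      simp only [Function.comp, slope_def_module, this, ContinuousLinearMap.comp_apply]
      rw [ContinuousLinearMap.map_smul_of_tower, map_sub]
    · simpa using ((hasDerivAt_id s).smul_const b).hasDerivWithinAt
  · intro s hs
    exact hε s ⟨hs.1, hs.2.le⟩

/-- The right derivative at `0` along a contraction semigroup is a closed operator. -/
lemma tendsto_of_mem_closure {T : ℝ → E →L[ℂ] E} (hadd : ∀ s t, 0 ≤ s → 0 ≤ t →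
      T (s + t) = (T s).comp (T t))
    (hcont : ∀ ψ, ContinuousOn (fun t => T t ψ) (Set.Ici 0)) (h0 : T 0 = ContinuousLinearMap.id ℂ E)
    (hcontr : ∀ t, 0 ≤ t → ∀ ψ, ‖T t ψ‖ ≤ ‖ψ‖) {G : Set (E × E)}
    (hG : ∀ y ∈ G, Tendsto (fun h : ℝ => h⁻¹ • (T h y.1 - y.1)) (𝓝[>] 0) (𝓝 y.2))
    {y : E × E} (hy : y ∈ closure G) :
    Tendsto (fun h : ℝ => h⁻¹ • (T h y.1 - y.1)) (𝓝[>] 0) (𝓝 y.2) := by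
  have key : ∀ t ε : ℝ, 0 ≤ t → (∀ s ∈ Set.Icc 0 t, ‖T s y.2 - y.2‖ ≤ ε) →
      ‖T t y.1 - y.1 - t • y.2‖ ≤ ε * t := by
    intro t ε ht hε
    obtain ⟨w, hw, hlim⟩ := mem_closure_iff_seq_limit.1 hy
    have hl1 : Tendsto (fun n => (w n).1) atTop (𝓝 y.1) := (continuous_fst.tendsto y).comp hlim
    have hl2 : Tendsto (fun n => (w n).2) atTop (𝓝 y.2) := (continuous_snd.tendsto y).comp hlim
    have hL : Tendsto (fun n => ‖T t (w n).1 - (w n).1 - t • (w n).2‖) atTop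
        (𝓝 ‖T t y.1 - y.1 - t • y.2‖) :=
      (((((T t).continuous.tendsto _).comp hl1).sub hl1).sub (hl2.const_smul t)).norm
    have hR : Tendsto (fun n => (2 * ‖(w n).2 - y.2‖ + ε) * t) atTop (𝓝 ((2 * ‖y.2 - y.2‖ + ε) * t)) :=
      ((((hl2.sub_const y.2).norm).const_mul 2).add_const ε).mul_const t
    simp only [sub_self, norm_zero, mul_zero, zero_add] at hR
    refine le_of_tendsto_of_tendsto' hL hR fun n => ?_
    refine norm_semigroup_sub_le hadd hcont h0 (hG _ (hw n)) ht fun s hs => ?_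
    have e : T s (w n).2 - (w n).2 = T s ((w n).2 - y.2) + (T s y.2 - y.2) - ((w n).2 - y.2) := by
      rw [map_sub]; abel
    rw [e]
    refine (norm_sub_le _ _).trans ?_
    have h1 := norm_add_le (T s ((w n).2 - y.2)) (T s y.2 - y.2)
    have h2 := hcontr s hs.1 ((w n).2 - y.2)
    have h3 := hε s hs
    linarith
  rw [Metric.tendsto_nhds]
  intro ε hε
  have hc := (hcont y.2) 0 Set.self_mem_Ici
  simp only [ContinuousWithinAt, h0, ContinuousLinearMap.id_apply] at hc
  obtain ⟨δ, hδ, hball⟩ := Metric.mem_nhdsWithin_iff.1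
    (Metric.tendsto_nhds.1 hc (ε / 2) (half_pos hε))
  filter_upwards [Ioo_mem_nhdsGT hδ] with t ht
  have hk := key t (ε / 2) ht.1.le fun s hs => by
    have : s ∈ Metric.ball (0 : ℝ) δ ∩ Set.Ici 0 := by
      refine ⟨?_, hs.1⟩
      rw [Metric.mem_ball, dist_zero_right, Real.norm_eq_abs, abs_of_nonneg hs.1]
      exact hs.2.trans_lt ht.2
    have h := hball this
    rw [Set.mem_ofPred_eq, dist_eq_norm] at h
    exact h.le
  rw [dist_eq_norm]
  have e : t⁻¹ • (T t y.1 - y.1) - y.2 = t⁻¹ • (T t y.1 - y.1 - t • y.2) := by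
    rw [smul_sub t⁻¹ (T t y.1 - y.1) (t • y.2), smul_smul, inv_mul_cancel₀ ht.1.ne', one_smul]
  rw [e, norm_smul, norm_inv, Real.norm_eq_abs, abs_of_pos ht.1]
  calc t⁻¹ * ‖T t y.1 - y.1 - t • y.2‖ ≤ t⁻¹ * (ε / 2 * t) := by
        gcongr
        exact inv_nonneg.2 ht.1.le
    _ = ε / 2 := by field_simp [ht.1.ne']
    _ < ε := half_lt_self hε

variable [CompleteSpace E]

/-- The basic criterion for essential self-adjointness, for the graph `G` of a symmetric operator:
if `G + z` and `G + z̄` have dense range and `G + z` is bounded below, every vector of the adjoint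
relation differs from a vector of the closure of `G` by something orthogonal to the range
of `G + z̄`, hence by nothing. -/
lemma closure_eq_adjoint (G : Submodule ℂ (E × E))
    (hsym : ∀ a b a' b', (a, b) ∈ G → (a', b') ∈ G → inner ℂ b a' = inner ℂ a b') (z : ℂ)
    (hbound : ∀ a b, (a, b) ∈ G → ‖a‖ ≤ ‖b + z • a‖)
    (hz : Dense ((fun y : E × E => y.2 + z • y.1) '' (G : Set (E × E))))
    (hz' : Dense ((fun y : E × E => y.2 + (starRingEnd ℂ z) • y.1) '' (G : Set (E × E)))) :
    closure (G : Set (E × E)) = G.adjoint := by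
  refine (closure_subset_adjoint G hsym).antisymm ?_
  rintro ⟨ψ, χ⟩ hψ
  obtain ⟨w, hw, hwlim⟩ := mem_closure_iff_seq_limit.1 (hz (χ + z • ψ))
  choose y hy hyw using hw
  have hcauchy : CauchySeq (fun n => (y n).1) := by
    rw [Metric.cauchySeq_iff]
    intro ε hε
    obtain ⟨N, hN⟩ := Metric.cauchySeq_iff.1 hwlim.cauchySeq ε hε
    refine ⟨N, fun m hm n hn => lt_of_le_of_lt ?_ (hN m hm n hn)⟩
    rw [dist_eq_norm, dist_eq_norm, ← hyw m, ← hyw n]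
    refine (hbound _ _ (G.sub_mem (hy m) (hy n))).trans (le_of_eq ?_)
    congr 1
    simp only [smul_sub]
    abel
  obtain ⟨η, hη⟩ := cauchySeq_tendsto_of_complete hcauchy
  have hζ : Tendsto (fun n => (y n).2) atTop (𝓝 (χ + z • ψ - z • η)) := by
    have := hwlim.sub (hη.const_smul z)
    refine this.congr fun n => ?_
    rw [← hyw n]
    simp
  have hmem : (η, χ + z • ψ - z • η) ∈ closure (G : Set (E × E)) :=
    mem_closure_of_tendsto (hη.prodMk_nhds hζ) (Eventually.of_forall hy)
  have hadj := closure_subset_adjoint G hsym hmem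
  have hdiff := (Submodule.mem_adjoint_iff G _).1 (G.adjoint.sub_mem hψ hadj)
  have hzero : ψ - η = 0 := by
    refine hz'.eq_zero_of_inner_right ℂ ?_
    rintro v ⟨⟨a, b⟩, hab, rfl⟩
    have h := hdiff a b hab
    simp only [Prod.mk_sub_mk] at h
    rw [inner_add_left, inner_smul_left, Complex.conj_conj, sub_eq_zero.1 h]
    have e : χ - (χ + z • ψ - z • η) = -(z • (ψ - η)) := by
      rw [smul_sub]; abel
    rw [e, inner_neg_right, inner_smul_right]
    ring
  have e1 : η = ψ := (sub_eq_zero.1 hzero).symm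
  subst e1
  simpa using hmem

/-- A relation equal to its closure and to its adjoint, up to closure, is the graph of a
self-adjoint operator. -/
lemma exists_selfAdjoint_of_closure_eq_adjoint (G : Submodule ℂ (E × E))
    (hdense : Dense (Prod.fst '' (G : Set (E × E))))
    (h : closure (G : Set (E × E)) = G.adjoint) :
    ∃ H : E →ₗ.[ℂ] E, IsSelfAdjoint H ∧ (H.graph : Set (E × E)) = closure (G : Set (E × E)) ∧
      H.graph = G.adjoint := by
  have hfun : ∀ y ∈ G.adjoint, y.1 = 0 → y.2 = 0 := by
    intro y hy hy1
    refine hdense.eq_zero_of_inner_right ℂ ?_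
    rintro v ⟨⟨a, b⟩, hab, rfl⟩
    have := (Submodule.mem_adjoint_iff G y).1 hy a b hab
    simpa [hy1] using this
  have hgraph := Submodule.toLinearPMap_graph_eq G.adjoint hfun
  refine ⟨G.adjoint.toLinearPMap, ?_, by rw [hgraph, h], hgraph⟩
  have hdom : Dense (G.adjoint.toLinearPMap.domain : Set E) := by
    refine hdense.mono ?_
    rintro _ ⟨y, hy, rfl⟩
    rw [Submodule.toLinearPMap_domain]
    exact ⟨y, h ▸ subset_closure hy, rfl⟩
  rw [LinearPMap.isSelfAdjoint_def]
  apply LinearPMap.eq_of_eq_graph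
  rw [LinearPMap.adjoint_graph_eq_graph_adjoint hdom, hgraph]
  ext y
  simp only [Submodule.mem_adjoint_iff]
  constructor
  · intro hy a b hab
    have hab' : (a, b) ∈ (G.adjoint : Set (E × E)) := h ▸ subset_closure hab
    exact hy a b ((Submodule.mem_adjoint_iff G _).1 hab')
  · intro hy a b hab
    have hab' : (a, b) ∈ closure (G : Set (E × E)) := by
      rw [h]
      exact (Submodule.mem_adjoint_iff G (a, b)).2 hab
    have hclosed : IsClosed {p : E × E | inner ℂ p.2 y.1 - inner ℂ p.1 y.2 = 0} :=
      isClosed_eq (by fun_prop) continuous_const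
    exact closure_minimal (fun p hp => hy p.1 p.2 hp) hclosed hab'

/-- A symmetric contraction semigroup whose generator extends a densely defined `G` such that
`1 + G` has dense range is generated by the closure of `G`, a nonnegative self-adjoint operator. -/
theorem exists_generator_of_semigroup {T : ℝ≥0 → E →L[ℂ] E} (hT : IsContractionSemigroup T)
    (hsymm : ∀ t ψ χ, inner ℂ (T t ψ) χ = inner ℂ ψ (T t χ)) (G : Submodule ℂ (E × E))
    (hG : ∀ y ∈ G, Tendsto (fun t : ℝ≥0 => (((t : ℝ) : ℂ)⁻¹) • (y.1 - T t y.1)) (𝓝[>] 0) (𝓝 y.2))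
    (hdense : Dense (Prod.fst '' (G : Set (E × E))))
    (hrange : Dense ((fun y : E × E => y.2 + y.1) '' (G : Set (E × E)))) :
    ∃ H : E →ₗ.[ℂ] E, GeneratesSemigroup H T ∧ IsSelfAdjoint H ∧
      (∀ ψ : H.domain, 0 ≤ (inner ℂ (ψ : E) (H ψ)).re) ∧
      (H.graph : Set (E × E)) = closure (G : Set (E × E)) := by
  have hsym' : ∀ a b a' b' : E,
      Tendsto (fun t : ℝ≥0 => (((t : ℝ) : ℂ)⁻¹) • (a - T t a)) (𝓝[>] 0) (𝓝 b) →
      Tendsto (fun t : ℝ≥0 => (((t : ℝ) : ℂ)⁻¹) • (a' - T t a')) (𝓝[>] 0) (𝓝 b') →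
      inner ℂ b a' = inner ℂ a b' := by
    intro a b a' b' h h'
    refine tendsto_nhds_unique (h.inner tendsto_const_nhds)
      ((Tendsto.inner (tendsto_const_nhds (x := a)) h').congr fun t => ?_)
    rw [inner_smul_right, inner_smul_left, inner_sub_left, inner_sub_right, hsymm]
    simp
  have hpos : ∀ a b : E,
      Tendsto (fun t : ℝ≥0 => (((t : ℝ) : ℂ)⁻¹) • (a - T t a)) (𝓝[>] 0) (𝓝 b) →
      0 ≤ (inner ℂ a b).re := by
    intro a b h
    have h1 := (Complex.continuous_re.tendsto _).comp
      (Tendsto.inner (𝕜 := ℂ) (tendsto_const_nhds (x := a)) h)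
    refine ge_of_tendsto' h1 fun t => ?_
    simp only [Function.comp, inner_smul_right, inner_sub_right]
    have h2 : (inner ℂ a (T t a)).re ≤ ‖a‖ * ‖a‖ :=
      (Complex.re_le_norm _).trans ((norm_inner_le_norm _ _).trans
        (mul_le_mul_of_nonneg_left (hT.contraction t a) (norm_nonneg _)))
    have h3 : (inner ℂ a a).re = ‖a‖ * ‖a‖ := by
      rw [← inner_self_eq_norm_mul_norm (𝕜 := ℂ)]; rfl
    rw [← Complex.ofReal_inv, Complex.re_ofReal_mul, Complex.sub_re]
    refine mul_nonneg (inv_nonneg.2 t.2) ?_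
    linarith
  have hclos : closure (G : Set (E × E)) = G.adjoint := by
    refine closure_eq_adjoint G (fun a b a' b' h h' => hsym' a b a' b' (hG _ h) (hG _ h')) 1 ?_ ?_ ?_
    · intro a b hab
      have h1 := hpos a b (hG _ hab)
      have h2 : ‖a‖ * ‖a‖ ≤ ‖a‖ * ‖b + (1 : ℂ) • a‖ := by
        refine le_trans ?_ (norm_inner_le_norm (𝕜 := ℂ) a _)
        refine le_trans ?_ (Complex.re_le_norm _)
        rw [one_smul, inner_add_right, Complex.add_re]
        have h3 : (inner ℂ a a).re = ‖a‖ * ‖a‖ := by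
          rw [← inner_self_eq_norm_mul_norm (𝕜 := ℂ)]; rfl
        linarith
      rcases (norm_nonneg a).eq_or_lt with h0 | h0
      · rw [← h0]; positivity
      · exact le_of_mul_le_mul_left h2 h0
    · simpa using hrange
    · simpa using hrange
  obtain ⟨H, hsa, hcl, hadj⟩ := exists_selfAdjoint_of_closure_eq_adjoint G hdense hclos
  have hlim : Tendsto (fun h : ℝ => h.toNNReal) (𝓝[>] 0) (𝓝[>] 0) := by
    refine tendsto_nhdsWithin_iff.2 ⟨?_, ?_⟩
    · have := (continuous_real_toNNReal.tendsto 0).mono_left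
        (nhdsWithin_le_nhds (s := Set.Ioi (0 : ℝ)))
      simpa using this
    · filter_upwards [self_mem_nhdsWithin] with x hx
      exact Real.toNNReal_pos.2 hx
  have hlim' : Tendsto (fun t : ℝ≥0 => (t : ℝ)) (𝓝[>] 0) (𝓝[>] 0) := by
    refine tendsto_nhdsWithin_iff.2 ⟨?_, ?_⟩
    · have := (NNReal.continuous_coe.tendsto 0).mono_left
        (nhdsWithin_le_nhds (s := Set.Ioi (0 : ℝ≥0)))
      simpa using this
    · filter_upwards [self_mem_nhdsWithin] with x hx
      exact NNReal.coe_pos.2 hx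
  have hgen : GeneratesSemigroup H T := by
    intro ψ χ
    constructor
    · intro hmem
      have hmem' : (ψ, χ) ∈ closure (G : Set (E × E)) := hcl ▸ hmem
      have hmem'' : (ψ, -χ) ∈ closure ((fun y : E × E => (y.1, -y.2)) '' (G : Set (E × E))) :=
        image_closure_subset_closure_image (by fun_prop) ⟨_, hmem', rfl⟩
      have := tendsto_of_mem_closure (T := fun s : ℝ => T s.toNNReal)
        (fun s t hs ht => by rw [Real.toNNReal_add hs ht, hT.add])
        (fun ψ => ((hT.continuous ψ).comp continuous_real_toNNReal).continuousOn)
        (by rw [Real.toNNReal_zero, hT.zero]) (fun t _ ψ => hT.contraction _ ψ) ?_ hmem''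
      · have h2 := (this.comp hlim').neg
        rw [neg_neg] at h2
        refine h2.congr fun t => ?_
        simp only [Function.comp, Real.toNNReal_coe]
        rw [← smul_neg, neg_sub, ← Complex.ofReal_inv, Complex.coe_smul]
      · rintro _ ⟨y, hy, rfl⟩
        have h2 := ((hG y hy).comp hlim).neg
        refine h2.congr' ?_
        filter_upwards [self_mem_nhdsWithin] with x hx
        simp only [Function.comp]
        rw [Real.coe_toNNReal _ (le_of_lt hx), ← smul_neg, neg_sub, ← Complex.ofReal_inv,
          Complex.coe_smul]
    · intro h
      rw [hadj, Submodule.mem_adjoint_iff]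
      intro a b hab
      exact sub_eq_zero.2 (hsym' a b ψ χ (hG _ hab) h)
  refine ⟨H, hgen, hsa, fun ψ => hpos _ _ ((hgen _ _).1 (H.mem_graph ψ)), hcl⟩

/-- A unitary group whose generator extends a densely defined `G` such that `G ± i` have dense
range is generated by the closure of `G`, a self-adjoint operator. -/
theorem exists_generator_of_unitaryGroup {V : ℝ → E ≃ₗᵢ[ℂ] E} (hV : IsUnitaryGroup V)
    (G : Submodule ℂ (E × E))
    (hG : ∀ y ∈ G, Tendsto (fun α : ℝ => ((Complex.I * (α : ℂ))⁻¹) • (V α y.1 - y.1))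
      (𝓝[≠] 0) (𝓝 y.2))
    (hdense : Dense (Prod.fst '' (G : Set (E × E))))
    (hrange : Dense ((fun y : E × E => y.2 + Complex.I • y.1) '' (G : Set (E × E))))
    (hrange' : Dense ((fun y : E × E => y.2 + (-Complex.I) • y.1) '' (G : Set (E × E)))) :
    ∃ P : E →ₗ.[ℂ] E, GeneratesGroup P V ∧ IsSelfAdjoint P ∧
      (P.graph : Set (E × E)) = closure (G : Set (E × E)) := by
  have hneg : Tendsto (fun α : ℝ => -α) (𝓝[≠] 0) (𝓝[≠] 0) := by
    refine tendsto_nhdsWithin_iff.2 ⟨?_, ?_⟩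
    · have := (continuous_neg.tendsto (0 : ℝ)).mono_left (nhdsWithin_le_nhds (s := {0}ᶜ))
      simpa using this
    · filter_upwards [self_mem_nhdsWithin] with x hx
      simpa using hx
  have hunit : ∀ α ψ χ, inner ℂ (V α ψ) χ = inner ℂ ψ (V (-α) χ) := by
    intro α ψ χ
    rw [← (V (-α)).inner_map_map, ← hV.add, neg_add_cancel, hV.zero]
    rfl
  have hsym' : ∀ a b a' b' : E,
      Tendsto (fun α : ℝ => ((Complex.I * (α : ℂ))⁻¹) • (V α a - a)) (𝓝[≠] 0) (𝓝 b) →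
      Tendsto (fun α : ℝ => ((Complex.I * (α : ℂ))⁻¹) • (V α a' - a')) (𝓝[≠] 0) (𝓝 b') →
      inner ℂ b a' = inner ℂ a b' := by
    intro a b a' b' h h'
    refine tendsto_nhds_unique (h.inner tendsto_const_nhds)
      ((Tendsto.inner (tendsto_const_nhds (x := a)) (h'.comp hneg)).congr fun t => ?_)
    simp only [Function.comp]
    rw [inner_smul_right, inner_smul_left, inner_sub_left, inner_sub_right, hunit]
    simp
  have hbd : ∀ a b : E, (a, b) ∈ G → ‖a‖ ≤ ‖b + Complex.I • a‖ := by
    intro a b hab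
    have h1 := hsym' a b a b (hG _ hab) (hG _ hab)
    rw [← inner_conj_symm, Complex.conj_eq_iff_im] at h1
    have h3 : (inner ℂ a a).re = ‖a‖ * ‖a‖ := by
      rw [← inner_self_eq_norm_mul_norm (𝕜 := ℂ)]; rfl
    have h2 : ‖a‖ * ‖a‖ ≤ ‖a‖ * ‖b + Complex.I • a‖ := by
      refine le_trans ?_ (norm_inner_le_norm (𝕜 := ℂ) a _)
      refine le_trans ?_ ((le_abs_self _).trans (Complex.abs_im_le_norm _))
      rw [inner_add_right, inner_smul_right, Complex.add_im, Complex.I_mul_im, h1, h3, zero_add]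
    rcases (norm_nonneg a).eq_or_lt with h0 | h0
    · rw [← h0]; positivity
    · exact le_of_mul_le_mul_left h2 h0
  have hclos : closure (G : Set (E × E)) = G.adjoint :=
    closure_eq_adjoint G (fun a b a' b' h h' => hsym' a b a' b' (hG _ h) (hG _ h')) Complex.I hbd
      hrange (by simpa using hrange')
  obtain ⟨P, hsa, hcl, hadj⟩ := exists_selfAdjoint_of_closure_eq_adjoint G hdense hclos
  refine ⟨P, ?_, hsa, hcl⟩
  -- The two one-sided derivatives are those of the contraction semigroups `V (σ s)`, `σ = ±1`.
  have hone : ∀ σ : ℝ, σ ≠ 0 → ∀ ψ χ : E, (ψ, χ) ∈ closure (G : Set (E × E)) →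
      Tendsto (fun h : ℝ => h⁻¹ • (V (σ * h) ψ - ψ)) (𝓝[>] 0) (𝓝 ((Complex.I * σ) • χ)) := by
    intro σ hσ ψ χ hmem
    have hmem' : (ψ, (Complex.I * σ) • χ) ∈
        closure ((fun y : E × E => (y.1, (Complex.I * σ) • y.2)) '' (G : Set (E × E))) :=
      image_closure_subset_closure_image (by fun_prop) ⟨_, hmem, rfl⟩
    refine tendsto_of_mem_closure (T := fun s : ℝ => ((V (σ * s)).toContinuousLinearEquiv :
        E →L[ℂ] E)) (fun s t _ _ => ?_) (fun ψ => ?_) ?_ (fun t _ ψ => ?_) ?_ hmem'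
    · ext ψ
      simp [mul_add, hV.add]
    · exact ((hV.continuous ψ).comp (continuous_const.mul continuous_id)).continuousOn
    · ext ψ
      simp [hV.zero]
    · simp
    · rintro _ ⟨y, hy, rfl⟩
      have hlim : Tendsto (fun h : ℝ => σ * h) (𝓝[>] 0) (𝓝[≠] 0) := by
        refine tendsto_nhdsWithin_iff.2 ⟨?_, ?_⟩
        · have := ((continuous_const.mul continuous_id).tendsto (0 : ℝ)).mono_left
            (nhdsWithin_le_nhds (s := Set.Ioi 0)) (f := fun h : ℝ => σ * h)
          simpa using this
        · filter_upwards [self_mem_nhdsWithin] with x hx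
          exact mul_ne_zero hσ (ne_of_gt hx)
      have h2 := ((hG y hy).comp hlim).const_smul (Complex.I * (σ : ℂ))
      refine h2.congr' ?_
      filter_upwards [self_mem_nhdsWithin] with x hx
      have hx' : (x : ℂ) ≠ 0 := Complex.ofReal_ne_zero.2 (ne_of_gt hx)
      have hσ' : (σ : ℂ) ≠ 0 := Complex.ofReal_ne_zero.2 hσ
      simp only [Function.comp, smul_smul]
      have e : Complex.I * (σ : ℂ) * (Complex.I * ((σ * x : ℝ) : ℂ))⁻¹ = ((x⁻¹ : ℝ) : ℂ) := by
        push_cast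
        field_simp [Complex.I_ne_zero]
      rw [e, Complex.coe_smul]
      rfl
  intro ψ χ
  constructor
  · intro hmem
    have hmem' : (ψ, χ) ∈ closure (G : Set (E × E)) := hcl ▸ hmem
    rw [← Set.Iio_union_Ioi, nhdsWithin_union, tendsto_sup]
    constructor
    · have h1 := (hone (-1) (by norm_num) ψ χ hmem').const_smul (Complex.I)
      have hlim : Tendsto (fun h : ℝ => -h) (𝓝[<] 0) (𝓝[>] 0) := by
        have := tendsto_neg_nhdsLT (a := (0 : ℝ))
        simpa using this
      have h2 := h1.comp hlim
      rw [smul_smul] at h2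
      have e : Complex.I * (Complex.I * ((-1 : ℝ) : ℂ)) = 1 := by
        push_cast; rw [← mul_assoc, Complex.I_mul_I]; ring
      rw [e, one_smul] at h2
      refine h2.congr fun x => ?_
      simp only [Function.comp, neg_mul, one_mul, neg_neg]
      rw [← Complex.coe_smul, smul_smul, mul_inv, Complex.inv_I]
      push_cast
      congr 1
      rw [inv_neg]; ring
    · have h1 := (hone 1 (by norm_num) ψ χ hmem').const_smul (-Complex.I)
      rw [smul_smul] at h1
      have e : -Complex.I * (Complex.I * ((1 : ℝ) : ℂ)) = 1 := by
        push_cast; rw [← mul_assoc, neg_mul, Complex.I_mul_I]; ring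
      rw [e, one_smul] at h1
      refine h1.congr fun x => ?_
      simp only [one_mul]
      rw [← Complex.coe_smul, smul_smul, mul_inv, Complex.inv_I]
      push_cast
      rfl
  · intro h
    rw [hadj, Submodule.mem_adjoint_iff]
    intro a b hab
    exact sub_eq_zero.2 (hsym' a b ψ χ (hG _ hab) h)

end FunctionalAnalysis

/-! ### Characteristic functionals on product spaces -/

section CharFunctional

/-- The phase `e^{ir}` of a real number `r`. -/
noncomputable def phase (r : ℝ) : ℂ := Complex.exp (r * Complex.I)

lemma norm_phase (r : ℝ) : ‖phase r‖ = 1 := Complex.norm_exp_ofReal_mul_I r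

lemma phase_zero : phase 0 = 1 := by simp [phase]

lemma phase_add (r s : ℝ) : phase (r + s) = phase r * phase s := by
  simp [phase, add_mul, Complex.exp_add]

lemma phase_sum {ι : Type*} (s : Finset ι) (f : ι → ℝ) :
    phase (∑ i ∈ s, f i) = ∏ i ∈ s, phase (f i) := by
  simp [phase, Finset.sum_mul, Complex.exp_sum]

lemma phase_neg (r : ℝ) : phase (-r) = (starRingEnd ℂ) (phase r) := by
  simp [phase, ← Complex.exp_conj]

@[fun_prop]
lemma continuous_phase : Continuous phase := by unfold phase; fun_prop

@[fun_prop]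
lemma measurable_phase : Measurable phase := continuous_phase.measurable

variable {ι : Type*}

/-- Finite measures on a product of real lines, over any index set, are determined by their
characteristic functional on finite linear combinations of the coordinates. -/
lemma ext_of_charFunctional {μ ν : Measure (ι → ℝ)} [IsFiniteMeasure μ] [IsFiniteMeasure ν]
    (h : ∀ (s : Finset ι) (a : ι → ℝ),
      ∫ x, phase (∑ i ∈ s, a i * x i) ∂μ = ∫ x, phase (∑ i ∈ s, a i * x i) ∂ν) : μ = ν := by
  classical
  refine IsProjectiveLimit.unique (P := fun s => μ.map s.restrict) (fun s => rfl) fun s => ?_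
  refine (Measure.ext_of_charFunDual (E := s → ℝ) ?_).symm
  ext L
  rw [charFunDual_apply, charFunDual_apply]
  have hm : Measurable (s.restrict : (ι → ℝ) → (s → ℝ)) := Finset.measurable_restrict s
  have hc : Continuous fun v : s → ℝ => Complex.exp (L v * Complex.I) := by fun_prop
  rw [integral_map hm.aemeasurable hc.aestronglyMeasurable,
    integral_map hm.aemeasurable hc.aestronglyMeasurable]
  let a : ι → ℝ := fun i => if hi : i ∈ s then
    L (fun j => if (⟨i, hi⟩ : s) = j then 1 else 0) else 0
  have ha : ∀ x : ι → ℝ, L (s.restrict x) = ∑ i ∈ s, a i * x i := by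
    intro x
    have := LinearMap.pi_apply_eq_sum_univ (L : (s → ℝ) →ₗ[ℝ] ℝ) (s.restrict x)
    rw [← ContinuousLinearMap.coe_coe, this, ← Finset.sum_coe_sort s]
    refine Finset.sum_congr rfl fun i _ => ?_
    simp only [a, i.2, dif_pos, Finset.restrict, smul_eq_mul, ContinuousLinearMap.coe_coe]
    ring
  simp only [ha]
  exact h s a

lemma ext_of_charFunctional_prod {κ : Type*} {μ ν : Measure ((ι → ℝ) × (κ → ℝ))} [IsFiniteMeasure μ]
    [IsFiniteMeasure ν]
    (h : ∀ (s : Finset ι) (t : Finset κ) (a : ι → ℝ) (b : κ → ℝ),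
      ∫ x, phase (∑ i ∈ s, a i * x.1 i + ∑ i ∈ t, b i * x.2 i) ∂μ =
      ∫ x, phase (∑ i ∈ s, a i * x.1 i + ∑ i ∈ t, b i * x.2 i) ∂ν) : μ = ν := by
  let e : (ι → ℝ) × (κ → ℝ) → (ι ⊕ κ → ℝ) := fun x => Sum.elim x.1 x.2
  let g : (ι ⊕ κ → ℝ) → (ι → ℝ) × (κ → ℝ) := fun z => (fun i => z (Sum.inl i), fun i => z (Sum.inr i))
  have he : Measurable e := by
    refine measurable_pi_iff.2 fun i => ?_
    cases i <;> simp only [e, Sum.elim_inl, Sum.elim_inr] <;> fun_prop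
  have hg : Measurable g := by fun_prop
  have hge : ∀ μ : Measure ((ι → ℝ) × (κ → ℝ)), (μ.map e).map g = μ := by
    intro μ
    rw [Measure.map_map hg he]
    exact Measure.map_id
  rw [← hge μ, ← hge ν]
  congr 1
  refine ext_of_charFunctional fun s a => ?_
  have hc : Measurable fun x : ι ⊕ κ → ℝ => phase (∑ i ∈ s, a i * x i) := by fun_prop
  rw [integral_map he.aemeasurable hc.aestronglyMeasurable,
    integral_map he.aemeasurable hc.aestronglyMeasurable, ← Finset.toLeft_disjSum_toRight (u := s)]
  simp only [Finset.sum_disjSum, e, Sum.elim_inl, Sum.elim_inr]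
  exact h _ _ (fun i => a (Sum.inl i)) (fun i => a (Sum.inr i))

lemma ext_of_charFunctional_real_prod {μ ν : Measure (ℝ × (ι → ℝ))} [IsFiniteMeasure μ]
    [IsFiniteMeasure ν]
    (h : ∀ (k : ℝ) (s : Finset ι) (a : ι → ℝ),
      ∫ x, phase (k * x.1 + ∑ i ∈ s, a i * x.2 i) ∂μ =
      ∫ x, phase (k * x.1 + ∑ i ∈ s, a i * x.2 i) ∂ν) : μ = ν := by
  let e : ℝ × (ι → ℝ) → (Unit → ℝ) × (ι → ℝ) := fun x => (fun _ => x.1, x.2)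
  let g : (Unit → ℝ) × (ι → ℝ) → ℝ × (ι → ℝ) := fun z => (z.1 (), z.2)
  have he : Measurable e := by fun_prop
  have hg : Measurable g := by fun_prop
  have hge : ∀ μ : Measure (ℝ × (ι → ℝ)), (μ.map e).map g = μ := by
    intro μ
    rw [Measure.map_map hg he]
    exact Measure.map_id
  rw [← hge μ, ← hge ν]
  congr 1
  refine ext_of_charFunctional_prod fun s t a b => ?_
  have hc : Measurable fun x : (Unit → ℝ) × (ι → ℝ) =>
      phase (∑ i ∈ s, a i * x.1 i + ∑ i ∈ t, b i * x.2 i) := by fun_prop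
  rw [integral_map he.aemeasurable hc.aestronglyMeasurable,
    integral_map he.aemeasurable hc.aestronglyMeasurable]
  simp only [e, ← Finset.sum_mul]
  exact h _ _ _

end CharFunctional

/-! ### The law of the modes -/

section ModesLaw

instance : IsProbabilityMeasure modesLaw := by unfold modesLaw; infer_instance

lemma measurePreserving_eval_modesLaw (i : ℕ+ × Fin 2) :
    MeasurePreserving (fun x : Modes => x i) modesLaw (gaussianReal 0 1) :=
  measurePreserving_eval_infinitePi _ i

/-- Functions of finitely many coordinates, in product form, factorise under the modes law. -/
lemma integral_prod_modesLaw (s : Finset (ℕ+ × Fin 2)) {g : ℕ+ × Fin 2 → ℝ → ℂ}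
    (hg : ∀ i, Measurable (g i)) :
    ∫ x, ∏ i ∈ s, g i (x i) ∂modesLaw = ∏ i ∈ s, ∫ y, g i y ∂gaussianReal 0 1 := by
  have h := integral_restrict_infinitePi (μ := fun _ : ℕ+ × Fin 2 => gaussianReal 0 1) (s := s)
    (f := fun y : s → ℝ => ∏ i : s, g i (y i))
    (Finset.measurable_prod Finset.univ fun (i : s) _ =>
      (hg i).comp (measurable_pi_apply i)).aestronglyMeasurable
  rw [integral_fintype_prod_eq_prod (fun (i : s) y => g i y)] at h
  rw [← Finset.prod_coe_sort s, modesLaw, ← h]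
  congr 1
  ext x
  exact (Finset.prod_coe_sort s (fun i => g i (x i))).symm

lemma integral_phase_gaussianReal (v : ℝ≥0) (t : ℝ) :
    ∫ x, phase (t * x) ∂gaussianReal 0 v = Real.exp (-(v * t ^ 2 / 2)) := by
  have := charFun_gaussianReal (μ := 0) (v := v) t
  rw [charFun_apply_real] at this
  simp only [phase, Complex.ofReal_mul]
  rw [this]
  push_cast
  congr 1
  ring

lemma integral_phase_modesLaw (s : Finset (ℕ+ × Fin 2)) (a : ℕ+ × Fin 2 → ℝ) :
    ∫ x, phase (∑ i ∈ s, a i * x i) ∂modesLaw = Real.exp (-((∑ i ∈ s, a i ^ 2) / 2)) := by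
  simp only [phase_sum]
  rw [integral_prod_modesLaw s (g := fun i y => phase (a i * y)) (fun i => by fun_prop)]
  simp only [integral_phase_gaussianReal]
  rw [← Complex.ofReal_prod, ← Real.exp_sum]
  congr 2
  simp [Finset.sum_div]

/-- A set of sequences of full measure: those growing more slowly than `n²` in the mean. -/
def tempered : Set Modes := {x | Summable fun i : ℕ+ × Fin 2 => |x i| / (i.1 : ℝ) ^ 2}

lemma summable_inv_sq : Summable fun i : ℕ+ × Fin 2 => (1 : ℝ) / (i.1 : ℝ) ^ 2 := by
  have h1 : Summable fun n : ℕ+ => (1 : ℝ) / (n : ℝ) ^ 2 :=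
    (Real.summable_one_div_nat_pow.2 one_lt_two).comp_injective PNat.coe_injective
  have h2 := h1.mul_of_nonneg (g := fun _ : Fin 2 => (1 : ℝ)) (hasSum_fintype _).summable
    (fun n => by positivity) (fun _ => zero_le_one)
  simpa using h2

lemma ae_tempered : ∀ᵐ x ∂modesLaw, x ∈ tempered := by
  have hm : ∀ i : ℕ+ × Fin 2, Measurable fun x : Modes => ENNReal.ofReal (|x i| / (i.1 : ℝ) ^ 2) := by
    intro i; fun_prop
  obtain ⟨C, hC⟩ : ∃ C : ℝ≥0∞, C ≠ ∞ ∧ ∀ i : ℕ+ × Fin 2,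
      ∫⁻ x : Modes, ENNReal.ofReal |x i| ∂modesLaw = C := by
    refine ⟨∫⁻ y : ℝ, ENNReal.ofReal |y| ∂gaussianReal 0 1, ?_, fun i => ?_⟩
    · have h := (memLp_id_gaussianReal (μ := 0) (v := 1) 1).integrable le_rfl
      have h2 := h.abs.lintegral_lt_top
      exact h2.ne
    · exact (measurePreserving_eval_modesLaw i).lintegral_comp
        (f := fun y : ℝ => ENNReal.ofReal |y|) (by fun_prop)
  have hfin : ∫⁻ x : Modes, ∑' i : ℕ+ × Fin 2, ENNReal.ofReal (|x i| / (i.1 : ℝ) ^ 2) ∂modesLaw ≠ ∞ := by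
    rw [lintegral_tsum fun i => (hm i).aemeasurable]
    have : ∀ i : ℕ+ × Fin 2, ∫⁻ x : Modes, ENNReal.ofReal (|x i| / (i.1 : ℝ) ^ 2) ∂modesLaw =
        ENNReal.ofReal (1 / (i.1 : ℝ) ^ 2) * C := by
      intro i
      rw [← hC.2 i, ← lintegral_const_mul _ (by fun_prop)]
      congr 1
      ext x
      rw [← ENNReal.ofReal_mul (by positivity)]
      congr 1
      ring
    simp only [this]
    rw [ENNReal.tsum_mul_right]
    exact ENNReal.mul_ne_top summable_inv_sq.tsum_ofReal_ne_top hC.1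
  filter_upwards [ae_lt_top (Measurable.tsum hm) hfin] with x hx
  have h := ENNReal.summable_toReal hx.ne
  refine h.congr fun i => ?_
  rw [ENNReal.toReal_ofReal (by positivity)]

/-- The characteristic functional of the modes law on convergent infinite linear combinations. -/
lemma integral_phase_tsum_modesLaw {b : ℕ+ × Fin 2 → ℝ} (hb : Summable fun i => b i ^ 2)
    (hs : ∀ᵐ y ∂modesLaw, Summable fun i => b i * y i) :
    ∫ y, phase (∑' i, b i * y i) ∂modesLaw = Real.exp (-((∑' i, b i ^ 2) / 2)) := by
  have h1 : Tendsto (fun s : Finset (ℕ+ × Fin 2) => ∫ y, phase (∑ i ∈ s, b i * y i) ∂modesLaw) atTop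
      (𝓝 (∫ y, phase (∑' i, b i * y i) ∂modesLaw)) := by
    refine tendsto_integral_filter_of_dominated_convergence (fun _ => 1) ?_ ?_
      (integrable_const _) ?_
    · refine Eventually.of_forall fun s => ?_
      have : Measurable fun y : Modes => phase (∑ i ∈ s, b i * y i) := by fun_prop
      exact this.aestronglyMeasurable
    · exact Eventually.of_forall fun s => Eventually.of_forall fun y => (norm_phase _).le
    · filter_upwards [hs] with y hy
      exact (continuous_phase.tendsto _).comp hy.hasSum
  have h2 : Tendsto (fun s : Finset (ℕ+ × Fin 2) =>
      ((Real.exp (-((∑ i ∈ s, b i ^ 2) / 2)) : ℝ) : ℂ)) atTop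
      (𝓝 ((Real.exp (-((∑' i, b i ^ 2) / 2)) : ℝ) : ℂ)) := by
    have hc : Continuous fun r : ℝ => ((Real.exp (-(r / 2)) : ℝ) : ℂ) := by fun_prop
    exact (hc.tendsto _).comp hb.hasSum
  simp only [integral_phase_modesLaw] at h1
  exact tendsto_nhds_unique h1 h2

lemma summable_mul_of_tempered {b : ℕ+ × Fin 2 → ℝ} {C : ℝ} (hb : ∀ i, |b i| * (i.1 : ℝ) ^ 2 ≤ C)
    {x : Modes} (hx : x ∈ tempered) : Summable fun i => b i * x i := by
  refine Summable.of_norm_bounded (hx.mul_left C) fun i => ?_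
  have hi : (0 : ℝ) < (i.1 : ℝ) ^ 2 := by
    have := i.1.pos
    positivity
  rw [norm_mul, Real.norm_eq_abs, Real.norm_eq_abs]
  calc |b i| * |x i| = |b i| * (i.1 : ℝ) ^ 2 * (|x i| / (i.1 : ℝ) ^ 2) := by field_simp
    _ ≤ C * (|x i| / (i.1 : ℝ) ^ 2) := by gcongr; exact hb i

/-- The rotation of the plane spanned by two independent copies `(x, y)` of the modes by an angle
depending on the mode, composed with a reflection, preserves their joint law. -/
lemma measurePreserving_reflect {e s : ℕ+ × Fin 2 → ℝ} (h : ∀ i, e i ^ 2 + s i ^ 2 = 1) :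
    MeasurePreserving (fun z : Modes × Modes => ((fun i => e i * z.1 i + s i * z.2 i : Modes),
      (fun i => s i * z.1 i - e i * z.2 i : Modes))) (modesLaw.prod modesLaw)
      (modesLaw.prod modesLaw) := by
  classical
  have hm : Measurable (fun z : Modes × Modes => ((fun i => e i * z.1 i + s i * z.2 i : Modes),
      (fun i => s i * z.1 i - e i * z.2 i : Modes))) := by fun_prop
  refine ⟨hm, ?_⟩
  have : IsFiniteMeasure (Measure.map (fun z : Modes × Modes =>
      ((fun i => e i * z.1 i + s i * z.2 i : Modes),
      (fun i => s i * z.1 i - e i * z.2 i : Modes))) (modesLaw.prod modesLaw)) :=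
    Measure.isFiniteMeasure_map _ _
  refine ext_of_charFunctional_prod fun u t a b => ?_
  -- Both sums are extended by zero to the same finite set of modes.
  set a' : ℕ+ × Fin 2 → ℝ := fun i => if i ∈ u then a i else 0
  set b' : ℕ+ × Fin 2 → ℝ := fun i => if i ∈ t then b i else 0
  have hu : ∀ x : Modes, ∑ i ∈ u, a i * x i = ∑ i ∈ u ∪ t, a' i * x i := by
    intro x
    simp only [a', ite_mul, zero_mul, Finset.sum_ite_mem, Finset.union_inter_cancel_left]
  have ht : ∀ x : Modes, ∑ i ∈ t, b i * x i = ∑ i ∈ u ∪ t, b' i * x i := by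
    intro x
    simp only [b', ite_mul, zero_mul, Finset.sum_ite_mem, Finset.union_inter_cancel_right]
  have hphase : ∀ a b : ℕ+ × Fin 2 → ℝ, ∫ z : Modes × Modes,
      phase (∑ i ∈ u ∪ t, a i * z.1 i + ∑ i ∈ u ∪ t, b i * z.2 i) ∂modesLaw.prod modesLaw =
      Real.exp (-((∑ i ∈ u ∪ t, (a i ^ 2 + b i ^ 2)) / 2)) := by
    intro a b
    simp only [phase_add]
    rw [integral_prod_mul (fun x : Modes => phase (∑ i ∈ u ∪ t, a i * x i))
      (fun x : Modes => phase (∑ i ∈ u ∪ t, b i * x i)), integral_phase_modesLaw,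
      integral_phase_modesLaw, ← Complex.ofReal_mul, ← Real.exp_add, Finset.sum_add_distrib]
    congr 2
    ring
  simp only [hu, ht]
  rw [integral_map hm.aemeasurable (by
    have : Measurable fun z : Modes × Modes =>
      phase (∑ i ∈ u ∪ t, a' i * z.1 i + ∑ i ∈ u ∪ t, b' i * z.2 i) := by fun_prop
    exact this.aestronglyMeasurable), hphase a' b']
  have e1 : ∀ z : Modes × Modes,
      ∑ i ∈ u ∪ t, a' i * (e i * z.1 i + s i * z.2 i) + ∑ i ∈ u ∪ t, b' i * (s i * z.1 i - e i * z.2 i)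
      = ∑ i ∈ u ∪ t, (a' i * e i + b' i * s i) * z.1 i +
        ∑ i ∈ u ∪ t, (a' i * s i - b' i * e i) * z.2 i := by
    intro z
    rw [← Finset.sum_add_distrib, ← Finset.sum_add_distrib]
    exact Finset.sum_congr rfl fun i _ => by ring
  simp only [e1]
  rw [hphase]
  congr 4
  refine Finset.sum_congr rfl fun i _ => ?_
  linear_combination (a' i ^ 2 + b' i ^ 2) * h i

/-- The rotation of the modes induced by `z ↦ e^{iα} z`: `φ_n` is multiplied by `e^{-inα}`. -/
noncomputable def rotModes (α : ℝ) (x : Modes) : Modes := fun i =>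
  if i.2 = 0 then Real.cos (i.1 * α) * x (i.1, 0) + Real.sin (i.1 * α) * x (i.1, 1)
  else Real.cos (i.1 * α) * x (i.1, 1) - Real.sin (i.1 * α) * x (i.1, 0)

@[simp] lemma rotModes_apply_zero (α : ℝ) (x : Modes) (n : ℕ+) : rotModes α x (n, 0) =
    Real.cos (n * α) * x (n, 0) + Real.sin (n * α) * x (n, 1) := by simp [rotModes]

@[simp] lemma rotModes_apply_one (α : ℝ) (x : Modes) (n : ℕ+) : rotModes α x (n, 1) =
    Real.cos (n * α) * x (n, 1) - Real.sin (n * α) * x (n, 0) := by simp [rotModes]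

lemma ext_modes {x y : Modes} (h0 : ∀ n, x (n, 0) = y (n, 0)) (h1 : ∀ n, x (n, 1) = y (n, 1)) :
    x = y := by
  ext ⟨n, j⟩
  fin_cases j
  exacts [h0 n, h1 n]

lemma rotModes_zero (x : Modes) : rotModes 0 x = x := ext_modes (by simp) (by simp)

lemma rotModes_add (α β : ℝ) (x : Modes) : rotModes (α + β) x = rotModes α (rotModes β x) := by
  refine ext_modes (fun n => ?_) (fun n => ?_) <;>
    simp only [rotModes_apply_zero, rotModes_apply_one, mul_add, Real.cos_add, Real.sin_add] <;> ring

@[fun_prop]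
lemma measurable_rotModes (α : ℝ) : Measurable (rotModes α) := by
  refine measurable_pi_iff.2 fun i => ?_
  unfold rotModes
  split_ifs <;> fun_prop

lemma measurePreserving_rotModes (α : ℝ) : MeasurePreserving (rotModes α) modesLaw modesLaw := by
  classical
  refine ⟨measurable_rotModes α, ?_⟩
  have : IsFiniteMeasure (Measure.map (rotModes α) modesLaw) := Measure.isFiniteMeasure_map _ _
  refine ext_of_charFunctional fun u a => ?_
  set N : Finset ℕ+ := u.image Prod.fst
  set a' : ℕ+ × Fin 2 → ℝ := fun i => if i ∈ u then a i else 0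
  have hu : ∀ x : Modes, ∑ i ∈ u, a i * x i = ∑ i ∈ N ×ˢ Finset.univ, a' i * x i := by
    intro x
    have hsub : u ⊆ N ×ˢ Finset.univ := fun i hi =>
      Finset.mem_product.2 ⟨Finset.mem_image_of_mem _ hi, Finset.mem_univ _⟩
    simp only [a', ite_mul, zero_mul, Finset.sum_ite_mem, Finset.inter_eq_right.2 hsub]
  simp only [hu]
  rw [integral_map (measurable_rotModes α).aemeasurable (by
    have : Measurable fun z : Modes => phase (∑ i ∈ N ×ˢ Finset.univ, a' i * z i) := by fun_prop
    exact this.aestronglyMeasurable), integral_phase_modesLaw]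
  have e1 : ∀ x : Modes, ∑ i ∈ N ×ˢ Finset.univ, a' i * rotModes α x i =
      ∑ i ∈ N ×ˢ Finset.univ, rotModes (-α) a' i * x i := by
    intro x
    rw [Finset.sum_product, Finset.sum_product]
    refine Finset.sum_congr rfl fun n _ => ?_
    simp only [Fin.sum_univ_two, rotModes_apply_zero, rotModes_apply_one, mul_neg, Real.cos_neg,
      Real.sin_neg]
    ring
  simp only [e1]
  rw [integral_phase_modesLaw]
  congr 4
  rw [Finset.sum_product, Finset.sum_product]
  refine Finset.sum_congr rfl fun n _ => ?_
  simp only [Fin.sum_univ_two, rotModes_apply_zero, rotModes_apply_one, mul_neg, Real.cos_neg,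
    Real.sin_neg]
  linear_combination (a' (n, 0) ^ 2 + a' (n, 1) ^ 2) * Real.cos_sq_add_sin_sq (n * α)

lemma rotModes_mem_tempered {x : Modes} (hx : x ∈ tempered) (α : ℝ) : rotModes α x ∈ tempered := by
  have hswap : Summable fun i : ℕ+ × Fin 2 => |x (i.1, 1 - i.2)| / (i.1 : ℝ) ^ 2 := by
    have := hx.comp_injective (i := fun i : ℕ+ × Fin 2 => (i.1, 1 - i.2)) ?_
    · exact this
    · rintro ⟨n, j⟩ ⟨m, k⟩ h
      simpa using h
  refine Summable.of_nonneg_of_le (fun i => by positivity) (fun i => ?_) (hx.add hswap)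
  rw [← add_div]
  gcongr
  obtain ⟨n, j⟩ := i
  have key : ∀ c s p r : ℝ, |c| ≤ 1 → |s| ≤ 1 → |c * p + s * r| ≤ |p| + |r| := by
    intro c s p r hc hs
    refine (abs_add_le _ _).trans ?_
    rw [abs_mul, abs_mul]
    exact add_le_add (mul_le_of_le_one_left (abs_nonneg _) hc)
      (mul_le_of_le_one_left (abs_nonneg _) hs)
  fin_cases j
  · exact (rotModes_apply_zero α x n).symm ▸
      key _ _ _ _ (Real.abs_cos_le_one _) (Real.abs_sin_le_one _)
  · have := key (Real.cos (n * α)) (-Real.sin (n * α)) (x (n, 1)) (x (n, 0))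
      (Real.abs_cos_le_one _) (by rw [abs_neg]; exact Real.abs_sin_le_one _)
    rw [neg_mul, ← sub_eq_add_neg] at this
    exact (rotModes_apply_one α x n).symm ▸ this

/-- Translation of the standard Gaussian law by `θ`, as a change of density. -/
lemma withDensity_gaussianReal_eq_map (θ : ℝ) :
    (gaussianReal 0 1).withDensity (fun b => ENNReal.ofReal (Real.exp (θ * b - θ ^ 2 / 2))) =
      (gaussianReal 0 1).map (fun b => b + θ) := by
  rw [gaussianReal_map_add_const, gaussianReal_of_var_ne_zero _ one_ne_zero,
    gaussianReal_of_var_ne_zero _ one_ne_zero, ← withDensity_mul _ (measurable_gaussianPDF _ _)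
      (by fun_prop)]
  congr 1
  ext b
  simp only [Pi.mul_apply, gaussianPDF, gaussianPDFReal]
  rw [← ENNReal.ofReal_mul (by positivity), mul_assoc, ← Real.exp_add]
  congr 3
  simp
  ring

end ModesLaw

/-! ### Test functions, harmonic modes and the harmonic extension -/

section TestFunctions

lemma integrable_testFun (f : TestFun) : Integrable (f : ℂ → ℝ) :=
  f.continuous.integrable_of_hasCompactSupport f.hasCompactSupport

lemma exists_bound_testFun (f : TestFun) : ∃ M, 0 ≤ M ∧ ∀ z, |f z| ≤ M := by
  obtain ⟨M, hM⟩ := f.hasCompactSupport.exists_bound_of_continuous f.continuous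
  exact ⟨M, (norm_nonneg _).trans (hM 0), hM⟩

/-- The support of a test function stays away from the unit circle. -/
lemma exists_radius (f : TestFun) : ∃ r : ℝ, 0 ≤ r ∧ r < 1 ∧ ∀ z, f z ≠ 0 → ‖z‖ ≤ r := by
  rcases (tsupport f).eq_empty_or_nonempty with h | h
  · refine ⟨0, le_rfl, zero_lt_one, fun z hz => ?_⟩
    have := subset_tsupport f hz
    rw [h] at this
    exact this.elim
  · obtain ⟨w, hw, hmax⟩ := IsCompact.exists_isMaxOn (s := tsupport f) f.hasCompactSupport h
      continuous_norm.continuousOn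
    exact ⟨‖w‖, norm_nonneg _, mem_ball_zero_iff.1 (f.tsupport_subset hw),
      fun z hz => hmax (subset_tsupport f hz)⟩

lemma scale_apply (q : Dilation) (f : TestFun) (z : ℂ) :
    scale q f z = (‖q.1‖ ^ 2)⁻¹ * f (z / q.1) := rfl

/-- The change of variables `z ↦ q z`. -/
lemma integral_comp_mul (q : ℂ) (hq : q ≠ 0) (h : ℂ → ℝ) :
    ∫ z, (‖q‖ ^ 2)⁻¹ * h (z / q) = ∫ z, h z := by
  have hn : (‖q‖ : ℝ) ≠ 0 := norm_ne_zero_iff.2 hq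
  have hu : q / ‖q‖ ∈ Submonoid.unitSphere ℂ := by
    refine mem_sphere_zero_iff_norm.2 ?_
    rw [norm_div, Complex.norm_real, norm_norm, div_self hn]
  let u : Circle := ⟨q / ‖q‖, hu⟩
  have h1 := (rotation u).symm.measurePreserving.integral_comp
    (rotation u).symm.toHomeomorph.measurableEmbedding (fun z => h ((‖q‖⁻¹ : ℝ) • z))
  rw [Measure.integral_comp_smul volume h (‖q‖⁻¹)] at h1
  rw [integral_const_mul]
  have e : ∀ z : ℂ, (‖q‖⁻¹ : ℝ) • (rotation u).symm z = z / q := by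
    intro z
    rw [rotation_symm, rotation_apply]
    have : ((u⁻¹ : Circle) : ℂ) = ‖q‖ / q := by
      rw [Circle.coe_inv]
      simp [u]
    rw [this]
    have hn' : ((‖q‖ : ℝ) : ℂ) ≠ 0 := Complex.ofReal_ne_zero.2 hn
    rw [Complex.real_smul]
    push_cast
    field_simp
  simp only [e] at h1
  rw [h1, Complex.finrank_real_complex, smul_eq_mul, ← mul_assoc, abs_of_nonneg (by positivity)]
  field_simp

lemma integral_scale_mul (q : Dilation) (f : TestFun) (h : ℂ → ℝ) :
    ∫ z, h z * scale q f z = ∫ z, h (q.1 * z) * f z := by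
  rw [← integral_comp_mul q.1 q.2.1 (fun z => h (q.1 * z) * f z)]
  congr 1
  ext z
  rw [scale_apply, mul_div_cancel₀ _ q.2.1]
  ring

lemma integral_scale (q : Dilation) (f : TestFun) : ∫ z, scale q f z = ∫ z, f z := by
  simpa using integral_scale_mul q f (fun _ => 1)

/-- The harmonic functions `n^{-1/2} Re zⁿ` and `n^{-1/2} Im zⁿ` multiplying the coordinates
`α_n` and `β_n` in the harmonic extension. -/
noncomputable def diskMode (i : ℕ+ × Fin 2) (z : ℂ) : ℝ :=
  (if i.2 = 0 then (z ^ (i.1 : ℕ)).re else (z ^ (i.1 : ℕ)).im) / Real.sqrt i.1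

lemma diskMode_zero (n : ℕ+) (z : ℂ) : diskMode (n, 0) z = (z ^ (n : ℕ)).re / Real.sqrt n := by
  simp [diskMode]

lemma diskMode_one (n : ℕ+) (z : ℂ) : diskMode (n, 1) z = (z ^ (n : ℕ)).im / Real.sqrt n := by
  simp [diskMode]

lemma one_le_sqrt_pnat (n : ℕ+) : 1 ≤ Real.sqrt n :=
  Real.one_le_sqrt.2 (by exact_mod_cast (one_le : 1 ≤ n))

lemma abs_diskMode_le (i : ℕ+ × Fin 2) (z : ℂ) : |diskMode i z| ≤ ‖z‖ ^ (i.1 : ℕ) := by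
  rw [diskMode, abs_div, abs_of_nonneg (Real.sqrt_nonneg _), ← norm_pow]
  refine (div_le_self (abs_nonneg _) (one_le_sqrt_pnat i.1)).trans ?_
  split_ifs
  exacts [Complex.abs_re_le_norm _, Complex.abs_im_le_norm _]

@[fun_prop]
lemma continuous_diskMode (i : ℕ+ × Fin 2) : Continuous (diskMode i) := by
  unfold diskMode
  split_ifs <;> fun_prop

lemma integrable_diskMode_mul (i : ℕ+ × Fin 2) (f : TestFun) :
    Integrable (fun z => diskMode i z * f z) :=
  ((continuous_diskMode i).mul f.continuous).integrable_of_hasCompactSupport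
    f.hasCompactSupport.mul_left

/-- The coefficient of the coordinate `i` in the smeared harmonic extension `∫ (Pφ) f`. -/
noncomputable def coef (i : ℕ+ × Fin 2) (f : TestFun) : ℝ := ∫ z, diskMode i z * f z

lemma summable_modes_geometric {r : ℝ} (h0 : 0 ≤ r) (h1 : r < 1) :
    Summable fun i : ℕ+ × Fin 2 => r ^ (i.1 : ℕ) := by
  have h1 : Summable fun n : ℕ+ => r ^ (n : ℕ) :=
    (summable_geometric_of_lt_one h0 h1).comp_injective PNat.coe_injective
  have h2 := h1.mul_of_nonneg (g := fun _ : Fin 2 => (1 : ℝ)) (hasSum_fintype _).summable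
    (fun n => by positivity) (fun _ => zero_le_one)
  simpa using h2

lemma exists_pow_mul_sq_le {r : ℝ} (h0 : 0 ≤ r) (h1 : r < 1) :
    ∃ C, ∀ n : ℕ, r ^ n * (n : ℝ) ^ 2 ≤ C := by
  obtain ⟨C, hC⟩ := (tendsto_pow_const_mul_const_pow_of_abs_lt_one 2
    (by rwa [abs_of_nonneg h0] : |r| < 1)).bddAbove_range
  exact ⟨C, fun n => by rw [mul_comm]; exact hC ⟨n, rfl⟩⟩

lemma abs_coef_le {f : TestFun} {r : ℝ} (hr : ∀ z, f z ≠ 0 → ‖z‖ ≤ r) (i : ℕ+ × Fin 2) :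
    ∫ z, ‖diskMode i z * f z‖ ≤ r ^ (i.1 : ℕ) * ∫ z, |f z| := by
  rw [← integral_const_mul]
  refine integral_mono (integrable_diskMode_mul i f).norm ((integrable_testFun f).abs.const_mul _)
    fun z => ?_
  simp only [norm_mul, Real.norm_eq_abs]
  by_cases hz : f z = 0
  · simp [hz]
  · exact mul_le_mul_of_nonneg_right ((abs_diskMode_le i z).trans
      (pow_le_pow_left₀ (norm_nonneg _) (hr z hz) _)) (abs_nonneg _)

lemma exists_coef_bound (f : TestFun) : ∃ C, ∀ i : ℕ+ × Fin 2, |coef i f| * (i.1 : ℝ) ^ 2 ≤ C := by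
  obtain ⟨r, h0, h1, hr⟩ := exists_radius f
  obtain ⟨C, hC⟩ := exists_pow_mul_sq_le h0 h1
  refine ⟨C * ∫ z, |f z|, fun i => ?_⟩
  have hI : 0 ≤ ∫ z, |f z| := integral_nonneg fun z => abs_nonneg _
  calc |coef i f| * (i.1 : ℝ) ^ 2 ≤ (r ^ (i.1 : ℕ) * ∫ z, |f z|) * (i.1 : ℝ) ^ 2 := by
        gcongr
        exact (norm_integral_le_integral_norm _).trans (abs_coef_le hr i)
    _ = (r ^ (i.1 : ℕ) * ((i.1 : ℕ) : ℝ) ^ 2) * ∫ z, |f z| := by ring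
    _ ≤ C * ∫ z, |f z| := by gcongr; exact hC _

lemma summable_mul_coef (f : TestFun) {x : Modes} (hx : x ∈ tempered) :
    Summable fun i => coef i f * x i := by
  obtain ⟨C, hC⟩ := exists_coef_bound f
  exact summable_mul_of_tempered hC hx

lemma summable_coef_sq (f : TestFun) : Summable fun i => coef i f ^ 2 := by
  obtain ⟨r, h0, h1, hr⟩ := exists_radius f
  have hrr : r ^ 2 < 1 := by nlinarith
  refine Summable.of_nonneg_of_le (fun i => sq_nonneg _) (fun i => ?_)
    ((summable_modes_geometric (sq_nonneg r) hrr).mul_right ((∫ z, |f z|) ^ 2))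
  have h := (norm_integral_le_integral_norm _).trans (abs_coef_le hr i)
  rw [← pow_mul, mul_comm 2, pow_mul, ← mul_pow, ← sq_abs]
  exact pow_le_pow_left₀ (abs_nonneg _) h 2

lemma tsum_modes {f : ℕ+ × Fin 2 → ℝ} (hf : Summable f) :
    ∑' i, f i = ∑' n : ℕ+, (f (n, 0) + f (n, 1)) := by
  rw [hf.tsum_prod]
  simp [tsum_fintype, Fin.sum_univ_two]

lemma harmonicExt_eq (x : Modes) (z : ℂ) : harmonicExt x z =
    ∑' n : ℕ+, (x (n, 0) * diskMode (n, 0) z + x (n, 1) * diskMode (n, 1) z) := by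
  have h : ∀ n : ℕ+, phiPos n x * (starRingEnd ℂ) z ^ (n : ℕ) + phiNeg n x * z ^ (n : ℕ) =
      ((x (n, 0) * diskMode (n, 0) z + x (n, 1) * diskMode (n, 1) z : ℝ) : ℂ) := by
    intro n
    have hs : ((Real.sqrt n : ℝ) : ℂ) ≠ 0 :=
      Complex.ofReal_ne_zero.2 (zero_lt_one.trans_le (one_le_sqrt_pnat n)).ne'
    rw [← map_pow, diskMode_zero, diskMode_one, phiNeg, phiPos]
    set w := z ^ (n : ℕ)
    have hw : w = w.re + w.im * Complex.I := (Complex.re_add_im w).symm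
    have hcw : (starRingEnd ℂ) w = w.re - w.im * Complex.I := by
      apply Complex.ext <;> simp
    rw [hcw]
    nth_rewrite 3 [hw]
    simp only [map_div₀, map_add, map_mul, Complex.conj_ofReal, Complex.conj_I, map_ofNat]
    push_cast
    field_simp
    ring_nf
    rw [Complex.I_sq]
    ring
  rw [harmonicExt]
  simp only [h]
  rw [← Complex.ofReal_tsum, Complex.ofReal_re]

lemma summable_mul_diskMode {x : Modes} (hx : x ∈ tempered) {z : ℂ} (hz : ‖z‖ < 1) :
    Summable fun i => x i * diskMode i z := by
  obtain ⟨C, hC⟩ := exists_pow_mul_sq_le (norm_nonneg z) hz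
  refine (summable_mul_of_tempered (b := fun i => diskMode i z) (C := C) (fun i => ?_) hx).congr
    fun i => mul_comm _ _
  refine le_trans ?_ (hC i.1)
  gcongr
  exact abs_diskMode_le i z

/-- On tempered sequences the smeared harmonic extension is a convergent linear form. -/
lemma integral_harmonicExt_mul {x : Modes} (hx : x ∈ tempered) (f : TestFun) :
    ∫ z, harmonicExt x z * f z = ∑' i, coef i f * x i := by
  obtain ⟨r, h0, h1, hr⟩ := exists_radius f
  obtain ⟨C, hC⟩ := exists_pow_mul_sq_le h0 h1
  have hI : ∀ i, Integrable fun z => x i * (diskMode i z * f z) :=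
    fun i => (integrable_diskMode_mul i f).const_mul _
  have hS : Summable fun i => ∫ z, ‖x i * (diskMode i z * f z)‖ := by
    have hint : 0 ≤ ∫ z, |f z| := integral_nonneg fun z => abs_nonneg _
    refine Summable.of_nonneg_of_le (fun i => integral_nonneg fun z => norm_nonneg _)
      (fun i => ?_) (hx.mul_left (C * ∫ z, |f z|))
    simp only [norm_mul (x i)]
    rw [integral_const_mul, Real.norm_eq_abs]
    have hi : (0 : ℝ) < (i.1 : ℝ) ^ 2 := by
      have := i.1.pos
      positivity
    calc |x i| * ∫ z, ‖diskMode i z * f z‖ ≤ |x i| * (r ^ (i.1 : ℕ) * ∫ z, |f z|) := by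
          gcongr
          exact abs_coef_le hr i
      _ = (r ^ (i.1 : ℕ) * ((i.1 : ℕ) : ℝ) ^ 2) * (∫ z, |f z|) * (|x i| / (i.1 : ℝ) ^ 2) := by
          field_simp
      _ ≤ C * (∫ z, |f z|) * (|x i| / (i.1 : ℝ) ^ 2) := by
          gcongr
          exact hC _
  have h := (hasSum_integral_of_summable_integral_norm hI hS).tsum_eq
  simp only [integral_const_mul] at h
  simp only [coef, mul_comm _ (x _)]
  rw [h]
  congr 1
  ext z
  by_cases hz : f z = 0
  · simp [hz]
  · have hz1 : ‖z‖ < 1 := (hr z hz).trans_lt h1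
    rw [harmonicExt_eq, ← tsum_modes (summable_mul_diskMode hx hz1), ← tsum_mul_right]
    congr 1
    ext i
    ring

/-- The parameter of a dilation in polar form. -/
def IsPolar (q : Dilation) (t α : ℝ) : Prop := q.1 = Complex.exp (-t + α * Complex.I)

lemma IsPolar.norm {q : Dilation} {t α : ℝ} (h : IsPolar q t α) : ‖q.1‖ = Real.exp (-t) := by
  rw [h, Complex.norm_exp]
  simp

lemma IsPolar.pow {q : Dilation} {t α : ℝ} (h : IsPolar q t α) (n : ℕ) :
    q.1 ^ n = (Real.exp (-(n * t)) : ℂ) * (Real.cos (n * α) + Real.sin (n * α) * Complex.I) := by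
  rw [h, ← Complex.exp_nat_mul, Complex.ofReal_exp, Complex.ofReal_cos, Complex.ofReal_sin,
    ← Complex.exp_mul_I, ← Complex.exp_add]
  congr 1
  push_cast
  ring

lemma diskMode_mul_zero {q : Dilation} {t α : ℝ} (h : IsPolar q t α) (n : ℕ+) (z : ℂ) :
    diskMode (n, 0) (q.1 * z) = Real.exp (-(n * t)) *
      (Real.cos (n * α) * diskMode (n, 0) z - Real.sin (n * α) * diskMode (n, 1) z) := by
  rw [diskMode_zero, diskMode_zero, diskMode_one, mul_pow, h.pow, mul_assoc, Complex.re_ofReal_mul,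
    Complex.mul_re]
  simp [-Complex.ofReal_cos, -Complex.ofReal_sin]
  ring

lemma diskMode_mul_one {q : Dilation} {t α : ℝ} (h : IsPolar q t α) (n : ℕ+) (z : ℂ) :
    diskMode (n, 1) (q.1 * z) = Real.exp (-(n * t)) *
      (Real.cos (n * α) * diskMode (n, 1) z + Real.sin (n * α) * diskMode (n, 0) z) := by
  rw [diskMode_one, diskMode_zero, diskMode_one, mul_pow, h.pow, mul_assoc, Complex.im_ofReal_mul,
    Complex.mul_im]
  simp [-Complex.ofReal_cos, -Complex.ofReal_sin]
  ring

lemma coef_scale_zero {q : Dilation} {t α : ℝ} (h : IsPolar q t α) (n : ℕ+) (f : TestFun) :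
    coef (n, 0) (scale q f) = Real.exp (-(n * t)) *
      (Real.cos (n * α) * coef (n, 0) f - Real.sin (n * α) * coef (n, 1) f) := by
  simp only [coef]
  rw [integral_scale_mul, ← integral_const_mul, ← integral_const_mul,
    ← integral_sub ((integrable_diskMode_mul _ f).const_mul _)
      ((integrable_diskMode_mul _ f).const_mul _), ← integral_const_mul]
  congr 1
  ext z
  rw [diskMode_mul_zero h]
  ring

lemma coef_scale_one {q : Dilation} {t α : ℝ} (h : IsPolar q t α) (n : ℕ+) (f : TestFun) :
    coef (n, 1) (scale q f) = Real.exp (-(n * t)) *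
      (Real.cos (n * α) * coef (n, 1) f + Real.sin (n * α) * coef (n, 0) f) := by
  simp only [coef]
  rw [integral_scale_mul, ← integral_const_mul, ← integral_const_mul,
    ← integral_add ((integrable_diskMode_mul _ f).const_mul _)
      ((integrable_diskMode_mul _ f).const_mul _), ← integral_const_mul]
  congr 1
  ext z
  rw [diskMode_mul_one h]
  ring

/-- Smearing the harmonic extension with a scaled test function amounts to damping and rotating
the modes. -/
lemma tsum_coef_scale {q : Dilation} {t α : ℝ} (h : IsPolar q t α) (f : TestFun)
    {x : Modes} (hx : x ∈ tempered) (ht : 0 ≤ t) :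
    ∑' i, coef i (scale q f) * x i =
      ∑' i : ℕ+ × Fin 2, coef i f * rotModes α (fun j => Real.exp (-(j.1 * t)) * x j) i := by
  have hx' : rotModes α (fun j : ℕ+ × Fin 2 => Real.exp (-(j.1 * t)) * x j) ∈ tempered := by
    refine rotModes_mem_tempered ?_ α
    refine Summable.of_nonneg_of_le (fun i => by positivity) (fun i => ?_) hx
    refine div_le_div_of_nonneg_right ?_ (by positivity)
    rw [abs_mul, abs_of_nonneg (Real.exp_pos _).le]
    refine mul_le_of_le_one_left (abs_nonneg _) (Real.exp_le_one_iff.2 ?_)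
    have : (0 : ℝ) ≤ i.1 := by positivity
    nlinarith
  rw [tsum_modes (summable_mul_coef _ hx), tsum_modes (summable_mul_coef _ hx')]
  congr 1
  ext n
  rw [coef_scale_zero h, coef_scale_one h, rotModes_apply_zero, rotModes_apply_one]
  ring

end TestFunctions

/-! ### The Green function under dilations -/

section Green

lemma measurable_greenDisk : Measurable fun p : ℂ × ℂ => greenDisk p.1 p.2 := by
  unfold greenDisk
  have h : Measurable fun p : ℂ × ℂ => (starRingEnd ℂ) p.2 :=
    Complex.continuous_conj.measurable.comp measurable_snd
  exact Real.measurable_log.comp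
    (((measurable_const.sub (measurable_fst.mul h)).norm).div (measurable_fst.sub measurable_snd).norm)

lemma ae_ne_prod : ∀ᵐ p : ℂ × ℂ ∂(volume.prod volume), p.1 ≠ p.2 := by
  rw [Measure.ae_prod_iff_ae_ae]
  · refine Eventually.of_forall fun z => ?_
    have : ∀ᵐ w : ℂ, w ≠ z := by simp [ae_iff]
    filter_upwards [this] with w hw using hw.symm
  · exact (measurableSet_eq_fun measurable_fst measurable_snd).compl

/-- The logarithm of the norm is integrable near the origin of the plane. -/
lemma integrable_log_norm : Integrable
    ((Metric.ball (0 : ℂ) 2).indicator fun z => |Real.log ‖z‖|) := by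
  rw [integrable_indicator_iff measurableSet_ball]
  rw [integrableOn_fun_norm_addHaar volume (f := fun r => |Real.log r|)]
  rw [Complex.finrank_real_complex]
  have hc : Continuous fun y : ℝ => |y * Real.log y| := Real.continuous_mul_log.abs
  refine (hc.integrableOn_Icc.mono_set Set.Ioo_subset_Icc_self).congr_fun (fun y hy => ?_)
    measurableSet_Ioo
  simp only [smul_eq_mul, abs_mul, abs_of_pos hy.1]
  simp

lemma integrable_prod_log (f g : TestFun) : Integrable (fun p : ℂ × ℂ =>
    f p.1 * g p.2 * (Metric.ball (0 : ℂ) 2).indicator (fun z => |Real.log ‖z‖|) (p.1 - p.2))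
    (volume.prod volume) := by
  obtain ⟨M, hM0, hM⟩ := exists_bound_testFun f
  have h := Integrable.convolution_integrand (ContinuousLinearMap.mul ℝ ℝ) (integrable_testFun g)
    integrable_log_norm (μ := volume) (ν := volume)
  refine (h.bdd_mul (c := M) (f := fun p : ℂ × ℂ => f p.1)
    (f.continuous.comp continuous_fst).aestronglyMeasurable
    (Eventually.of_forall fun p => hM p.1)).congr ?_
  refine Eventually.of_forall fun p => ?_
  simp only [ContinuousLinearMap.mul_apply']
  ring

/-- The part of the Green function that is smooth inside the disk is bounded on supports of test
functions. -/
lemma abs_log_one_sub_le {r : ℝ} (h1 : r < 1) {ρ : ℝ} (hρ0 : 0 ≤ ρ) (hρ : ρ ≤ 1)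
    {z w : ℂ} (hz : ‖z‖ ≤ r) (hw : ‖w‖ ≤ r) :
    |Real.log ‖1 - ρ * (z * (starRingEnd ℂ) w)‖| ≤ Real.log 2 + |Real.log (1 - r ^ 2)| := by
  have h0 : 0 ≤ r := (norm_nonneg z).trans hz
  have hζ : ‖(ρ : ℂ) * (z * (starRingEnd ℂ) w)‖ ≤ r ^ 2 := by
    rw [norm_mul, norm_mul, Complex.norm_conj, Complex.norm_real, Real.norm_eq_abs,
      abs_of_nonneg hρ0]
    calc ρ * (‖z‖ * ‖w‖) ≤ 1 * (r * r) := by gcongr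
      _ = r ^ 2 := by ring
  have hr2 : r ^ 2 < 1 := by nlinarith
  have hlow : 1 - r ^ 2 ≤ ‖1 - (ρ : ℂ) * (z * (starRingEnd ℂ) w)‖ := by
    have := norm_sub_norm_le (1 : ℂ) ((ρ : ℂ) * (z * (starRingEnd ℂ) w))
    rw [norm_one] at this
    linarith
  have hup : ‖1 - (ρ : ℂ) * (z * (starRingEnd ℂ) w)‖ ≤ 2 := by
    have := norm_sub_le (1 : ℂ) ((ρ : ℂ) * (z * (starRingEnd ℂ) w))
    rw [norm_one] at this
    linarith
  have hpos : 0 < 1 - r ^ 2 := by linarith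
  rw [abs_le]
  have l1 := Real.log_le_log hpos hlow
  have l2 := Real.log_le_log (hpos.trans_le hlow) hup
  have l3 := neg_abs_le (Real.log (1 - r ^ 2))
  have l4 := Real.log_nonneg one_le_two
  have l5 := abs_nonneg (Real.log (1 - r ^ 2))
  constructor <;> linarith

lemma one_sub_ne_zero {ρ : ℝ} (hρ0 : 0 ≤ ρ) (hρ : ρ ≤ 1)
    {z w : ℂ} (hz : ‖z‖ < 1) (hw : ‖w‖ < 1) : 1 - (ρ : ℂ) * (z * (starRingEnd ℂ) w) ≠ 0 := by
  intro h
  have h1 : ‖(ρ : ℂ) * (z * (starRingEnd ℂ) w)‖ = 1 := by rw [← sub_eq_zero.1 h, norm_one]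
  rw [norm_mul, norm_mul, Complex.norm_conj, Complex.norm_real, Real.norm_eq_abs,
    abs_of_nonneg hρ0] at h1
  have h2 : ‖z‖ * ‖w‖ < 1 := mul_lt_one_of_nonneg_of_lt_one_left (norm_nonneg _) hz hw.le
  have h3 : 0 ≤ ‖z‖ * ‖w‖ := by positivity
  nlinarith

lemma greenDisk_eq {z w : ℂ} (hz : ‖z‖ < 1) (hw : ‖w‖ < 1) (h : z ≠ w) :
    greenDisk z w = Real.log ‖1 - z * (starRingEnd ℂ) w‖ - Real.log ‖z - w‖ := by
  have h1 := one_sub_ne_zero zero_le_one le_rfl hz hw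
  rw [Complex.ofReal_one, one_mul] at h1
  rw [greenDisk, Real.log_div (norm_ne_zero_iff.2 h1) (norm_ne_zero_iff.2 (sub_ne_zero.2 h))]

/-- The kernel `f(z) G(z, w) g(w)` of the covariance is absolutely integrable. -/
lemma integrable_greenDisk (f g : TestFun) : Integrable
    (fun p : ℂ × ℂ => f p.1 * greenDisk p.1 p.2 * g p.2) (volume.prod volume) := by
  obtain ⟨r, h0, h1, hr⟩ := exists_radius f
  obtain ⟨r', h0', h1', hr'⟩ := exists_radius g
  set R := max r r'
  have hR : R < 1 := max_lt h1 h1'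
  set C := Real.log 2 + |Real.log (1 - R ^ 2)|
  have hb := (((integrable_testFun f).mul_prod (integrable_testFun g)).norm.mul_const C).add
    (integrable_prod_log f g).norm
  refine Integrable.mono' hb ?_ ?_
  · have hf : Measurable fun p : ℂ × ℂ => f p.1 := f.continuous.measurable.comp measurable_fst
    have hg : Measurable fun p : ℂ × ℂ => g p.2 := g.continuous.measurable.comp measurable_snd
    exact ((hf.mul measurable_greenDisk).mul hg).aestronglyMeasurable
  · filter_upwards [ae_ne_prod] with p hp
    by_cases hfz : f p.1 = 0
    · simp [hfz]
    by_cases hgz : g p.2 = 0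
    · simp [hgz]
    have hz : ‖p.1‖ ≤ R := (hr _ hfz).trans (le_max_left _ _)
    have hw : ‖p.2‖ ≤ R := (hr' _ hgz).trans (le_max_right _ _)
    have hball : p.1 - p.2 ∈ Metric.ball (0 : ℂ) 2 := by
      rw [mem_ball_zero_iff]
      have := norm_sub_le p.1 p.2
      linarith
    have hG : |greenDisk p.1 p.2| ≤ C + |Real.log ‖p.1 - p.2‖| := by
      rw [greenDisk_eq (hz.trans_lt hR) (hw.trans_lt hR) hp]
      refine (abs_sub _ _).trans (add_le_add ?_ le_rfl)
      have := abs_log_one_sub_le hR zero_le_one le_rfl hz hw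
      rwa [Complex.ofReal_one, one_mul] at this
    simp only [Pi.add_apply, Set.indicator_of_mem hball, norm_mul, Real.norm_eq_abs, abs_abs]
    calc |f p.1| * |greenDisk p.1 p.2| * |g p.2|
        ≤ |f p.1| * (C + |Real.log ‖p.1 - p.2‖|) * |g p.2| := by gcongr
      _ = _ := by ring

/-- The covariance form of the Dirichlet field. -/
noncomputable def greenForm (f g : TestFun) : ℝ := ∫ z, ∫ w, f z * greenDisk z w * g w

lemma greenForm_eq (f g : TestFun) : greenForm f g =
    ∫ p : ℂ × ℂ, f p.1 * greenDisk p.1 p.2 * g p.2 ∂(volume.prod volume) :=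
  (integral_prod _ (integrable_greenDisk f g)).symm

lemma greenForm_sum {κ : Type*} (s t : Finset κ) (f g : κ → TestFun) (a b : κ → ℝ) :
    greenForm (∑ k ∈ s, a k • f k) (∑ l ∈ t, b l • g l) =
      ∑ k ∈ s, ∑ l ∈ t, a k * b l * greenForm (f k) (g l) := by
  have h : ∀ p : ℂ × ℂ, (∑ k ∈ s, a k • f k) p.1 * greenDisk p.1 p.2 * (∑ l ∈ t, b l • g l) p.2 =
      ∑ k ∈ s, ∑ l ∈ t, a k * b l * (f k p.1 * greenDisk p.1 p.2 * g l p.2) := by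
    intro p
    simp only [sum_apply, smul_apply, smul_eq_mul, Finset.sum_mul, Finset.mul_sum]
    rw [Finset.sum_comm]
    exact Finset.sum_congr rfl fun f _ => Finset.sum_congr rfl fun g _ => by ring
  simp only [greenForm_eq, h]
  rw [integral_finsetSum _ fun k _ => integrable_finsetSum _ fun l _ =>
    (integrable_greenDisk (f k) (g l)).const_mul _]
  refine Finset.sum_congr rfl fun k _ => ?_
  rw [integral_finsetSum _ fun l _ => (integrable_greenDisk (f k) (g l)).const_mul _]
  simp only [integral_const_mul]

lemma diskMode_mul_add (n : ℕ+) (z w : ℂ) :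
    diskMode (n, 0) z * diskMode (n, 0) w + diskMode (n, 1) z * diskMode (n, 1) w =
      ((z * (starRingEnd ℂ) w) ^ (n : ℕ) / (n : ℂ)).re := by
  have hs : Real.sqrt n ≠ 0 := (zero_lt_one.trans_le (one_le_sqrt_pnat n)).ne'
  have hn : ((n : ℕ) : ℝ) = Real.sqrt n * Real.sqrt n := (Real.mul_self_sqrt (by positivity)).symm
  rw [diskMode_zero, diskMode_zero, diskMode_one, diskMode_one, mul_pow, ← map_pow]
  have : (((n : ℕ) : ℂ)) = (((n : ℕ) : ℝ) : ℂ) := by push_cast; rfl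
  rw [this, Complex.div_ofReal_re, Complex.mul_re, Complex.conj_re, Complex.conj_im]
  nth_rewrite 5 [hn]
  field_simp
  ring

/-- The logarithmic series `-log |1 - ρ z w̄| = ∑ ρⁿ Re (z w̄)ⁿ / n`, written in modes. -/
lemma hasSum_diskMode {ρ : ℝ} (hρ0 : 0 ≤ ρ) (hρ : ρ ≤ 1) {z w : ℂ} (hz : ‖z‖ < 1) (hw : ‖w‖ < 1) :
    HasSum (fun n : ℕ+ => ρ ^ (n : ℕ) *
      (diskMode (n, 0) z * diskMode (n, 0) w + diskMode (n, 1) z * diskMode (n, 1) w))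
      (-Real.log ‖1 - ρ * (z * (starRingEnd ℂ) w)‖) := by
  have hζ : ‖(ρ : ℂ) * (z * (starRingEnd ℂ) w)‖ < 1 := by
    rw [norm_mul, norm_mul, Complex.norm_conj, Complex.norm_real, Real.norm_eq_abs,
      abs_of_nonneg hρ0]
    have h2 : ‖z‖ * ‖w‖ < 1 := mul_lt_one_of_nonneg_of_lt_one_left (norm_nonneg _) hz hw.le
    have h3 : 0 ≤ ‖z‖ * ‖w‖ := by positivity
    nlinarith
  have h := Complex.hasSum_re (Complex.hasSum_taylorSeries_neg_log hζ)
  rw [Complex.neg_re, Complex.log_re] at h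
  have h2 := (PNat.coe_injective.hasSum_iff (f := fun n : ℕ =>
    (((ρ : ℂ) * (z * (starRingEnd ℂ) w)) ^ n / (n : ℂ)).re) (a := -Real.log ‖1 - ρ * (z * (starRingEnd ℂ) w)‖)
    (fun n hn => ?_)).2 h
  · convert h2 using 2 with n
    simp only [Function.comp]
    rw [diskMode_mul_add, mul_pow (ρ : ℂ), mul_div_assoc, ← Complex.ofReal_pow,
      Complex.re_ofReal_mul]
  · have : n = 0 := by
      by_contra hne
      exact hn ⟨⟨n, Nat.pos_of_ne_zero hne⟩, rfl⟩
    simp [this]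

lemma one_sub_exp_sq_mem {n : ℕ} {t : ℝ} (ht : 0 ≤ t) :
    0 ≤ 1 - Real.exp (-(n * t)) ^ 2 ∧ 1 - Real.exp (-(n * t)) ^ 2 ≤ 1 := by
  have h1 : Real.exp (-(n * t)) ≤ 1 := Real.exp_le_one_iff.2 (by
    have : 0 ≤ (n : ℝ) * t := by positivity
    linarith)
  have h2 := Real.exp_pos (-(n * t))
  constructor <;> nlinarith

/-- The Green function of the dilated disk, up to a constant, differs from that of the disk by
the covariance of the harmonic modes. -/
lemma greenDisk_mul {q : Dilation} {t α : ℝ} (h : IsPolar q t α) (ht : 0 ≤ t) {z w : ℂ}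
    (hz : ‖z‖ < 1) (hw : ‖w‖ < 1) (hzw : z ≠ w) :
    greenDisk (q.1 * z) (q.1 * w) = t + greenDisk z w +
      ∑' i : ℕ+ × Fin 2, (1 - Real.exp (-(i.1 * t)) ^ 2) * (diskMode i z * diskMode i w) := by
  set ρ := Real.exp (-t) ^ 2
  have hρ0 : 0 ≤ ρ := by positivity
  have hexp : Real.exp (-t) ≤ 1 := Real.exp_le_one_iff.2 (by linarith)
  have hρ : ρ ≤ 1 := pow_le_one₀ (Real.exp_pos _).le hexp
  have hq : ‖q.1‖ ≠ 0 := norm_ne_zero_iff.2 q.2.1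
  have hmul : ∀ v : ℂ, ‖v‖ < 1 → ‖q.1 * v‖ < 1 := by
    intro v hv
    rw [norm_mul, h.norm]
    exact mul_lt_one_of_nonneg_of_lt_one_right hexp (norm_nonneg _) hv
  rw [greenDisk_eq (hmul z hz) (hmul w hw) (fun e => hzw (mul_left_cancel₀ q.2.1 e)),
    greenDisk_eq hz hw hzw, ← mul_sub, norm_mul, Real.log_mul hq
      (norm_ne_zero_iff.2 (sub_ne_zero.2 hzw)), h.norm, Real.log_exp]
  have e1 : q.1 * z * (starRingEnd ℂ) (q.1 * w) = (ρ : ℂ) * (z * (starRingEnd ℂ) w) := by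
    have : q.1 * (starRingEnd ℂ) q.1 = (ρ : ℂ) := by
      rw [Complex.mul_conj, Complex.normSq_eq_norm_sq, h.norm]
    rw [map_mul, ← this]
    ring
  have hsum := (hasSum_diskMode zero_le_one le_rfl hz hw).sub (hasSum_diskMode hρ0 hρ hz hw)
  have hS : Summable fun i : ℕ+ × Fin 2 =>
      (1 - Real.exp (-(i.1 * t)) ^ 2) * (diskMode i z * diskMode i w) := by
    refine Summable.of_norm_bounded (summable_modes_geometric (norm_nonneg z) hz) fun i => ?_
    have h1 := one_sub_exp_sq_mem (n := i.1) ht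
    rw [norm_mul, norm_mul, Real.norm_eq_abs, Real.norm_eq_abs, Real.norm_eq_abs,
      abs_of_nonneg h1.1]
    calc (1 - Real.exp (-(i.1 * t)) ^ 2) * (|diskMode i z| * |diskMode i w|)
        ≤ 1 * (‖z‖ ^ (i.1 : ℕ) * 1) := by
          gcongr
          · exact h1.2
          · exact abs_diskMode_le i z
          · exact (abs_diskMode_le i w).trans (pow_le_one₀ (norm_nonneg _) hw.le)
      _ = ‖z‖ ^ (i.1 : ℕ) := by ring
  have e2 : ∑' i : ℕ+ × Fin 2, (1 - Real.exp (-(i.1 * t)) ^ 2) * (diskMode i z * diskMode i w) =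
      -Real.log ‖1 - z * (starRingEnd ℂ) w‖ - -Real.log ‖1 - ρ * (z * (starRingEnd ℂ) w)‖ := by
    rw [tsum_modes hS]
    rw [Complex.ofReal_one, one_mul] at hsum
    rw [← hsum.tsum_eq]
    congr 1
    ext n
    have : Real.exp (-(n * t)) ^ 2 = ρ ^ (n : ℕ) := by
      simp only [ρ]
      rw [← Real.exp_nat_mul, ← Real.exp_nat_mul, ← Real.exp_nat_mul]
      congr 1
      push_cast
      ring
    simp only [this, one_pow]
    ring
  rw [e1, e2]
  ring

lemma greenForm_scale_eq (q : Dilation) (f g : TestFun) :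
    greenForm (scale q f) (scale q g) = ∫ z, ∫ w, f z * greenDisk (q.1 * z) (q.1 * w) * g w := by
  rw [greenForm]
  have e1 : ∀ z, ∫ w, scale q f z * greenDisk z w * scale q g w =
      (∫ w, greenDisk z (q.1 * w) * g w) * scale q f z := by
    intro z
    rw [integral_scale_mul q g (fun w => scale q f z * greenDisk z w), ← integral_mul_const]
    congr 1
    ext w
    ring
  simp only [e1]
  rw [integral_scale_mul q f (fun z => ∫ w, greenDisk z (q.1 * w) * g w)]
  congr 1
  ext z
  rw [← integral_mul_const]
  congr 1
  ext w
  ring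

lemma integrable_tsum_of_summable_integral_norm {α ι : Type*} [MeasurableSpace α] {μ : Measure α}
    [Countable ι] {F : ι → α → ℝ} (hm : ∀ i, Measurable (F i)) (hF : ∀ i, Integrable (F i) μ)
    (hs : Summable fun i => ∫ a, ‖F i a‖ ∂μ) : Integrable (fun a => ∑' i, F i a) μ := by
  refine ⟨(Measurable.tsum hm).aestronglyMeasurable, ?_⟩
  refine lt_of_le_of_lt (lintegral_mono fun a => enorm_tsum_le_tsum_enorm) ?_
  rw [lintegral_tsum fun i => (hm i).enorm.aemeasurable]
  simp only [← ofReal_integral_norm_eq_lintegral_enorm (hF _)]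
  exact hs.tsum_ofReal_lt_top

/-- Covariance of the dilated Dirichlet field: an independent constant of variance `t`, an
independent harmonic field, and a Dirichlet field. -/
lemma greenForm_scale {q : Dilation} {t α : ℝ} (h : IsPolar q t α) (ht : 0 ≤ t) (f g : TestFun) :
    greenForm (scale q f) (scale q g) = t * ((∫ z, f z) * ∫ z, g z) + greenForm f g +
      ∑' i : ℕ+ × Fin 2, (1 - Real.exp (-(i.1 * t)) ^ 2) * (coef i f * coef i g) := by
  obtain ⟨r, h0, h1, hr⟩ := exists_radius f
  obtain ⟨r', h0', h1', hr'⟩ := exists_radius g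
  set F : ℕ+ × Fin 2 → ℂ × ℂ → ℝ := fun i p => (1 - Real.exp (-(i.1 * t)) ^ 2) *
    ((diskMode i p.1 * f p.1) * (diskMode i p.2 * g p.2)) with hF
  have hFint : ∀ i, Integrable (F i) (volume.prod volume) := fun i =>
    ((integrable_diskMode_mul i f).mul_prod (integrable_diskMode_mul i g)).const_mul _
  have hFm : ∀ i, Measurable (F i) := fun i => by
    have hc : Continuous (F i) := by
      have hf := f.continuous
      have hg := g.continuous
      simp only [hF]
      fun_prop
    exact hc.measurable
  have hFsum : Summable fun i => ∫ p, ‖F i p‖ ∂(volume.prod volume) := by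
    have hI : 0 ≤ ∫ z, |f z| := integral_nonneg fun z => abs_nonneg _
    have hI' : 0 ≤ ∫ z, |g z| := integral_nonneg fun z => abs_nonneg _
    refine Summable.of_nonneg_of_le (fun i => integral_nonneg fun z => norm_nonneg _) (fun i => ?_)
      ((summable_modes_geometric h0 h1).mul_right ((∫ z, |f z|) * ∫ z, |g z|))
    have hc := one_sub_exp_sq_mem (n := i.1) ht
    have hn : ∀ p, ‖F i p‖ = ‖1 - Real.exp (-(i.1 * t)) ^ 2‖ *
        (‖diskMode i p.1 * f p.1‖ * ‖diskMode i p.2 * g p.2‖) := fun p => by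
      rw [← norm_mul, ← norm_mul]
    simp only [hn]
    rw [integral_const_mul, integral_prod_mul (fun z => ‖diskMode i z * f z‖)
      (fun z => ‖diskMode i z * g z‖), Real.norm_eq_abs, abs_of_nonneg hc.1]
    calc (1 - Real.exp (-(i.1 * t)) ^ 2) *
          ((∫ z, ‖diskMode i z * f z‖) * ∫ z, ‖diskMode i z * g z‖)
        ≤ 1 * ((r ^ (i.1 : ℕ) * ∫ z, |f z|) * (r' ^ (i.1 : ℕ) * ∫ z, |g z|)) := by
          have := integral_nonneg (μ := volume) (f := fun z : ℂ => ‖diskMode i z * g z‖)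
            fun z => norm_nonneg _
          have := integral_nonneg (μ := volume) (f := fun z : ℂ => ‖diskMode i z * f z‖)
            fun z => norm_nonneg _
          gcongr
          · exact hc.2
          · exact abs_coef_le hr i
          · exact abs_coef_le hr' i
      _ ≤ 1 * ((r ^ (i.1 : ℕ) * ∫ z, |f z|) * (1 * ∫ z, |g z|)) := by
          gcongr
          exact pow_le_one₀ h0' h1'.le
      _ = r ^ (i.1 : ℕ) * ((∫ z, |f z|) * ∫ z, |g z|) := by ring
  have hFtot := hasSum_integral_of_summable_integral_norm hFint hFsum
  have hFtsum : Integrable (fun p => ∑' i, F i p) (volume.prod volume) :=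
    integrable_tsum_of_summable_integral_norm hFm hFint hFsum
  set A : ℂ × ℂ → ℝ := fun p => t * (f p.1 * g p.2) with hA
  have hAint : Integrable A (volume.prod volume) :=
    ((integrable_testFun f).mul_prod (integrable_testFun g)).const_mul t
  have hae : (fun p : ℂ × ℂ => A p + f p.1 * greenDisk p.1 p.2 * g p.2 + ∑' i, F i p)
      =ᵐ[volume.prod volume] fun p => f p.1 * greenDisk (q.1 * p.1) (q.1 * p.2) * g p.2 := by
    filter_upwards [ae_ne_prod] with p hp
    by_cases hfz : f p.1 = 0
    · simp [hfz, hA, hF]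
    by_cases hgz : g p.2 = 0
    · simp [hgz, hA, hF]
    rw [greenDisk_mul h ht ((hr _ hfz).trans_lt h1) ((hr' _ hgz).trans_lt h1') hp]
    have e : ∑' i, F i p = f p.1 * (∑' i : ℕ+ × Fin 2, (1 - Real.exp (-(i.1 * t)) ^ 2) *
        (diskMode i p.1 * diskMode i p.2)) * g p.2 := by
      rw [← tsum_mul_left, ← tsum_mul_right]
      congr 1
      ext i
      simp only [hF]
      ring
    rw [e, hA]
    ring
  have hG := integrable_greenDisk f g
  have hint := (((hAint.add hG).add hFtsum).congr hae)
  rw [greenForm_scale_eq, ← integral_prod _ hint, ← integral_congr_ae hae,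
    integral_add (f := fun p => A p + f p.1 * greenDisk p.1 p.2 * g p.2) (hAint.add hG) hFtsum,
    integral_add hAint hG, ← greenForm_eq, ← hFtot.tsum_eq,
    integral_const_mul, integral_prod_mul (fun z => f z) (fun z => g z)]
  congr 2
  ext i
  simp only [hF]
  rw [integral_const_mul, integral_prod_mul (fun z => diskMode i z * f z)
    (fun z => diskMode i z * g z), coef, coef]

/-- The covariance form is invariant under rotations. -/
lemma greenForm_scale_rot (q : Dilation) (hq : ‖q.1‖ = 1) (f g : TestFun) :
    greenForm (scale q f) (scale q g) = greenForm f g := by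
  rw [greenForm_scale_eq, greenForm]
  have : ∀ z w, greenDisk (q.1 * z) (q.1 * w) = greenDisk z w := by
    intro z w
    rw [greenDisk, greenDisk, ← mul_sub, norm_mul, hq, one_mul]
    congr 4
    have h1 : q.1 * (starRingEnd ℂ) q.1 = 1 := by
      rw [Complex.mul_conj, Complex.normSq_eq_norm_sq, hq]; simp
    rw [map_mul]
    linear_combination (z * (starRingEnd ℂ) w) * h1
  simp only [this]

end Green

/-! ### The law of the dilated field -/

section FieldLaw

lemma integral_sum_testFun {κ : Type*} (s : Finset κ) (a : κ → ℝ) (f : κ → TestFun) :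
    ∫ z, (∑ k ∈ s, a k • f k) z = ∑ k ∈ s, a k * ∫ z, f k z := by
  simp only [sum_apply, smul_apply, smul_eq_mul]
  rw [integral_finsetSum _ fun k _ => (integrable_testFun (f k)).const_mul _]
  simp only [integral_const_mul]

lemma coef_sum {κ : Type*} (i : ℕ+ × Fin 2) (s : Finset κ) (a : κ → ℝ) (f : κ → TestFun) :
    coef i (∑ k ∈ s, a k • f k) = ∑ k ∈ s, a k * coef i (f k) := by
  simp only [coef, sum_apply, smul_apply, smul_eq_mul, Finset.mul_sum, mul_left_comm _ (a _)]
  rw [integral_finsetSum _ fun k _ => (integrable_diskMode_mul i (f k)).const_mul _]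
  simp only [integral_const_mul]

lemma scale_sum {κ : Type*} (q : Dilation) (s : Finset κ) (a : κ → ℝ) (f : κ → TestFun) :
    scale q (∑ k ∈ s, a k • f k) = ∑ k ∈ s, a k • scale q (f k) := by
  refine TestFunction.ext fun z => ?_
  simp only [scale_apply, sum_apply, smul_apply, smul_eq_mul, Finset.mul_sum]
  exact Finset.sum_congr rfl fun k _ => by ring

/-- The smeared harmonic extension as an infinite linear form in the modes; it agrees with
`∫ (Pφ) f` for tempered modes, and is measurable in the modes without exception. -/
noncomputable def harmPart (x : Modes) (f : TestFun) : ℝ := ∑' i, coef i f * x i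

lemma measurable_harmPart (f : TestFun) : Measurable fun x : Modes => harmPart x f :=
  Measurable.tsum fun i => (measurable_pi_apply i).const_mul _

lemma harmPart_sum {κ : Type*} {x : Modes} (hx : x ∈ tempered) (s : Finset κ) (a : κ → ℝ)
    (f : κ → TestFun) : harmPart x (∑ k ∈ s, a k • f k) = ∑ k ∈ s, a k * harmPart x (f k) := by
  simp only [harmPart, ← tsum_mul_left]
  rw [← Summable.tsum_finsetSum fun k _ => (summable_mul_coef (f k) hx).mul_left (a k)]
  congr 1
  ext i
  rw [coef_sum, Finset.sum_mul]
  exact Finset.sum_congr rfl fun k _ => by ring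

/-- The total field, with the harmonic extension in its everywhere measurable form. -/
noncomputable def totalField' {Ω : Type*} (Φ : Ω → DiskField) (p : Config) (ω : Ω) : DiskField :=
  fun f => p.1 * (∫ z, f z) + Φ ω f + harmPart p.2 f

lemma totalField_eq {Ω : Type*} {Φ : Ω → DiskField} {p : Config} (hp : p.2 ∈ tempered) (ω : Ω) :
    totalField Φ p ω = totalField' Φ p ω := by
  ext f
  rw [totalField, totalField', integral_harmonicExt_mul hp, harmPart]

variable {Ω : Type*} [MeasurableSpace Ω] {μ : Measure Ω} {Φ : Ω → DiskField}

lemma measurable_totalField' (hΦ : IsDirichletGFF Φ μ) :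
    Measurable fun z : Config × Ω => totalField' Φ z.1 z.2 := by
  refine measurable_pi_iff.2 fun f => ?_
  have h1 : Measurable fun z : Config × Ω => Φ z.2 f := (hΦ.measurable f).comp measurable_snd
  have h2 : Measurable fun z : Config × Ω => harmPart z.1.2 f :=
    (measurable_harmPart f).comp (measurable_snd.comp measurable_fst)
  exact (((measurable_fst.comp measurable_fst).mul_const _).add h1).add h2

variable [IsProbabilityMeasure μ]

/-- Characteristic functional of the Dirichlet field. -/
lemma integral_phase_gff (hΦ : IsDirichletGFF Φ μ) {κ : Type*} (s : Finset κ) (a : κ → ℝ)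
    (f : κ → TestFun) : ∫ ω, phase (∑ k ∈ s, a k * Φ ω (f k)) ∂μ =
      Real.exp (-(greenForm (∑ k ∈ s, a k • f k) (∑ k ∈ s, a k • f k) / 2)) := by
  have hgauss : HasGaussianLaw (fun ω => ∑ k ∈ s, a k * Φ ω (f k)) μ :=
    ((hΦ.gaussian.comp_right f).smul a).hasGaussianLaw_fun_sum (I := s)
  have hL2 : ∀ k, MemLp (fun ω => Φ ω (f k)) 2 μ := fun k =>
    (hΦ.gaussian.hasGaussianLaw_eval (f k)).memLp_two
  have hmean : ∫ ω, ∑ k ∈ s, a k * Φ ω (f k) ∂μ = 0 := by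
    rw [integral_finsetSum _ fun k _ => ((hL2 k).integrable one_le_two).const_mul _]
    simp [integral_const_mul, hΦ.mean]
  have hvar : Var[fun ω => ∑ k ∈ s, a k * Φ ω (f k); μ] =
      greenForm (∑ k ∈ s, a k • f k) (∑ k ∈ s, a k • f k) := by
    rw [variance_of_integral_eq_zero hgauss.aemeasurable hmean, greenForm_sum]
    have : ∀ ω, (∑ k ∈ s, a k * Φ ω (f k)) ^ 2 =
        ∑ k ∈ s, ∑ l ∈ s, a k * a l * (Φ ω (f k) * Φ ω (f l)) := by
      intro ω
      rw [sq, Finset.sum_mul_sum]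
      exact Finset.sum_congr rfl fun k _ => Finset.sum_congr rfl fun l _ => by ring
    simp only [this]
    have hint : ∀ k l, Integrable (fun ω => a k * a l * (Φ ω (f k) * Φ ω (f l))) μ := fun k l =>
      ((hL2 k).integrable_mul (hL2 l)).const_mul _
    rw [integral_finsetSum _ fun k _ => integrable_finsetSum _ fun l _ => hint k l]
    refine Finset.sum_congr rfl fun k _ => ?_
    rw [integral_finsetSum _ fun l _ => hint k l]
    refine Finset.sum_congr rfl fun l _ => ?_
    rw [integral_const_mul, hΦ.covariance]
    rfl
  have hmap := hgauss.map_eq_gaussianReal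
  rw [hmean, hvar] at hmap
  have hnn : 0 ≤ greenForm (∑ k ∈ s, a k • f k) (∑ k ∈ s, a k • f k) := by
    rw [← hvar]; exact variance_nonneg _ _
  have h1 := integral_map (f := fun y : ℝ => phase y) hgauss.aemeasurable
    continuous_phase.aestronglyMeasurable
  rw [← h1, hmap]
  have h2 := integral_phase_gaussianReal
    (greenForm (∑ k ∈ s, a k • f k) (∑ k ∈ s, a k • f k)).toNNReal 1
  simp only [one_mul] at h2
  rw [h2, Real.coe_toNNReal _ hnn]
  simp

/-- The law of the noise driving the dilation semigroup: a standard Gaussian for the constant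
mode and an independent copy of the modes. -/
noncomputable def noiseLaw : Measure (ℝ × Modes) := (gaussianReal 0 1).prod modesLaw

instance : IsProbabilityMeasure noiseLaw := by unfold noiseLaw; infer_instance

/-- The damping factor `e^{-nt}` of the mode `n`. -/
noncomputable def damp (t : ℝ) (i : ℕ+ × Fin 2) : ℝ := Real.exp (-(i.1 * t))

/-- The size `(1 - e^{-2nt})^{1/2}` of the noise in the mode `n`. -/
noncomputable def noiseSize (t : ℝ) (i : ℕ+ × Fin 2) : ℝ := Real.sqrt (1 - damp t i ^ 2)

lemma damp_sq_add_noiseSize_sq {t : ℝ} (ht : 0 ≤ t) (i : ℕ+ × Fin 2) :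
    damp t i ^ 2 + noiseSize t i ^ 2 = 1 := by
  have : 0 ≤ 1 - damp t i ^ 2 := (one_sub_exp_sq_mem (n := i.1) ht).1
  rw [noiseSize, Real.sq_sqrt this]
  ring

/-- One step of the Markov process with rotation: Brownian motion in the constant mode and an
Ornstein-Uhlenbeck process, turned by the angle `nα`, in the mode `n`. -/
noncomputable def flow (t α : ℝ) (p : Config) (η : ℝ × Modes) : Config :=
  (p.1 + Real.sqrt t * η.1,
    fun i => rotModes α (fun j => damp t j * p.2 j) i + noiseSize t i * η.2 i)

@[fun_prop]
lemma measurable_flow (t α : ℝ) : Measurable fun z : Config × (ℝ × Modes) => flow t α z.1 z.2 := by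
  refine Measurable.prodMk (by fun_prop) (measurable_pi_iff.2 fun i => ?_)
  have h1 : Measurable fun z : Config × (ℝ × Modes) => rotModes α (fun j => damp t j * z.1.2 j) :=
    (measurable_rotModes α).comp (by fun_prop)
  exact (measurable_pi_iff.1 h1 i).add (by fun_prop)

lemma damp_mul_mem_tempered {x : Modes} (hx : x ∈ tempered) {t : ℝ} (ht : 0 ≤ t) :
    (fun j => damp t j * x j) ∈ tempered := by
  refine Summable.of_nonneg_of_le (fun i => by positivity) (fun i => ?_) hx
  refine div_le_div_of_nonneg_right ?_ (by positivity)
  rw [abs_mul, damp, abs_of_nonneg (Real.exp_pos _).le]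
  refine mul_le_of_le_one_left (abs_nonneg _) (Real.exp_le_one_iff.2 ?_)
  have : (0 : ℝ) ≤ i.1 := by positivity
  nlinarith

lemma noiseSize_mul_mem_tempered {y : Modes} (hy : y ∈ tempered) (t : ℝ) :
    (fun j => noiseSize t j * y j) ∈ tempered := by
  refine Summable.of_nonneg_of_le (fun i => by positivity) (fun i => ?_) hy
  refine div_le_div_of_nonneg_right ?_ (by positivity)
  rw [abs_mul, noiseSize, abs_of_nonneg (Real.sqrt_nonneg _)]
  refine mul_le_of_le_one_left (abs_nonneg _) (Real.sqrt_le_one.2 ?_)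
  nlinarith [sq_nonneg (damp t i)]

lemma add_mem_tempered {x y : Modes} (hx : x ∈ tempered) (hy : y ∈ tempered) :
    (fun i => x i + y i) ∈ tempered := by
  refine Summable.of_nonneg_of_le (fun i => by positivity) (fun i => ?_) (hx.add hy)
  rw [← add_div]
  exact div_le_div_of_nonneg_right (abs_add_le _ _) (by positivity)

lemma harmPart_add {x y : Modes} (hx : x ∈ tempered) (hy : y ∈ tempered) (f : TestFun) :
    harmPart (fun i => x i + y i) f = harmPart x f + harmPart y f := by
  simp only [harmPart]
  rw [← (summable_mul_coef f hx).tsum_add (summable_mul_coef f hy)]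
  congr 1
  ext i
  ring

lemma flow_snd_mem_tempered {p : Config} (hp : p.2 ∈ tempered) {η : ℝ × Modes}
    (hη : η.2 ∈ tempered) {t : ℝ} (ht : 0 ≤ t) (α : ℝ) : (flow t α p η).2 ∈ tempered :=
  add_mem_tempered (rotModes_mem_tempered (damp_mul_mem_tempered hp ht) α)
    (noiseSize_mul_mem_tempered hη t)

lemma ae_noise_tempered : ∀ᵐ η ∂noiseLaw, η.2 ∈ tempered :=
  Measure.quasiMeasurePreserving_snd.ae ae_tempered

lemma harmPart_flow {q : Dilation} {t α : ℝ} (h : IsPolar q t α) (ht : 0 ≤ t) {p : Config}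
    (hp : p.2 ∈ tempered) {η : ℝ × Modes} (hη : η.2 ∈ tempered) (f : TestFun) :
    harmPart (flow t α p η).2 f =
      harmPart p.2 (scale q f) + ∑' i, (coef i f * noiseSize t i) * η.2 i := by
  rw [flow, harmPart_add (rotModes_mem_tempered (damp_mul_mem_tempered hp ht) α)
    (noiseSize_mul_mem_tempered hη t)]
  congr 1
  · exact (tsum_coef_scale h f hp ht).symm
  · simp only [harmPart, mul_assoc]

lemma integral_phase_noise {t : ℝ} (ht : 0 ≤ t) (k : ℝ) (f : TestFun) :
    ∫ η, phase (k * η.1 + ∑' i, (coef i f * noiseSize t i) * η.2 i) ∂noiseLaw =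
      Real.exp (-((k ^ 2 + ∑' i : ℕ+ × Fin 2, (1 - damp t i ^ 2) * (coef i f * coef i f)) / 2)) := by
  simp only [phase_add]
  have hsq : ∀ i, (coef i f * noiseSize t i) ^ 2 = (1 - damp t i ^ 2) * (coef i f * coef i f) := by
    intro i
    rw [← damp_sq_add_noiseSize_sq ht i]
    ring
  have hS : Summable fun i => (coef i f * noiseSize t i) ^ 2 := by
    refine Summable.of_nonneg_of_le (fun i => sq_nonneg _) (fun i => ?_) (summable_coef_sq f)
    rw [hsq i]
    have := sq_nonneg (damp t i * coef i f)
    nlinarith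
  rw [noiseLaw, integral_prod_mul (fun b : ℝ => phase (k * b))
    (fun y : Modes => phase (∑' i, (coef i f * noiseSize t i) * y i)), integral_phase_gaussianReal,
    integral_phase_tsum_modesLaw hS]
  · rw [← Complex.ofReal_mul, ← Real.exp_add]
    simp only [hsq]
    congr 2
    push_cast
    ring
  · filter_upwards [ae_tempered] with y hy
    refine (summable_mul_coef f (noiseSize_mul_mem_tempered hy t)).congr fun i => ?_
    ring

/-- The field `φ(q ·) + Q log |q|` with `φ = c + Φ + Pφ`, smeared with `f`. -/
noncomputable def dilatedField {Ω : Type*} (Φ : Ω → DiskField) (Q : ℝ) (q : Dilation) (p : Config) (ω : Ω) :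
    DiskField :=
  fun f => totalField' Φ p ω (scale q f) + Q * Real.log ‖q.1‖ * ∫ z, f z

/-- The dilated field is distributed as the total field over the randomly moved boundary data,
up to the drift of the constant mode. -/
lemma map_dilatedField (hΦ : IsDirichletGFF Φ μ) (Q : ℝ) {q : Dilation} {t α : ℝ}
    (h : IsPolar q t α) (ht : 0 ≤ t) {p : Config} (hp : p.2 ∈ tempered) :
    μ.map (dilatedField Φ Q q p) = (noiseLaw.prod μ).map
      (fun z => totalField' Φ (flow t α p (z.1.1 - Q * Real.sqrt t, z.1.2)) z.2) := by
  have hmL : Measurable (dilatedField Φ Q q p) := by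
    refine measurable_pi_iff.2 fun f => ?_
    have := measurable_pi_iff.1 ((measurable_totalField' hΦ).comp
      (measurable_const.prodMk measurable_id : Measurable fun ω : Ω => (p, ω))) (scale q f)
    exact this.add_const _
  have hmR : Measurable (fun z : (ℝ × Modes) × Ω =>
      totalField' Φ (flow t α p (z.1.1 - Q * Real.sqrt t, z.1.2)) z.2) := by
    have h1 : Measurable fun z : (ℝ × Modes) × Ω =>
        flow t α p (z.1.1 - Q * Real.sqrt t, z.1.2) :=
      (measurable_flow t α).comp (measurable_const.prodMk (by fun_prop))
    exact (measurable_totalField' hΦ).comp (h1.prodMk measurable_snd)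
  have := Measure.isProbabilityMeasure_map (μ := μ) hmL.aemeasurable
  have := Measure.isProbabilityMeasure_map (μ := noiseLaw.prod μ) hmR.aemeasurable
  refine ext_of_charFunctional fun s a => ?_
  have hphase : Measurable fun φ : DiskField => phase (∑ f ∈ s, a f * φ f) := by fun_prop
  rw [integral_map hmL.aemeasurable hphase.aestronglyMeasurable,
    integral_map hmR.aemeasurable hphase.aestronglyMeasurable]
  set g : TestFun := ∑ f ∈ s, a f • f with hg
  have hlog : Real.log ‖q.1‖ = -t := by rw [h.norm, Real.log_exp]
  have hIg : ∑ f ∈ s, a f * ∫ z, f z = ∫ z, g z := (integral_sum_testFun s a fun f => f).symm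
  have hL : ∀ ω, ∑ f ∈ s, a f * dilatedField Φ Q q p ω f =
      ((p.1 - Q * t) * ∫ z, g z) + harmPart p.2 (scale q g) + ∑ f ∈ s, a f * Φ ω (scale q f) := by
    intro ω
    rw [hg, scale_sum, harmPart_sum hp, ← hIg, Finset.mul_sum, ← Finset.sum_add_distrib,
      ← Finset.sum_add_distrib]
    refine Finset.sum_congr rfl fun f _ => ?_
    rw [dilatedField, totalField', integral_scale, hlog]
    ring
  have hR : ∀ z : (ℝ × Modes) × Ω, z.1.2 ∈ tempered →
      ∑ f ∈ s, a f * totalField' Φ (flow t α p (z.1.1 - Q * Real.sqrt t, z.1.2)) z.2 f =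
      ((p.1 - Q * t) * ∫ z, g z) + harmPart p.2 (scale q g) +
        ((Real.sqrt t * ∫ z, g z) * z.1.1 + ∑' i, (coef i g * noiseSize t i) * z.1.2 i)
        + ∑ f ∈ s, a f * Φ z.2 f := by
    intro z hz
    have hfl := harmPart_flow h ht hp (η := (z.1.1 - Q * Real.sqrt t, z.1.2)) hz g
    have hsum := harmPart_sum (flow_snd_mem_tempered hp (η := (z.1.1 - Q * Real.sqrt t, z.1.2)) hz
      ht α) s a fun f => f
    rw [← hg, hfl] at hsum
    simp only [totalField', mul_add, Finset.sum_add_distrib, ← hsum]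
    have h1 : ∑ f ∈ s, a f * ((flow t α p (z.1.1 - Q * Real.sqrt t, z.1.2)).1 * ∫ z, f z) =
        (p.1 + Real.sqrt t * (z.1.1 - Q * Real.sqrt t)) * ∫ z, g z := by
      rw [← hIg, Finset.mul_sum]
      exact Finset.sum_congr rfl fun f _ => by rw [flow]; ring
    rw [h1]
    have h2 : Real.sqrt t * Real.sqrt t = t := Real.mul_self_sqrt ht
    linear_combination (-Q * ∫ z, g z) * h2
  simp only [hL, phase_add _ (∑ f ∈ s, _)]
  rw [integral_const_mul, integral_phase_gff hΦ, ← scale_sum, ← hg]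
  have hae : ∀ᵐ z ∂(noiseLaw.prod μ), z.1.2 ∈ tempered :=
    Measure.quasiMeasurePreserving_fst.ae ae_noise_tempered
  have hcongr : (fun z : (ℝ × Modes) × Ω => phase (∑ f ∈ s, a f *
      totalField' Φ (flow t α p (z.1.1 - Q * Real.sqrt t, z.1.2)) z.2 f)) =ᵐ[noiseLaw.prod μ]
      fun z => (phase (((p.1 - Q * t) * ∫ z, g z) + harmPart p.2 (scale q g)) *
        phase ((Real.sqrt t * ∫ z, g z) * z.1.1 + ∑' i, (coef i g * noiseSize t i) * z.1.2 i)) *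
        phase (∑ f ∈ s, a f * Φ z.2 f) := by
    filter_upwards [hae] with z hz
    rw [hR z hz, phase_add, phase_add (_ + _)]
  rw [integral_congr_ae hcongr, integral_prod_mul (fun η : ℝ × Modes =>
    phase (((p.1 - Q * t) * ∫ z, g z) + harmPart p.2 (scale q g)) *
        phase ((Real.sqrt t * ∫ z, g z) * η.1 + ∑' i, (coef i g * noiseSize t i) * η.2 i))
    (fun ω => phase (∑ f ∈ s, a f * Φ ω f)), integral_const_mul, integral_phase_noise ht,
    integral_phase_gff hΦ s a fun f => f, mul_assoc, ← Complex.ofReal_mul, ← Real.exp_add,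
    greenForm_scale h ht]
  congr 3
  have h2 : Real.sqrt t ^ 2 = t := Real.sq_sqrt ht
  rw [mul_pow, h2, ← hg]
  simp only [damp]
  ring

end FieldLaw

/-! ### The transition operators -/

section Transition

lemma measurePreserving_prodProdProdComm {A B C D : Type*} [MeasurableSpace A]
    [MeasurableSpace B] [MeasurableSpace C] [MeasurableSpace D] (a : Measure A) (b : Measure B)
    (c : Measure C) (d : Measure D) [SFinite a] [SFinite b] [SFinite c] [SFinite d] :
    MeasurePreserving (fun z : (A × B) × (C × D) => ((z.1.1, z.2.1), (z.1.2, z.2.2)))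
      ((a.prod b).prod (c.prod d)) ((a.prod c).prod (b.prod d)) := by
  have h1 := measurePreserving_prodAssoc a b (c.prod d)
  have h2 := (measurePreserving_prodAssoc b c d).symm
  have h3 : MeasurePreserving (Prod.swap : B × C → C × B) (b.prod c) (c.prod b) :=
    Measure.measurePreserving_swap
  have h4 := measurePreserving_prodAssoc c b d
  have h5 := (measurePreserving_prodAssoc a c (b.prod d)).symm
  have h6 := (MeasurePreserving.id a).prod (h4.comp ((h3.prod (MeasurePreserving.id d)).comp h2))
  exact h5.comp (h6.comp h1)

lemma measurePreserving_gaussian_shift (r : ℝ) :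
    MeasurePreserving (fun z : ℝ × ℝ => (z.1 + r * z.2, -z.2))
      ((volume : Measure ℝ).prod (gaussianReal 0 1)) (volume.prod (gaussianReal 0 1)) := by
  have hneg : MeasurePreserving (fun b : ℝ => -b) (gaussianReal 0 1) (gaussianReal 0 1) :=
    ⟨measurable_neg, by rw [gaussianReal_map_neg, neg_zero]⟩
  have h1 : MeasurePreserving (fun z : ℝ × ℝ => (-z.1, z.2 + r * z.1))
      ((gaussianReal 0 1).prod (volume : Measure ℝ)) ((gaussianReal 0 1).prod volume) := by
    refine hneg.skew_product (g := fun b c => c + r * b) (by fun_prop) (ae_of_all _ fun b => ?_)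
    exact (measurePreserving_add_right volume (r * b)).map_eq
  exact (Measure.measurePreserving_swap.comp h1).comp Measure.measurePreserving_swap

/-- An involution of configuration and noise which exchanges the initial point and the endpoint
of a step of the process; it expresses the reversibility of the process. -/
noncomputable def timeReversal (t : ℝ) (z : Config × (ℝ × Modes)) : Config × (ℝ × Modes) :=
  ((z.1.1 + Real.sqrt t * z.2.1, fun i => damp t i * z.1.2 i + noiseSize t i * z.2.2 i),
    (-z.2.1, fun i => noiseSize t i * z.1.2 i - damp t i * z.2.2 i))

instance : SFinite configMeasure := by unfold configMeasure; infer_instance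

lemma measurePreserving_timeReversal {t : ℝ} (ht : 0 ≤ t) :
    MeasurePreserving (timeReversal t) (configMeasure.prod noiseLaw)
      (configMeasure.prod noiseLaw) := by
  have h1 := measurePreserving_prodProdProdComm (volume : Measure ℝ) modesLaw (gaussianReal 0 1)
    modesLaw
  have h2 := measurePreserving_prodProdProdComm (volume : Measure ℝ) (gaussianReal 0 1) modesLaw
    modesLaw
  have h3 := (measurePreserving_gaussian_shift (Real.sqrt t)).prod
    (measurePreserving_reflect (damp_sq_add_noiseSize_sq ht))
  exact h2.comp (h3.comp h1)

lemma flow_eq_fst_timeReversal (t : ℝ) (z : Config × (ℝ × Modes)) :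
    flow t 0 z.1 z.2 = (timeReversal t z).1 := by
  simp [flow, timeReversal, rotModes_zero]

lemma timeReversal_timeReversal {t : ℝ} (ht : 0 ≤ t) (z : Config × (ℝ × Modes)) :
    timeReversal t (timeReversal t z) = z := by
  have h := damp_sq_add_noiseSize_sq ht
  refine Prod.ext (Prod.ext ?_ (funext fun i => ?_)) (Prod.ext ?_ (funext fun i => ?_))
  · simp [timeReversal]
  · simp only [timeReversal]
    linear_combination (z.1.2 i) * h i
  · simp [timeReversal]
  · simp only [timeReversal]
    linear_combination (z.2.2 i) * h i

lemma damp_zero (i : ℕ+ × Fin 2) : damp 0 i = 1 := by simp [damp]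

lemma noiseSize_zero (i : ℕ+ × Fin 2) : noiseSize 0 i = 0 := by simp [noiseSize, damp_zero]

lemma flow_zero (α : ℝ) (p : Config) (η : ℝ × Modes) :
    flow 0 α p η = (p.1, rotModes α p.2) := by
  simp [flow, damp_zero, noiseSize_zero]

lemma measurePreserving_flow {t : ℝ} (ht : 0 ≤ t) :
    MeasurePreserving (fun z : Config × (ℝ × Modes) => flow t 0 z.1 z.2)
      (configMeasure.prod noiseLaw) configMeasure := by
  simp only [flow_eq_fst_timeReversal]
  exact measurePreserving_fst.comp (measurePreserving_timeReversal ht)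

/-- The square integrable functions of configuration and noise. -/
abbrev NoisySpace : Type := Lp ℂ 2 (configMeasure.prod noiseLaw)

/-- The isometry which ignores the noise. -/
noncomputable def ignoreNoise : StateSpace →ₗᵢ[ℂ] NoisySpace :=
  Lp.compMeasurePreservingₗᵢ ℂ Prod.fst measurePreserving_fst

/-- Composition with one step of the process. -/
noncomputable def moveBy (t : ℝ≥0) : StateSpace →ₗᵢ[ℂ] NoisySpace :=
  Lp.compMeasurePreservingₗᵢ ℂ _ (measurePreserving_flow t.coe_nonneg)

lemma lintegral_sq_le {X : Type*} [MeasurableSpace X] (ν : Measure X)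
    [IsProbabilityMeasure ν] {g : X → ℝ≥0∞} (hg : AEMeasurable g ν) :
    (∫⁻ x, g x ∂ν) ^ 2 ≤ ∫⁻ x, g x ^ 2 ∂ν := by
  have h := ENNReal.lintegral_mul_le_Lp_mul_Lq ν Real.HolderConjugate.two_two hg
    (aemeasurable_const (b := (1 : ℝ≥0∞)))
  simp only [Pi.mul_apply, mul_one, ENNReal.one_rpow, lintegral_const, measure_univ] at h
  calc (∫⁻ x, g x ∂ν) ^ 2 ≤ ((∫⁻ x, g x ^ (2 : ℝ) ∂ν) ^ (1 / 2 : ℝ)) ^ 2 := by gcongr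
    _ = ∫⁻ x, g x ^ (2 : ℝ) ∂ν := by
      rw [← ENNReal.rpow_natCast, ← ENNReal.rpow_mul]; norm_num
    _ = _ := by simp

lemma memLp_two_iff {X : Type*} [MeasurableSpace X] {ν : Measure X} {f : X → ℂ}
    (hf : AEStronglyMeasurable f ν) : MemLp f 2 ν ↔ ∫⁻ x, ‖f x‖ₑ ^ 2 ∂ν < ∞ := by
  have h := eLpNorm_lt_top_iff_lintegral_rpow_enorm_lt_top (f := f) (μ := ν) (p := 2)
    (by norm_num) (by norm_num)
  simp only [ENNReal.toReal_ofNat, ENNReal.rpow_ofNat] at h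
  rw [MemLp, h]
  exact and_iff_right hf

lemma memLp_integral_noise {g : Config × (ℝ × Modes) → ℂ}
    (hg : MemLp g 2 (configMeasure.prod noiseLaw)) :
    MemLp (fun p => ∫ η, g (p, η) ∂noiseLaw) 2 configMeasure := by
  have hfin := (memLp_two_iff hg.1).1 hg
  rw [memLp_two_iff hg.1.integral_prod_right']
  refine lt_of_le_of_lt ?_ hfin
  rw [lintegral_prod _ (hg.1.enorm.pow_const 2)]
  refine lintegral_mono_ae ?_
  filter_upwards [hg.1.prodMk_left] with p hp
  calc ‖∫ η, g (p, η) ∂noiseLaw‖ₑ ^ 2 ≤ (∫⁻ η, ‖g (p, η)‖ₑ ∂noiseLaw) ^ 2 := by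
        gcongr; exact enorm_integral_le_lintegral_enorm _
    _ ≤ _ := lintegral_sq_le noiseLaw hp.enorm

/-- Averaging over the noise is the adjoint of ignoring it. -/
lemma adjoint_ignoreNoise_apply {g : Config × (ℝ × Modes) → ℂ}
    (hg : MemLp g 2 (configMeasure.prod noiseLaw)) :
    ContinuousLinearMap.adjoint ignoreNoise.toContinuousLinearMap (hg.toLp g) =
      (memLp_integral_noise hg).toLp _ := by
  refine ext_inner_left ℂ fun ψ => ?_
  rw [ContinuousLinearMap.adjoint_inner_right, LinearIsometry.coe_toContinuousLinearMap,
    L2.inner_def, L2.inner_def]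
  have h1 : ignoreNoise ψ =ᵐ[configMeasure.prod noiseLaw] fun z => ψ z.1 :=
    Lp.coeFn_compMeasurePreserving ψ measurePreserving_fst
  have hint : Integrable (fun z : Config × (ℝ × Modes) => inner ℂ (ψ z.1) (g z))
      (configMeasure.prod noiseLaw) := by
    refine (L2.integrable_inner (𝕜 := ℂ) (ignoreNoise ψ) (hg.toLp g)).congr ?_
    filter_upwards [h1, hg.coeFn_toLp] with z hz hz'
    rw [hz, hz']
  calc ∫ z, inner ℂ (ignoreNoise ψ z) (hg.toLp g z) ∂(configMeasure.prod noiseLaw)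
      = ∫ z, inner ℂ (ψ z.1) (g z) ∂(configMeasure.prod noiseLaw) := by
        refine integral_congr_ae ?_
        filter_upwards [h1, hg.coeFn_toLp] with z hz hz'
        rw [hz, hz']
    _ = ∫ p, ∫ η, inner ℂ (ψ p) (g (p, η)) ∂noiseLaw ∂configMeasure := integral_prod _ hint
    _ = _ := by
        refine integral_congr_ae ?_
        filter_upwards [(memLp_integral_noise hg).coeFn_toLp] with p hp
        rw [hp]
        simp only [RCLike.inner_apply]
        rw [integral_mul_const]

/-- The semigroup: Brownian motion in the constant mode, killed at rate `Q² / 2`, and an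
Ornstein-Uhlenbeck process in the other modes. -/
noncomputable def semigroup (Q : ℝ) (t : ℝ≥0) : StateSpace →L[ℂ] StateSpace :=
  (Real.exp (-(Q ^ 2 * t / 2)) : ℂ) •
    (ContinuousLinearMap.adjoint ignoreNoise.toContinuousLinearMap).comp
      (moveBy t).toContinuousLinearMap

lemma semigroup_toLp (Q : ℝ) (t : ℝ≥0) {f : Config → ℂ} (hf : MemLp f 2 configMeasure) :
    semigroup Q t (hf.toLp f) =ᵐ[configMeasure]
      fun p => (Real.exp (-(Q ^ 2 * t / 2)) : ℂ) * ∫ η, f (flow t 0 p η) ∂noiseLaw := by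
  have h1 : moveBy t (hf.toLp f) = (hf.comp_measurePreserving (measurePreserving_flow t.coe_nonneg)).toLp _ :=
    rfl
  have h2 : semigroup Q t (hf.toLp f) = (Real.exp (-(Q ^ 2 * t / 2)) : ℂ) •
      (ContinuousLinearMap.adjoint ignoreNoise.toContinuousLinearMap) (moveBy t (hf.toLp f)) := rfl
  rw [h2, h1, adjoint_ignoreNoise_apply]
  refine (Lp.coeFn_smul _ _).trans ?_
  filter_upwards [(memLp_integral_noise
    (hf.comp_measurePreserving (measurePreserving_flow t.coe_nonneg))).coeFn_toLp] with p hp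
  rw [Pi.smul_apply, hp, smul_eq_mul]
  rfl

lemma norm_semigroup_le (Q : ℝ) (t : ℝ≥0) (ψ : StateSpace) : ‖semigroup Q t ψ‖ ≤ ‖ψ‖ := by
  have h2 : semigroup Q t ψ = (Real.exp (-(Q ^ 2 * t / 2)) : ℂ) •
      (ContinuousLinearMap.adjoint ignoreNoise.toContinuousLinearMap) (moveBy t ψ) := rfl
  rw [h2, norm_smul, Complex.norm_real, Real.norm_of_nonneg (Real.exp_pos _).le]
  have h3 : ‖ContinuousLinearMap.adjoint ignoreNoise.toContinuousLinearMap‖ ≤ 1 := by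
    rw [LinearIsometryEquiv.norm_map]
    exact ignoreNoise.norm_toContinuousLinearMap_le
  have h4 := (ContinuousLinearMap.adjoint ignoreNoise.toContinuousLinearMap).le_opNorm (moveBy t ψ)
  rw [(moveBy t).norm_map] at h4
  have h5 : Real.exp (-(Q ^ 2 * t / 2)) ≤ 1 := by
    refine Real.exp_le_one_iff.2 ?_
    have := t.2
    have : 0 ≤ Q ^ 2 * (t : ℝ) / 2 := by positivity
    linarith
  calc _ ≤ 1 * (1 * ‖ψ‖) := by
        gcongr
        exact h4.trans (by gcongr)
    _ = ‖ψ‖ := by ring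

lemma exists_toLp (ψ : StateSpace) : ∃ (f : Config → ℂ) (hf : MemLp f 2 configMeasure),
    hf.toLp f = ψ := ⟨ψ, Lp.memLp ψ, Lp.toLp_coeFn ψ (Lp.memLp ψ)⟩

/-- The semigroup is symmetric. It is a multiple of `ignoreNoise⋆ ∘ moveBy`, and the reversal of
time exchanges the starting point of the motion with its end point. -/
lemma inner_semigroup (Q : ℝ) (t : ℝ≥0) (ψ χ : StateSpace) :
    inner ℂ (semigroup Q t ψ) χ = inner ℂ ψ (semigroup Q t χ) := by
  have h2 : ∀ ψ, semigroup Q t ψ = (Real.exp (-(Q ^ 2 * t / 2)) : ℂ) •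
      (ContinuousLinearMap.adjoint ignoreNoise.toContinuousLinearMap) (moveBy t ψ) := fun _ => rfl
  let R : NoisySpace →ₗᵢ[ℂ] NoisySpace :=
    Lp.compMeasurePreservingₗᵢ ℂ _ (measurePreserving_timeReversal t.coe_nonneg)
  have h3 : ∀ ψ, R (ignoreNoise ψ) = moveBy t ψ := by
    intro ψ
    obtain ⟨f, hf, rfl⟩ := exists_toLp ψ
    change ((hf.comp_measurePreserving measurePreserving_fst).comp_measurePreserving
      (measurePreserving_timeReversal t.coe_nonneg)).toLp _ =
      (hf.comp_measurePreserving (measurePreserving_flow t.coe_nonneg)).toLp _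
    congr 1
    ext z
    simp [flow_eq_fst_timeReversal]
  have h4 : ∀ ψ, R (moveBy t ψ) = ignoreNoise ψ := by
    intro ψ
    obtain ⟨f, hf, rfl⟩ := exists_toLp ψ
    change ((hf.comp_measurePreserving (measurePreserving_flow t.coe_nonneg)).comp_measurePreserving
      (measurePreserving_timeReversal t.coe_nonneg)).toLp _ =
      (hf.comp_measurePreserving measurePreserving_fst).toLp _
    congr 1
    ext z
    simp [flow_eq_fst_timeReversal, timeReversal_timeReversal]
  rw [h2, h2, inner_smul_left, inner_smul_right, ContinuousLinearMap.adjoint_inner_left,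
    ContinuousLinearMap.adjoint_inner_right, Complex.conj_ofReal,
    LinearIsometry.coe_toContinuousLinearMap]
  congr 1
  rw [← R.inner_map_map, h4, h3]

lemma measurePreserving_rotate (α : ℝ) :
    MeasurePreserving (fun p : Config => (p.1, rotModes α p.2)) configMeasure configMeasure :=
  (MeasurePreserving.id volume).prod (measurePreserving_rotModes α)

/-- The rotation of the modes as a linear isometry of the state space. -/
noncomputable def rotate (α : ℝ) : StateSpace →ₗᵢ[ℂ] StateSpace :=
  Lp.compMeasurePreservingₗᵢ ℂ _ (measurePreserving_rotate α)

lemma rotate_toLp (α : ℝ) {f : Config → ℂ} (hf : MemLp f 2 configMeasure) :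
    rotate α (hf.toLp f) = (hf.comp_measurePreserving (measurePreserving_rotate α)).toLp _ := rfl

lemma rotate_zero (ψ : StateSpace) : rotate 0 ψ = ψ := by
  obtain ⟨f, hf, rfl⟩ := exists_toLp ψ
  rw [rotate_toLp]
  congr 1
  ext p
  simp [rotModes_zero]

lemma rotate_add (α β : ℝ) (ψ : StateSpace) : rotate (α + β) ψ = rotate α (rotate β ψ) := by
  obtain ⟨f, hf, rfl⟩ := exists_toLp ψ
  rw [rotate_toLp, rotate_toLp, rotate_toLp]
  congr 1
  ext p
  simp [add_comm α β, rotModes_add]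

/-- The rotation group. -/
noncomputable def rotationGroup (α : ℝ) : StateSpace ≃ₗᵢ[ℂ] StateSpace where
  toLinearEquiv := LinearEquiv.ofLinearMap (rotate α).toLinearMap (rotate (-α)).toLinearMap
    (by ext1 ψ; simp [← rotate_add, rotate_zero]) (by ext1 ψ; simp [← rotate_add, rotate_zero])
  norm_map' ψ := (rotate α).norm_map ψ

lemma rotationGroup_apply (α : ℝ) (ψ : StateSpace) : rotationGroup α ψ = rotate α ψ := rfl

end Transition

/-! ### The transition operators are induced by the dilations -/

section Induced

/-- The density which turns the drift of the constant mode into a weight. -/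
noncomputable def driftDensity (θ : ℝ) (η : ℝ × Modes) : ℝ≥0∞ :=
  ENNReal.ofReal (Real.exp (-θ * η.1 - θ ^ 2 / 2))

lemma measurable_driftDensity (θ : ℝ) : Measurable (driftDensity θ) := by
  unfold driftDensity
  fun_prop

lemma map_noiseLaw_sub (θ : ℝ) : noiseLaw.map (fun η => (η.1 - θ, η.2)) =
    noiseLaw.withDensity (driftDensity θ) := by
  have h1 := withDensity_gaussianReal_eq_map (-θ)
  have h2 : noiseLaw.withDensity (driftDensity θ) = ((gaussianReal 0 1).withDensity
      (fun b => ENNReal.ofReal (Real.exp (-θ * b - (-θ) ^ 2 / 2)))).prod modesLaw := by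
    rw [prod_withDensity_left (by fun_prop)]
    simp only [neg_sq]
    rfl
  have h3 := Measure.map_prod_map (gaussianReal 0 1) modesLaw (f := fun b : ℝ => b + -θ)
    (g := id) (by fun_prop) measurable_id
  rw [Measure.map_id] at h3
  rw [h2, h1, h3]
  simp only [sub_eq_add_neg]
  rfl

lemma flow_eq_flow_rotate (t α : ℝ) (p : Config) (η : ℝ × Modes) :
    flow t α p η = flow t 0 (p.1, rotModes α p.2) η := by
  refine Prod.ext rfl (ext_modes (fun n => ?_) (fun n => ?_)) <;>
  · simp only [flow, rotModes_apply_zero, rotModes_apply_one, mul_zero, Real.cos_zero,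
      Real.sin_zero, damp]
    ring

lemma measurePreserving_flow_rotate {t : ℝ} (ht : 0 ≤ t) (α : ℝ) :
    MeasurePreserving (fun z : Config × (ℝ × Modes) => flow t α z.1 z.2)
      (configMeasure.prod noiseLaw) configMeasure := by
  simp only [flow_eq_flow_rotate t α]
  exact (measurePreserving_flow ht).comp
    ((measurePreserving_rotate α).prod (MeasurePreserving.id noiseLaw))

lemma ae_config_tempered : ∀ᵐ p ∂configMeasure, p.2 ∈ tempered :=
  Measure.quasiMeasurePreserving_snd.ae ae_tempered

variable {Ω : Type*} [MeasurableSpace Ω] {μ : Measure Ω} {Φ : Ω → DiskField}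

/-- `e^{-Qc} 𝔼 F(c + Φ + Pφ)`, with the total field in its everywhere measurable form. -/
noncomputable def U' (μ : Measure Ω) (Φ : Ω → DiskField) (Q : ℝ) (F : DiskField → ℂ) (p : Config) :
    ℂ := Real.exp (-Q * p.1) * ∫ ω, F (totalField' Φ p ω) ∂μ

/-- `e^{-Qc} 𝔼 |F(c + Φ + Pφ)|`. -/
noncomputable def absU (μ : Measure Ω) (Φ : Ω → DiskField) (Q : ℝ) (F : DiskField → ℂ)
    (p : Config) : ℝ≥0∞ :=
  ENNReal.ofReal (Real.exp (-Q * p.1)) * ∫⁻ ω, ‖F (totalField' Φ p ω)‖ₑ ∂μ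

lemma admissible_iff {Q : ℝ} {F : DiskField → ℂ} : Admissible μ Φ Q F ↔
    Measurable F ∧ ∫⁻ p, absU μ Φ Q F p ^ 2 ∂configMeasure < ∞ := by
  refine and_congr_right fun _ => ?_
  rw [lintegral_congr_ae]
  filter_upwards [ae_config_tempered] with p hp
  simp only [absU, totalField_eq hp]

lemma U_ae_eq (Q : ℝ) (F : DiskField → ℂ) : U μ Φ Q F =ᵐ[configMeasure] U' μ Φ Q F := by
  filter_upwards [ae_config_tempered] with p hp
  simp only [U, U', totalField_eq hp]

lemma enorm_U'_le (Q : ℝ) (F : DiskField → ℂ) (p : Config) :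
    ‖U' μ Φ Q F p‖ₑ ≤ absU μ Φ Q F p := by
  rw [U', absU, enorm_mul, ← ofReal_norm, Complex.norm_real,
    Real.norm_of_nonneg (Real.exp_pos _).le]
  gcongr
  exact enorm_integral_le_lintegral_enorm _

lemma measurable_dilatedField (hΦ : IsDirichletGFF Φ μ) (Q : ℝ) (q : Dilation) (p : Config) :
    Measurable (dilatedField Φ Q q p) := by
  refine measurable_pi_iff.2 fun f => ?_
  have := measurable_pi_iff.1 ((measurable_totalField' hΦ).comp
    (measurable_const.prodMk measurable_id : Measurable fun ω : Ω => (p, ω))) (scale q f)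
  exact this.add_const _

lemma measurable_totalField'_flow (hΦ : IsDirichletGFF Φ μ) (t α : ℝ) (p : Config) :
    Measurable fun z : (ℝ × Modes) × Ω => totalField' Φ (flow t α p z.1) z.2 := by
  have h1 : Measurable fun z : (ℝ × Modes) × Ω => flow t α p z.1 :=
    (measurable_flow t α).comp (measurable_const.prodMk (by fun_prop))
  exact (measurable_totalField' hΦ).comp (h1.prodMk measurable_snd)

variable [IsProbabilityMeasure μ]

lemma measurable_absU (hΦ : IsDirichletGFF Φ μ) (Q : ℝ) {F : DiskField → ℂ} (hF : Measurable F) :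
    Measurable (absU μ Φ Q F) := by
  have h : Measurable fun p : Config => ∫⁻ ω, ‖F (totalField' Φ p ω)‖ₑ ∂μ :=
    (hF.comp (measurable_totalField' hΦ)).enorm.lintegral_prod_right'
  unfold absU
  exact Measurable.mul (by fun_prop) h

lemma stronglyMeasurable_U' (hΦ : IsDirichletGFF Φ μ) (Q : ℝ) {F : DiskField → ℂ}
    (hF : Measurable F) : StronglyMeasurable (U' μ Φ Q F) := by
  have h : StronglyMeasurable fun p : Config => ∫ ω, F (totalField' Φ p ω) ∂μ :=
    (hF.comp (measurable_totalField' hΦ)).stronglyMeasurable.integral_prod_right'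
  have h2 : Measurable fun p : Config => (Real.exp (-Q * p.1) : ℂ) := by fun_prop
  exact h2.stronglyMeasurable.mul h

lemma memLp_U' (hΦ : IsDirichletGFF Φ μ) {Q : ℝ} {F : DiskField → ℂ}
    (hF : Admissible μ Φ Q F) : MemLp (U' μ Φ Q F) 2 configMeasure := by
  rw [admissible_iff] at hF
  rw [memLp_two_iff (stronglyMeasurable_U' hΦ Q hF.1).aestronglyMeasurable]
  refine (lintegral_mono fun p => ?_).trans_lt hF.2
  exact pow_le_pow_left' (enorm_U'_le Q F p) 2

lemma measurable_dilate (Q : ℝ) (q : Dilation) {F : DiskField → ℂ} (hF : Measurable F) :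
    Measurable (dilate Q q F) := by
  refine hF.comp (measurable_pi_iff.2 fun f => ?_)
  exact (measurable_pi_apply _).add_const _

/-- The law of the dilated field, with the drift removed by a change of measure. -/
lemma map_dilatedField_withDensity (hΦ : IsDirichletGFF Φ μ) (Q : ℝ) {q : Dilation} {t α : ℝ}
    (h : IsPolar q t α) (ht : 0 ≤ t) {p : Config} (hp : p.2 ∈ tempered) :
    μ.map (dilatedField Φ Q q p) =
      ((noiseLaw.withDensity (driftDensity (Q * Real.sqrt t))).prod μ).map
        (fun z => totalField' Φ (flow t α p z.1) z.2) := by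
  have h1 := Measure.map_prod_map noiseLaw μ (f := fun η => (η.1 - Q * Real.sqrt t, η.2))
    (g := id) (by fun_prop) measurable_id
  rw [Measure.map_id] at h1
  rw [map_dilatedField hΦ Q h ht hp, ← map_noiseLaw_sub, h1,
    Measure.map_map (measurable_totalField'_flow hΦ t α p) (by fun_prop)]
  rfl

/-- The density that removes the drift is, up to the factor `exp (-Q² t / 2)`, the ratio of the
weights `exp (-Q c)` at the end and at the start of the motion. -/
lemma exp_mul_driftDensity (Q : ℝ) {t : ℝ} (ht : 0 ≤ t) (α : ℝ) (p : Config) (η : ℝ × Modes) :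
    ENNReal.ofReal (Real.exp (-Q * p.1)) * driftDensity (Q * Real.sqrt t) η =
      ENNReal.ofReal (Real.exp (-(Q ^ 2 * t / 2))) *
        ENNReal.ofReal (Real.exp (-Q * (flow t α p η).1)) := by
  rw [driftDensity, ← ENNReal.ofReal_mul (Real.exp_pos _).le,
    ← ENNReal.ofReal_mul (Real.exp_pos _).le, ← Real.exp_add, ← Real.exp_add, flow, mul_pow,
    Real.sq_sqrt ht]
  congr 2
  ring

lemma absU_dilate (hΦ : IsDirichletGFF Φ μ) (Q : ℝ) {F : DiskField → ℂ} (hF : Measurable F)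
    {q : Dilation} {t α : ℝ} (h : IsPolar q t α) (ht : 0 ≤ t) {p : Config} (hp : p.2 ∈ tempered) :
    absU μ Φ Q (dilate Q q F) p = ENNReal.ofReal (Real.exp (-(Q ^ 2 * t / 2))) *
      ∫⁻ η, absU μ Φ Q F (flow t α p η) ∂noiseLaw := by
  have hm := measurable_totalField'_flow hΦ t α p
  have h1 : ∫⁻ ω, ‖dilate Q q F (totalField' Φ p ω)‖ₑ ∂μ =
      ∫⁻ η, driftDensity (Q * Real.sqrt t) η *
        ∫⁻ ω, ‖F (totalField' Φ (flow t α p η) ω)‖ₑ ∂μ ∂noiseLaw := by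
    have h2 := lintegral_map (μ := μ) hF.enorm (measurable_dilatedField hΦ Q q p)
    refine h2.symm.trans ?_
    have hm' : Measurable fun z : (ℝ × Modes) × Ω => ‖F (totalField' Φ (flow t α p z.1) z.2)‖ₑ :=
      (hF.comp hm).enorm
    rw [map_dilatedField_withDensity hΦ Q h ht hp, lintegral_map hF.enorm hm,
      lintegral_prod _ hm'.aemeasurable,
      lintegral_withDensity_eq_lintegral_mul _ (measurable_driftDensity _)
        hm'.lintegral_prod_right']
    rfl
  have hm2 : Measurable fun η => ∫⁻ ω, ‖F (totalField' Φ (flow t α p η) ω)‖ₑ ∂μ :=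
    (hF.comp hm).enorm.lintegral_prod_right'
  have hm3 : Measurable fun η => absU μ Φ Q F (flow t α p η) :=
    (measurable_absU hΦ Q hF).comp ((measurable_flow t α).comp
      (measurable_const.prodMk measurable_id : Measurable fun η : ℝ × Modes => (p, η)))
  have hm4 : Measurable fun η => driftDensity (Q * Real.sqrt t) η *
      ∫⁻ ω, ‖F (totalField' Φ (flow t α p η) ω)‖ₑ ∂μ := (measurable_driftDensity _).mul hm2
  rw [absU, h1, ← lintegral_const_mul _ hm4, ← lintegral_const_mul _ hm3]
  refine lintegral_congr fun η => ?_
  rw [← mul_assoc, exp_mul_driftDensity Q ht α, absU, mul_assoc]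

lemma U'_dilate (hΦ : IsDirichletGFF Φ μ) (Q : ℝ) {F : DiskField → ℂ} (hF : Measurable F)
    {q : Dilation} {t α : ℝ} (h : IsPolar q t α) (ht : 0 ≤ t) {p : Config} (hp : p.2 ∈ tempered)
    (hfin : absU μ Φ Q (dilate Q q F) p < ∞) :
    U' μ Φ Q (dilate Q q F) p = (Real.exp (-(Q ^ 2 * t / 2)) : ℂ) *
      ∫ η, U' μ Φ Q F (flow t α p η) ∂noiseLaw := by
  have hm := measurable_totalField'_flow hΦ t α p
  have hmap := map_dilatedField_withDensity hΦ Q h ht hp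
  have hfin1 : ∫⁻ ω, ‖F (dilatedField Φ Q q p ω)‖ₑ ∂μ < ∞ :=
    ENNReal.lt_top_of_mul_ne_top_right hfin.ne
      (ENNReal.ofReal_pos.2 (Real.exp_pos (-Q * p.1))).ne'
  have hint : Integrable (fun z : (ℝ × Modes) × Ω => F (totalField' Φ (flow t α p z.1) z.2))
      ((noiseLaw.withDensity (driftDensity (Q * Real.sqrt t))).prod μ) := by
    refine ⟨(hF.comp hm).aestronglyMeasurable, ?_⟩
    rw [HasFiniteIntegral, ← lintegral_map hF.enorm hm, ← hmap,
      lintegral_map hF.enorm (measurable_dilatedField hΦ Q q p)]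
    exact hfin1
  have h1 : ∫ ω, dilate Q q F (totalField' Φ p ω) ∂μ =
      ∫ η, (driftDensity (Q * Real.sqrt t) η).toReal •
        ∫ ω, F (totalField' Φ (flow t α p η) ω) ∂μ ∂noiseLaw := by
    have h2 := integral_map (μ := μ) (measurable_dilatedField hΦ Q q p).aemeasurable
      hF.aestronglyMeasurable
    refine h2.symm.trans ?_
    rw [hmap, integral_map hm.aemeasurable hF.aestronglyMeasurable, integral_prod _ hint,
      integral_withDensity_eq_integral_toReal_smul (measurable_driftDensity _)
        (ae_of_all _ fun _ => ENNReal.ofReal_lt_top)]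
  rw [U', h1, ← integral_const_mul, ← integral_const_mul]
  refine integral_congr_ae (ae_of_all _ fun η => ?_)
  have h3 := congrArg ENNReal.toReal (exp_mul_driftDensity Q ht α p η)
  rw [ENNReal.toReal_mul, ENNReal.toReal_mul, ENNReal.toReal_ofReal (Real.exp_pos _).le,
    ENNReal.toReal_ofReal (Real.exp_pos _).le, ENNReal.toReal_ofReal (Real.exp_pos _).le] at h3
  simp only [U', Complex.real_smul]
  rw [← mul_assoc, ← mul_assoc, ← Complex.ofReal_mul, ← Complex.ofReal_mul, h3]

lemma admissible_dilate (hΦ : IsDirichletGFF Φ μ) {Q : ℝ} {F : DiskField → ℂ}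
    (hF : Admissible μ Φ Q F) {q : Dilation} {t α : ℝ} (h : IsPolar q t α) (ht : 0 ≤ t) :
    Admissible μ Φ Q (dilate Q q F) := by
  rw [admissible_iff] at hF ⊢
  refine ⟨measurable_dilate Q q hF.1, lt_of_le_of_lt ?_ hF.2⟩
  have hm := measurable_absU hΦ Q hF.1
  have hm' : Measurable fun z : Config × (ℝ × Modes) => absU μ Φ Q F (flow t α z.1 z.2) ^ 2 :=
    (hm.comp (measurable_flow t α)).pow_const 2
  rw [← (measurePreserving_flow_rotate ht α).lintegral_comp (hm.pow_const 2),
    lintegral_prod _ hm'.aemeasurable]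
  refine lintegral_mono_ae ?_
  filter_upwards [ae_config_tempered] with p hp
  rw [absU_dilate hΦ Q hF.1 h ht hp]
  have h1 : ENNReal.ofReal (Real.exp (-(Q ^ 2 * t / 2))) ≤ 1 := by
    rw [ENNReal.ofReal_le_one, Real.exp_le_one_iff]
    have : 0 ≤ Q ^ 2 * t / 2 := by positivity
    linarith
  have h2 : Measurable fun η => absU μ Φ Q F (flow t α p η) :=
    hm.comp ((measurable_flow t α).comp
      (measurable_const.prodMk measurable_id : Measurable fun η : ℝ × Modes => (p, η)))
  calc _ ≤ (1 * ∫⁻ η, absU μ Φ Q F (flow t α p η) ∂noiseLaw) ^ 2 := by gcongr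
    _ ≤ _ := by rw [one_mul]; exact lintegral_sq_le noiseLaw h2.aemeasurable

/-- The transition operators followed by the rotations are induced by the dilations. -/
theorem isInduced_of_isPolar (hΦ : IsDirichletGFF Φ μ) (Q : ℝ) {q : Dilation} {t : ℝ≥0} {α : ℝ}
    (h : IsPolar q t α) :
    IsInduced μ Φ Q q ((rotate α).toContinuousLinearMap.comp (semigroup Q t)) := by
  intro F hF
  have hSF := admissible_dilate hΦ hF h t.coe_nonneg
  have hU := memLp_U' hΦ hF
  have hU' := memLp_U' hΦ hSF
  refine ⟨hSF, hU.ae_eq (U_ae_eq Q F).symm, hU'.ae_eq (U_ae_eq Q _).symm, ?_⟩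
  rw [MemLp.toLp_congr _ hU (U_ae_eq Q F), MemLp.toLp_congr _ hU' (U_ae_eq Q _)]
  refine Lp.ext ?_
  have h1 : (rotate α) (semigroup Q t (hU.toLp _)) =ᵐ[configMeasure]
      fun p => semigroup Q t (hU.toLp _) (p.1, rotModes α p.2) :=
    Lp.coeFn_compMeasurePreserving _ (measurePreserving_rotate α)
  have h2 := (measurePreserving_rotate α).quasiMeasurePreserving.ae (semigroup_toLp Q t hU)
  have hSF' := admissible_iff.1 hSF
  have h3 : ∀ᵐ p ∂configMeasure, absU μ Φ Q (dilate Q q F) p ^ 2 < ∞ :=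
    ae_lt_top ((measurable_absU hΦ Q hSF'.1).pow_const 2) hSF'.2.ne
  refine h1.trans ?_
  filter_upwards [h2, h3, ae_config_tempered, hU'.coeFn_toLp] with p hp1 hp2 hp3 hp4
  rw [hp1, hp4, U'_dilate hΦ Q hF.1 h t.coe_nonneg hp3 (by simpa using hp2)]
  simp only [flow_eq_flow_rotate t α]

lemma isPolar_dil (t : ℝ≥0) : IsPolar (dil t) t 0 := by
  simp [IsPolar, dil]

lemma isPolar_rot (α : ℝ) : IsPolar (rot α) (0 : ℝ≥0) α := by
  simp [IsPolar, rot]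

lemma semigroup_zero (Q : ℝ) : semigroup Q 0 = ContinuousLinearMap.id ℂ StateSpace := by
  ext1 ψ
  obtain ⟨f, hf, rfl⟩ := exists_toLp ψ
  refine Lp.ext ((semigroup_toLp Q 0 hf).trans ?_)
  rw [ContinuousLinearMap.id_apply]
  filter_upwards [hf.coeFn_toLp] with p hp
  simp [flow_zero, rotModes_zero, hp]

lemma isInduced_semigroup (hΦ : IsDirichletGFF Φ μ) (Q : ℝ) (t : ℝ≥0) :
    IsInduced μ Φ Q (dil t) (semigroup Q t) := by
  have h := isInduced_of_isPolar hΦ Q (isPolar_dil t)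
  have h2 : (rotate 0).toContinuousLinearMap.comp (semigroup Q t) = semigroup Q t := by
    ext1 ψ
    exact rotate_zero _
  rwa [h2] at h

lemma isInduced_rotationGroup (hΦ : IsDirichletGFF Φ μ) (Q : ℝ) (α : ℝ) :
    IsInduced μ Φ Q (rot α) (rotationGroup α : StateSpace →L[ℂ] StateSpace) := by
  have h := isInduced_of_isPolar hΦ Q (isPolar_rot α)
  rw [semigroup_zero, ContinuousLinearMap.comp_id] at h
  exact h

end Induced

/-! ### Totality in the state space -/

section Totality

/-- The value of a polynomial in the coordinates. -/
noncomputable def polyEval (p : MvPolynomial (ℕ+ × Fin 2) ℂ) (x : Modes) : ℂ :=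
  MvPolynomial.eval (fun i => (x i : ℂ)) p

@[fun_prop]
lemma measurable_polyEval (p : MvPolynomial (ℕ+ × Fin 2) ℂ) : Measurable (polyEval p) := by
  induction p using MvPolynomial.induction_on with
  | C a =>
    have : polyEval (MvPolynomial.C a) = fun _ => a := by ext x; simp [polyEval]
    rw [this]; fun_prop
  | add p q hp hq =>
    have : polyEval (p + q) = fun x => polyEval p x + polyEval q x := by
      ext x; simp [polyEval]
    rw [this]; fun_prop
  | mul_X p i hp =>
    have : polyEval (p * MvPolynomial.X i) = fun x => polyEval p x * (x i : ℂ) := by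
      ext x; simp [polyEval]
    rw [this]; fun_prop

lemma memLp_polyEval (p : MvPolynomial (ℕ+ × Fin 2) ℂ) {r : ℝ≥0∞} (hr : r ≠ ∞) :
    MemLp (polyEval p) r modesLaw := by
  induction p using MvPolynomial.induction_on generalizing r with
  | C a =>
    have : polyEval (MvPolynomial.C a) = fun _ => a := by ext x; simp [polyEval]
    rw [this]; exact memLp_const a
  | add p q hp hq =>
    have : polyEval (p + q) = polyEval p + polyEval q := by
      ext x; simp [polyEval]
    rw [this]; exact (hp hr).add (hq hr)
  | mul_X p i hp =>
    have h1 : polyEval (p * MvPolynomial.X i) = fun x => polyEval p x * (x i : ℂ) := by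
      ext x; simp [polyEval]
    have h2 : MemLp (fun x : Modes => (x i : ℂ)) (r * 2) modesLaw := by
      have h := (memLp_id_gaussianReal' (μ := 0) (v := 1) (r * 2)
        (ENNReal.mul_ne_top hr (by simp))).ofReal (K := ℂ)
      exact h.comp_measurePreserving (measurePreserving_eval_modesLaw i)
    have : ENNReal.HolderTriple (r * 2) (r * 2) r := by
      constructor
      rw [ENNReal.mul_inv (Or.inr (by simp)) (Or.inr (by simp)), ← mul_add,
        ENNReal.inv_two_add_inv_two, mul_one]
    rw [h1]
    exact h2.mul' (hp (r := r * 2) (ENNReal.mul_ne_top hr (by simp)))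

lemma memLp_tensor {u : ℝ → ℂ} {g : Modes → ℂ} (hu : MemLp u 2 volume) (hg : MemLp g 2 modesLaw) :
    MemLp (fun p : Config => u p.1 * g p.2) 2 configMeasure := by
  have hm : AEStronglyMeasurable (fun p : Config => u p.1 * g p.2) configMeasure :=
    hu.1.comp_fst.mul hg.1.comp_snd
  rw [memLp_two_iff hm]
  have h : ∀ p : Config, ‖u p.1 * g p.2‖ₑ ^ 2 = ‖u p.1‖ₑ ^ 2 * ‖g p.2‖ₑ ^ 2 := fun p => by
    rw [enorm_mul, mul_pow]
  simp only [h]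
  rw [configMeasure, lintegral_prod_mul (f := fun c => ‖u c‖ₑ ^ 2) (g := fun x => ‖g x‖ₑ ^ 2)
    (hu.1.enorm.pow_const 2) (hg.1.enorm.pow_const 2)]
  exact ENNReal.mul_lt_top ((memLp_two_iff hu.1).1 hu) ((memLp_two_iff hg.1).1 hg)

lemma ae_eq_zero_of_charFunctional_real {ι : Type*} {ν : Measure (ℝ × (ι → ℝ))}
    {h : ℝ × (ι → ℝ) → ℝ} (hh : Integrable h ν)
    (h0 : ∀ (k : ℝ) (s : Finset ι) (a : ι → ℝ),
      ∫ x, (h x : ℂ) * phase (k * x.1 + ∑ i ∈ s, a i * x.2 i) ∂ν = 0) : h =ᵐ[ν] 0 := by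
  have hf1 := isFiniteMeasure_withDensity_ofReal hh.2
  have hf2 := isFiniteMeasure_withDensity_ofReal hh.neg.2
  have hm1 : AEMeasurable (fun x => ENNReal.ofReal (h x)) ν := hh.aemeasurable.ennreal_ofReal
  have hm2 : AEMeasurable (fun x => ENNReal.ofReal ((-h) x)) ν :=
    hh.neg.aemeasurable.ennreal_ofReal
  have hb : ∀ (g : ℝ × (ι → ℝ) → ℝ), Integrable g ν → ∀ (k : ℝ) (s : Finset ι) (a : ι → ℝ),
      Integrable (fun x => ((max (g x) 0 : ℝ) : ℂ) * phase (k * x.1 + ∑ i ∈ s, a i * x.2 i)) ν := by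
    intro g hg k s a
    have hp : Measurable fun x : ℝ × (ι → ℝ) =>
      phase (k * x.1 + ∑ i ∈ s, a i * x.2 i) := by fun_prop
    exact hg.pos_part.ofReal.mul_bdd (c := 1) hp.aestronglyMeasurable
      (ae_of_all _ fun x => (norm_phase _).le)
  have key : ν.withDensity (fun x => ENNReal.ofReal (h x)) =
      ν.withDensity (fun x => ENNReal.ofReal ((-h) x)) := by
    refine ext_of_charFunctional_real_prod fun k s a => ?_
    rw [integral_withDensity_eq_integral_toReal_smul₀ hm1
        (ae_of_all _ fun _ => ENNReal.ofReal_lt_top),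
      integral_withDensity_eq_integral_toReal_smul₀ hm2
        (ae_of_all _ fun _ => ENNReal.ofReal_lt_top), ← sub_eq_zero, ← integral_sub, ← h0 k s a]
    · refine integral_congr_ae (ae_of_all _ fun x => ?_)
      simp only [Pi.neg_apply, ENNReal.toReal_ofReal', Complex.real_smul]
      rw [← sub_mul, ← Complex.ofReal_sub, max_zero_sub_max_neg_zero_eq_self]
    · exact (hb _ hh k s a).congr (ae_of_all _ fun x => by simp [ENNReal.toReal_ofReal'])
    · exact (hb _ hh.neg k s a).congr (ae_of_all _ fun x => by simp [ENNReal.toReal_ofReal'])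
  have hfin : ∫⁻ x, ENNReal.ofReal (h x) ∂ν ≠ ∞ :=
    ((lintegral_mono fun x => Real.ofReal_le_enorm (h x)).trans_lt hh.2).ne
  filter_upwards [(withDensity_eq_iff hm1 hm2 hfin).1 key] with x hx
  have h1 := congrArg ENNReal.toReal hx
  rw [ENNReal.toReal_ofReal', ENNReal.toReal_ofReal'] at h1
  have h2 := max_zero_sub_max_neg_zero_eq_self (h x)
  simp only [Pi.neg_apply] at h1
  simp only [Pi.zero_apply]
  linarith

/-- An integrable function whose Fourier transform vanishes is zero. -/
lemma ae_eq_zero_of_charFunctional {ι : Type*} {ν : Measure (ℝ × (ι → ℝ))}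
    {h : ℝ × (ι → ℝ) → ℂ} (hh : Integrable h ν)
    (h0 : ∀ (k : ℝ) (s : Finset ι) (a : ι → ℝ),
      ∫ x, h x * phase (k * x.1 + ∑ i ∈ s, a i * x.2 i) ∂ν = 0) : h =ᵐ[ν] 0 := by
  have hb : ∀ (g : ℝ × (ι → ℝ) → ℂ), Integrable g ν → ∀ (k : ℝ) (s : Finset ι) (a : ι → ℝ),
      Integrable (fun x => g x * phase (k * x.1 + ∑ i ∈ s, a i * x.2 i)) ν := by
    intro g hg k s a
    have hp : Measurable fun x : ℝ × (ι → ℝ) =>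
      phase (k * x.1 + ∑ i ∈ s, a i * x.2 i) := by fun_prop
    exact hg.mul_bdd (c := 1) hp.aestronglyMeasurable (ae_of_all _ fun x => (norm_phase _).le)
  have hconj : Integrable (fun x => (starRingEnd ℂ) (h x)) ν :=
    Complex.conjLIE.toContinuousLinearEquiv.toContinuousLinearMap.integrable_comp hh
  have h0' : ∀ (k : ℝ) (s : Finset ι) (a : ι → ℝ),
      ∫ x, (starRingEnd ℂ) (h x) * phase (k * x.1 + ∑ i ∈ s, a i * x.2 i) ∂ν = 0 := by
    intro k s a
    have h1 := congrArg (starRingEnd ℂ) (h0 (-k) s fun i => -a i)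
    rw [← integral_conj, map_zero] at h1
    rw [← h1]
    refine integral_congr_ae (ae_of_all _ fun x => ?_)
    simp only [map_mul, ← phase_neg]
    congr 2
    simp only [neg_mul, Finset.sum_neg_distrib]
    ring
  have hre := ae_eq_zero_of_charFunctional_real (ν := ν) (h := fun x => (h x).re) hh.re
    fun k s a => by
      have h1 := congrArg₂ (· + ·) (h0 k s a) (h0' k s a)
      beta_reduce at h1
      rw [← integral_add (hb _ hh k s a) (hb _ hconj k s a), add_zero] at h1
      simp only [← add_mul, Complex.add_conj] at h1
      simp only [Complex.ofReal_mul, Complex.ofReal_ofNat, mul_assoc] at h1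
      rw [integral_const_mul] at h1
      exact (mul_eq_zero.1 h1).resolve_left two_ne_zero
  have him := ae_eq_zero_of_charFunctional_real (ν := ν) (h := fun x => (h x).im) hh.im
    fun k s a => by
      have h1 := congrArg₂ (· - ·) (h0 k s a) (h0' k s a)
      beta_reduce at h1
      rw [← integral_sub (hb _ hh k s a) (hb _ hconj k s a), sub_zero] at h1
      have h2 : ∀ x, h x * phase (k * x.1 + ∑ i ∈ s, a i * x.2 i) - (starRingEnd ℂ) (h x) *
          phase (k * x.1 + ∑ i ∈ s, a i * x.2 i) = (2 * Complex.I) * (((h x).im : ℂ) *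
          phase (k * x.1 + ∑ i ∈ s, a i * x.2 i)) := by
        intro x
        rw [← sub_mul, Complex.sub_conj]
        push_cast
        ring
      simp only [h2] at h1
      rw [integral_const_mul] at h1
      exact (mul_eq_zero.1 h1).resolve_left (by simp)
  filter_upwards [hre, him] with x h1 h2
  exact Complex.ext h1 h2

lemma memLp_exp_abs_sum (s : Finset (ℕ+ × Fin 2)) (a : ℕ+ × Fin 2 → ℝ) :
    MemLp (fun x : Modes => (Real.exp |∑ i ∈ s, a i * x i| : ℂ)) 2 modesLaw := by
  have hm : AEStronglyMeasurable (fun x : Modes => (Real.exp |∑ i ∈ s, a i * x i| : ℂ))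
      modesLaw := by
    have : Measurable (fun x : Modes => (Real.exp |∑ i ∈ s, a i * x i| : ℂ)) := by fun_prop
    exact this.aestronglyMeasurable
  have hind : iIndepFun (fun i (x : Modes) => a i * x i) modesLaw :=
    iIndepFun_infinitePi (P := fun _ : ℕ+ × Fin 2 => gaussianReal 0 1)
      (X := fun i y => a i * y) (fun i => by fun_prop)
  have hint : ∀ t : ℝ, Integrable (fun x : Modes => Real.exp (t * ∑ i ∈ s, a i * x i)) modesLaw := by
    intro t
    have h := hind.integrable_exp_mul_sum (t := t) (s := s) (fun i => by fun_prop) fun i _ => by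
      have h1 := integrable_exp_mul_gaussianReal (μ := 0) (v := 1) (t * a i)
      have h2 := (measurePreserving_eval_modesLaw i).integrable_comp_of_integrable h1
      refine h2.congr (ae_of_all _ fun x => ?_)
      simp [mul_assoc]
    simpa using h
  rw [memLp_two_iff_integrable_sq_norm hm]
  refine Integrable.mono' ((hint 2).add (hint (-2))) ?_ (ae_of_all _ fun x => ?_)
  · exact (hm.norm.pow 2)
  · simp only [Pi.add_apply, Complex.norm_real, norm_pow, Real.norm_eq_abs, Real.abs_exp]
    rw [← Real.exp_nat_mul]
    rcases abs_cases (∑ i ∈ s, a i * x i) with h | h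
    · rw [h.1]
      have := Real.exp_pos (-2 * ∑ i ∈ s, a i * x i)
      push_cast
      linarith
    · rw [h.1]
      have := Real.exp_pos (2 * ∑ i ∈ s, a i * x i)
      have h2 : ((2 : ℕ) : ℝ) * -∑ i ∈ s, a i * x i = -2 * ∑ i ∈ s, a i * x i := by push_cast; ring
      rw [h2]
      linarith

/-- The functions `u(c) p(φ)` are total in the state space. -/
lemma ae_eq_zero_of_integral_tensor {ψ : Config → ℂ} (hψ : MemLp ψ 2 configMeasure)
    (h : ∀ (u : SchwartzMap ℝ ℂ) (p : MvPolynomial (ℕ+ × Fin 2) ℂ),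
      ∫ y, ψ y * (u y.1 * polyEval p y.2) ∂configMeasure = 0) : ψ =ᵐ[configMeasure] 0 := by
  have hprod : ∀ {f : Config → ℂ}, MemLp f 2 configMeasure →
      Integrable (fun y => ψ y * f y) configMeasure := fun hf => hψ.integrable_mul hf
  -- the power series of the character in the modes converges in the mean
  have key : ∀ (u : SchwartzMap ℝ ℂ) (s : Finset (ℕ+ × Fin 2)) (a : ℕ+ × Fin 2 → ℝ),
      ∫ y, ψ y * (u y.1 * phase (∑ i ∈ s, a i * y.2 i)) ∂configMeasure = 0 := by
    intro u s a
    have hu : MemLp u 2 volume := u.memLp 2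
    set L : Modes → ℝ := fun x => ∑ i ∈ s, a i * x i with hL
    set p : ℕ → MvPolynomial (ℕ+ × Fin 2) ℂ := fun n =>
      MvPolynomial.C (Complex.I ^ n / (n.factorial : ℂ)) *
        (∑ i ∈ s, MvPolynomial.C (a i : ℂ) * MvPolynomial.X i) ^ n with hp
    have hpe : ∀ n x, polyEval (p n) x = (L x * Complex.I) ^ n / (n.factorial : ℂ) := by
      intro n x
      simp only [hp, hL, polyEval, map_mul, map_pow, map_sum, MvPolynomial.eval_C,
        MvPolynomial.eval_X]
      push_cast
      rw [mul_pow]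
      ring
    have hsum := hasSum_integral_of_dominated_convergence (μ := configMeasure)
      (F := fun n y => ψ y * (u y.1 * polyEval (p n) y.2))
      (f := fun y => ψ y * (u y.1 * phase (L y.2)))
      (fun n y => ‖ψ y * u y.1‖ * (|L y.2| ^ n / n.factorial))
      (fun n => (hprod (memLp_tensor hu (memLp_polyEval (p n) (by simp)))).1)
      (fun n => ae_of_all _ fun y => by
        rw [← mul_assoc, norm_mul, hpe]
        simp)
      (ae_of_all _ fun y => (Real.summable_pow_div_factorial _).mul_left _)
      (by
        have h1 := (hprod (memLp_tensor hu (memLp_exp_abs_sum s a))).norm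
        refine h1.congr (ae_of_all _ fun y => ?_)
        simp only
        rw [tsum_mul_left, ← mul_assoc, norm_mul (ψ y * u y.1), Complex.norm_real,
          Real.norm_of_nonneg (Real.exp_pos _).le, Real.exp_eq_exp_ℝ,
          NormedSpace.exp_eq_tsum_div])
      (ae_of_all _ fun y => by
        have h1 : HasSum (fun n => polyEval (p n) y.2) (phase (L y.2)) := by
          simp only [hpe, phase, Complex.exp_eq_exp_ℂ]
          exact NormedSpace.expSeries_div_hasSum_exp _
        exact (h1.mul_left _).mul_left _)
    refine hsum.unique ?_
    simp only [h]
    exact hasSum_zero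
  -- smooth cutoffs in the constant mode
  let b : ℕ → ContDiffBump (0 : ℝ) := fun n => ⟨n + 1, n + 2, by positivity, by linarith⟩
  have hcut : ∀ n, (fun y : Config => ψ y * (b n y.1 : ℂ)) =ᵐ[configMeasure] 0 := by
    intro n
    have hmod : ∀ k : ℝ, ∃ u : SchwartzMap ℝ ℂ, ∀ c, u c = (b n c : ℂ) * phase (k * c) := by
      intro k
      have hc : HasCompactSupport fun c : ℝ => (b n c : ℂ) * phase (k * c) :=
        ((b n).hasCompactSupport.comp_left Complex.ofReal_zero).mul_right
      have hs : ContDiff ℝ ((⊤ : ℕ∞) : WithTop ℕ∞) fun c : ℝ => (b n c : ℂ) * phase (k * c) := by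
        refine (Complex.ofRealCLM.contDiff.comp (b n).contDiff).mul ?_
        unfold phase
        have : ContDiff ℝ ((⊤ : ℕ∞) : WithTop ℕ∞) fun c : ℝ => ((k * c : ℝ) : ℂ) :=
          Complex.ofRealCLM.contDiff.comp (contDiff_const.mul contDiff_id)
        exact (this.mul contDiff_const).cexp
      exact ⟨hc.toSchwartzMap hs, fun c => rfl⟩
    refine ae_eq_zero_of_charFunctional ?_ fun k s a => ?_
    · obtain ⟨u, hu⟩ := hmod 0
      have h1 := hprod (memLp_tensor (u.memLp 2) (memLp_polyEval 1 (by simp)))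
      refine h1.congr (ae_of_all _ fun y => ?_)
      simp [hu, phase_zero, polyEval]
    · obtain ⟨u, hu⟩ := hmod k
      rw [← key u s a]
      refine integral_congr_ae (ae_of_all _ fun y => ?_)
      simp only [hu, phase_add]
      ring
  filter_upwards [ae_all_iff.2 hcut] with y hy
  obtain ⟨n, hn⟩ := exists_nat_gt |y.1|
  have h1 := hy n
  have h2 : b n y.1 = 1 := by
    refine (b n).one_of_mem_closedBall ?_
    simp only [b, mem_closedBall_zero_iff, Real.norm_eq_abs]
    linarith
  simpa [h2] using h1

end Totality

/-! ### Test functions dual to the modes -/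

section DualTestFunctions

/-- A smooth radial weight supported in a smaller disk. -/
noncomputable def radialWeight (z : ℂ) : ℝ := expNegInvGlue (1 / 2 - ‖z‖ ^ 2)

lemma radialWeight_nonneg (z : ℂ) : 0 ≤ radialWeight z := expNegInvGlue.nonneg _

lemma contDiff_radialWeight : ContDiff ℝ ((⊤ : ℕ∞) : WithTop ℕ∞) radialWeight :=
  expNegInvGlue.contDiff.comp (contDiff_const.sub (contDiff_norm_sq ℝ))

lemma norm_sq_le_of_radialWeight_ne_zero {z : ℂ} (hz : radialWeight z ≠ 0) :
    ‖z‖ ^ 2 ≤ 1 / 2 := by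
  by_contra h
  exact hz (expNegInvGlue.zero_of_nonpos (by linarith))

lemma radialWeight_mul {q : ℂ} (hq : ‖q‖ = 1) (z : ℂ) : radialWeight (q * z) = radialWeight z := by
  simp [radialWeight, hq]

lemma tsupport_radialWeight_mul_subset (h : ℂ → ℝ) :
    tsupport (fun z => radialWeight z * h z) ⊆ Metric.closedBall 0 (Real.sqrt (1 / 2)) := by
  refine closure_minimal (fun z hz => ?_) Metric.isClosed_closedBall
  have := norm_sq_le_of_radialWeight_ne_zero (left_ne_zero_of_mul hz)
  rw [mem_closedBall_zero_iff]
  exact Real.le_sqrt_of_sq_le this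

/-- The test function given by a smooth function times the radial weight. -/
noncomputable def radialCutoff (h : ℂ → ℝ) (hh : ContDiff ℝ ((⊤ : ℕ∞) : WithTop ℕ∞) h) :
    TestFun where
  toFun z := radialWeight z * h z
  contDiff' := contDiff_radialWeight.mul hh
  hasCompactSupport' :=
    (isCompact_closedBall 0 _).of_isClosed_subset (isClosed_tsupport _)
      (tsupport_radialWeight_mul_subset h)
  tsupport_subset' := (tsupport_radialWeight_mul_subset h).trans <| by
    refine Metric.closedBall_subset_ball ?_
    rw [Real.sqrt_lt' one_pos]
    norm_num

lemma radialCutoff_apply (h : ℂ → ℝ) (hh) (z : ℂ) :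
    radialCutoff h hh z = radialWeight z * h z := rfl

lemma integrable_radialWeight_mul {h : ℂ → ℝ} (hh : Continuous h) :
    Integrable fun z => radialWeight z * h z :=
  (contDiff_radialWeight.continuous.mul hh).integrable_of_hasCompactSupport
    ((isCompact_closedBall 0 _).of_isClosed_subset (isClosed_tsupport _)
      (tsupport_radialWeight_mul_subset h))

lemma integral_radialWeight_mul_pos {h : ℂ → ℝ} (hh : Continuous h) (h0 : ∀ z, 0 ≤ h z) {z : ℂ}
    (hz : ‖z‖ ^ 2 < 1 / 2) (hz' : h z ≠ 0) : 0 < ∫ z, radialWeight z * h z := by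
  refine Continuous.integral_pos_of_hasCompactSupport_nonneg_nonzero (x := z)
    (contDiff_radialWeight.continuous.mul hh)
    ((isCompact_closedBall 0 _).of_isClosed_subset (isClosed_tsupport _)
      (tsupport_radialWeight_mul_subset h))
    (fun z => mul_nonneg (radialWeight_nonneg z) (h0 z)) ?_
  exact mul_ne_zero (expNegInvGlue.pos_of_pos (by linarith)).ne' hz'

/-- A function which some rotation turns into its negative has vanishing radial averages. -/
lemma integral_radialWeight_mul_eq_zero {q : ℂ} (hq : ‖q‖ = 1) {h : ℂ → ℝ}
    (hh : ∀ z, h (q * z) = -h z) : ∫ z, radialWeight z * h z = 0 := by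
  have hq0 : q ≠ 0 := fun h0 => by simp [h0] at hq
  have h1 := integral_comp_mul q hq0 (fun z => radialWeight (q * z) * h (q * z))
  have h2 : ∀ z, q * (z / q) = z := fun z => mul_div_cancel₀ z hq0
  simp only [h2, hq, one_pow, inv_one, one_mul, hh, radialWeight_mul hq, mul_neg,
    integral_neg] at h1
  linarith

/-- The unit complex number of angle `π / r`. -/
noncomputable def halfTurn (r : ℝ) : ℂ := Complex.exp ((Real.pi / r : ℝ) * Complex.I)

lemma norm_halfTurn (r : ℝ) : ‖halfTurn r‖ = 1 := Complex.norm_exp_ofReal_mul_I _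

lemma halfTurn_pow {n : ℕ} (hn : n ≠ 0) : halfTurn n ^ n = -1 := by
  have hn' : (n : ℂ) ≠ 0 := Nat.cast_ne_zero.2 hn
  rw [halfTurn, ← Complex.exp_nat_mul, ← Complex.exp_pi_mul_I]
  congr 1
  push_cast
  field_simp

lemma halfTurn_pow_mul_conj_pow {n m : ℕ} (h : n ≠ m) :
    halfTurn ((n : ℝ) - m) ^ n * (starRingEnd ℂ) (halfTurn ((n : ℝ) - m)) ^ m = -1 := by
  have hn' : (n : ℂ) - m ≠ 0 := sub_ne_zero.2 (Nat.cast_injective.ne h)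
  rw [halfTurn, ← Complex.exp_conj, ← Complex.exp_nat_mul, ← Complex.exp_nat_mul,
    ← Complex.exp_add, ← Complex.exp_pi_mul_I]
  congr 1
  simp only [map_mul, Complex.conj_ofReal, Complex.conj_I]
  push_cast
  field_simp
  ring

/-- The coefficient `c` with `diskMode (n, j) z = n^{-1/2} Re (c zⁿ)`. -/
noncomputable def modeSign (j : Fin 2) : ℂ := if j = 0 then 1 else -Complex.I

lemma diskMode_eq (i : ℕ+ × Fin 2) (z : ℂ) :
    diskMode i z = (modeSign i.2 * z ^ (i.1 : ℕ)).re / Real.sqrt i.1 := by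
  rw [diskMode, modeSign]
  split_ifs <;> simp

lemma contDiff_diskMode (i : ℕ+ × Fin 2) : ContDiff ℝ ((⊤ : ℕ∞) : WithTop ℕ∞) (diskMode i) := by
  have h : diskMode i = fun z => (modeSign i.2 * z ^ (i.1 : ℕ)).re / Real.sqrt i.1 :=
    funext (diskMode_eq i)
  rw [h]
  have h2 : ContDiff ℝ ((⊤ : ℕ∞) : WithTop ℕ∞) fun z : ℂ => modeSign i.2 * z ^ (i.1 : ℕ) :=
    contDiff_const.mul (contDiff_id.pow _)
  exact (Complex.reCLM.contDiff.comp h2).div_const _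

lemma diskMode_halfTurn (i : ℕ+ × Fin 2) (z : ℂ) :
    diskMode i (halfTurn (i.1 : ℕ) * z) = -diskMode i z := by
  rw [diskMode_eq, diskMode_eq, mul_pow, halfTurn_pow i.1.ne_zero]
  simp
  ring

lemma re_mul_re (u v : ℂ) : u.re * v.re =
    ((u * v).re + (u * (starRingEnd ℂ) v).re) / 2 := by
  simp [Complex.mul_re]

lemma modeSign_mul_conj {j k : Fin 2} (h : j ≠ k) :
    (modeSign j * (starRingEnd ℂ) (modeSign k)).re = 0 := by
  fin_cases j <;> fin_cases k <;> simp_all [modeSign]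

/-- Distinct modes are orthogonal for every radial weight: the product of two modes is the sum of
the real parts of multiples of `z ^ (n + m)` and `z ^ n * conj z ^ m`. A rotation by `π / (n + m)`
negates the first part, a rotation by `π / (n - m)` negates the second one, and for `n = m` the second
part vanishes. -/
lemma integral_diskMode_mul_diskMode {i j : ℕ+ × Fin 2} (h : i ≠ j) :
    ∫ z, radialWeight z * (diskMode i z * diskMode j z) = 0 := by
  set A : ℂ → ℝ := fun z =>
    ((modeSign i.2 * z ^ (i.1 : ℕ)) * (modeSign j.2 * z ^ (j.1 : ℕ))).re with hA
  set B : ℂ → ℝ := fun z => ((modeSign i.2 * z ^ (i.1 : ℕ)) *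
    (starRingEnd ℂ) (modeSign j.2 * z ^ (j.1 : ℕ))).re with hB
  have hAB : ∀ z, radialWeight z * (diskMode i z * diskMode j z) =
      (Real.sqrt i.1 * Real.sqrt j.1 * 2)⁻¹ * (radialWeight z * A z + radialWeight z * B z) := by
    intro z
    rw [diskMode_eq, diskMode_eq, div_mul_div_comm, re_mul_re]
    simp only [hA, hB]
    field_simp
  have hAc : Continuous A := by fun_prop
  have hBc : Continuous B :=
    Complex.continuous_re.comp ((by fun_prop : Continuous fun z : ℂ => modeSign i.2 * z ^ (i.1 : ℕ)).mul
      (Complex.continuous_conj.comp (by fun_prop)))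
  have hA0 : ∫ z, radialWeight z * A z = 0 := by
    refine integral_radialWeight_mul_eq_zero (norm_halfTurn ((i.1 : ℕ) + (j.1 : ℕ) : ℕ))
      fun z => ?_
    simp only [hA]
    rw [← Complex.neg_re]
    congr 1
    have h1 := halfTurn_pow (n := (i.1 : ℕ) + (j.1 : ℕ)) (by have := i.1.pos; omega)
    rw [pow_add] at h1
    rw [mul_pow, mul_pow]
    linear_combination (modeSign i.2 * modeSign j.2 * z ^ (i.1 : ℕ) * z ^ (j.1 : ℕ)) * h1
  have hB0 : ∫ z, radialWeight z * B z = 0 := by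
    by_cases hn : i.1 = j.1
    · have hj : i.2 ≠ j.2 := fun h' => h (Prod.ext hn h')
      have : ∀ z, B z = 0 := by
        intro z
        simp only [hB]
        rw [hn, map_mul, mul_mul_mul_comm, Complex.mul_conj, Complex.re_mul_ofReal,
          modeSign_mul_conj hj, zero_mul]
      simp [this]
    · have hn' : (i.1 : ℕ) ≠ j.1 := fun h' => hn (PNat.coe_injective h')
      refine integral_radialWeight_mul_eq_zero (norm_halfTurn ((i.1 : ℕ) - (j.1 : ℕ) : ℝ))
        fun z => ?_
      simp only [hB]
      rw [← Complex.neg_re]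
      congr 1
      have h1 := halfTurn_pow_mul_conj_pow hn'
      rw [mul_pow, mul_pow, map_mul, map_mul, map_mul, map_pow]
      linear_combination (modeSign i.2 * (starRingEnd ℂ) (modeSign j.2) * z ^ (i.1 : ℕ) *
        (starRingEnd ℂ) (z ^ (j.1 : ℕ))) * h1
  simp only [hAB]
  rw [integral_const_mul, integral_add (integrable_radialWeight_mul hAc)
    (integrable_radialWeight_mul hBc), hA0, hB0]
  simp

lemma exists_diskMode_ne_zero (i : ℕ+ × Fin 2) : ∃ z : ℂ, ‖z‖ ^ 2 < 1 / 2 ∧ diskMode i z ≠ 0 := by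
  have h0 : diskMode (i.1, 0) (1 / 2 : ℝ) ≠ 0 := by
    rw [diskMode_zero, ← Complex.ofReal_pow, Complex.ofReal_re]
    have : (0 : ℝ) < Real.sqrt i.1 := zero_lt_one.trans_le (one_le_sqrt_pnat i.1)
    positivity
  obtain ⟨n, j⟩ := i
  fin_cases j
  · exact ⟨(1 / 2 : ℝ), by norm_num, h0⟩
  · have hpol : IsPolar (rot (Real.pi / 2 / n)) 0 (Real.pi / 2 / n) := by
      simpa using isPolar_rot (Real.pi / 2 / n)
    refine ⟨(rot (Real.pi / 2 / n)).1 * (1 / 2 : ℝ), ?_, ?_⟩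
    · rw [norm_mul, hpol.norm]
      norm_num
    · have h1 := diskMode_mul_one hpol n (1 / 2 : ℝ)
      have h2 : (n : ℝ) * (Real.pi / 2 / n) = Real.pi / 2 := by
        have : (n : ℝ) ≠ 0 := by exact_mod_cast n.ne_zero
        field_simp
      rw [h2, Real.cos_pi_div_two, Real.sin_pi_div_two] at h1
      simp only [mul_zero, neg_zero, Real.exp_zero, zero_mul, one_mul, zero_add] at h1
      rw [← h1] at h0
      exact h0

/-- A radial test function of integral one; it does not couple to the modes. -/
noncomputable def radialTest : TestFun :=
  (∫ z, radialCutoff (fun _ => 1) contDiff_const z)⁻¹ • radialCutoff (fun _ => 1) contDiff_const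

/-- Test functions dual to the modes. -/
noncomputable def dualTest (i : ℕ+ × Fin 2) : TestFun :=
  (coef i (radialCutoff (diskMode i) (contDiff_diskMode i)))⁻¹ •
    radialCutoff (diskMode i) (contDiff_diskMode i)

lemma integral_radialTest : ∫ z, radialTest z = 1 := by
  have h : 0 < ∫ z, radialCutoff (fun _ => 1) contDiff_const z := by
    simp only [radialCutoff_apply]
    exact integral_radialWeight_mul_pos (z := 0) continuous_const (fun _ => zero_le_one)
      (by norm_num) one_ne_zero
  simp only [radialTest, smul_apply, smul_eq_mul]
  rw [integral_const_mul, inv_mul_cancel₀ h.ne']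

lemma coef_radialTest (i : ℕ+ × Fin 2) : coef i radialTest = 0 := by
  have h := integral_radialWeight_mul_eq_zero (norm_halfTurn (i.1 : ℕ)) (diskMode_halfTurn i)
  simp only [coef, radialTest, smul_apply, smul_eq_mul, radialCutoff_apply, mul_one]
  simp only [mul_left_comm _ (_)⁻¹, mul_comm (diskMode i _)]
  rw [integral_const_mul, h, mul_zero]

lemma integral_dualTest (i : ℕ+ × Fin 2) : ∫ z, dualTest i z = 0 := by
  have h := integral_radialWeight_mul_eq_zero (norm_halfTurn (i.1 : ℕ)) (diskMode_halfTurn i)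
  simp only [dualTest, smul_apply, smul_eq_mul, radialCutoff_apply]
  rw [integral_const_mul, h, mul_zero]

lemma coef_radialCutoff (i j : ℕ+ × Fin 2) :
    coef i (radialCutoff (diskMode j) (contDiff_diskMode j)) =
      ∫ z, radialWeight z * (diskMode i z * diskMode j z) := by
  simp only [coef, radialCutoff_apply]
  congr 1
  ext z
  ring

lemma coef_dualTest [DecidableEq (ℕ+ × Fin 2)] (i j : ℕ+ × Fin 2) :
    coef i (dualTest j) = if i = j then 1 else 0 := by
  have h1 : coef i (dualTest j) = (coef j (radialCutoff (diskMode j) (contDiff_diskMode j)))⁻¹ *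
      coef i (radialCutoff (diskMode j) (contDiff_diskMode j)) := by
    simp only [coef, dualTest, smul_apply, smul_eq_mul, mul_left_comm (diskMode i _)]
    rw [integral_const_mul]
  rw [h1]
  split_ifs with h
  · subst h
    obtain ⟨z, hz, hz'⟩ := exists_diskMode_ne_zero i
    refine inv_mul_cancel₀ (ne_of_gt ?_)
    rw [coef_radialCutoff]
    exact integral_radialWeight_mul_pos (by fun_prop) (fun z => mul_self_nonneg _) hz
      (mul_self_ne_zero.2 hz')
  · rw [coef_radialCutoff i j, integral_diskMode_mul_diskMode h, mul_zero]

/-- The unit complex number of angle `π / n` as a rotation parameter. -/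
noncomputable def halfTurnDilation (n : ℕ+) : Dilation :=
  ⟨halfTurn (n : ℕ), fun h => by simpa [h] using norm_halfTurn (n : ℕ), (norm_halfTurn _).le⟩

lemma radialWeight_div {q : ℂ} (hq : ‖q‖ = 1) (z : ℂ) : radialWeight (z / q) = radialWeight z := by
  simp [radialWeight, hq]

lemma scale_halfTurn_radialTest (n : ℕ+) : scale (halfTurnDilation n) radialTest = radialTest := by
  refine TestFunction.ext fun z => ?_
  simp [scale_apply, radialTest, smul_apply, radialCutoff_apply, halfTurnDilation, norm_halfTurn,
    radialWeight_div (norm_halfTurn _)]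

lemma scale_halfTurn_dualTest (i : ℕ+ × Fin 2) :
    scale (halfTurnDilation i.1) (dualTest i) = (-1 : ℝ) • dualTest i := by
  refine TestFunction.ext fun z => ?_
  have hq : halfTurn (i.1 : ℕ) ≠ 0 := (halfTurnDilation i.1).2.1
  have h := diskMode_halfTurn i (z / halfTurn (i.1 : ℕ))
  rw [mul_div_cancel₀ z hq] at h
  simp [scale_apply, dualTest, smul_apply, radialCutoff_apply, halfTurnDilation, norm_halfTurn,
    radialWeight_div (norm_halfTurn _), h]

lemma greenForm_smul_smul (a b : ℝ) (f g : TestFun) :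
    greenForm (a • f) (b • g) = a * b * greenForm f g := by
  simpa using greenForm_sum {()} {()} (fun _ => f) (fun _ => g) (fun _ => a) (fun _ => b)

/-- A rotation that fixes the radial test function negates the dual one. -/
lemma greenForm_radialTest_dualTest (i : ℕ+ × Fin 2) : greenForm radialTest (dualTest i) = 0 := by
  have h := greenForm_scale_rot (halfTurnDilation i.1) (norm_halfTurn _) radialTest (dualTest i)
  have h2 := greenForm_smul_smul 1 (-1) radialTest (dualTest i)
  rw [one_smul] at h2
  rw [scale_halfTurn_radialTest, scale_halfTurn_dualTest, h2] at h
  linarith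

lemma greenForm_dualTest_radialTest (i : ℕ+ × Fin 2) : greenForm (dualTest i) radialTest = 0 := by
  have h := greenForm_scale_rot (halfTurnDilation i.1) (norm_halfTurn _) (dualTest i) radialTest
  have h2 := greenForm_smul_smul (-1) 1 (dualTest i) radialTest
  rw [one_smul] at h2
  rw [scale_halfTurn_radialTest, scale_halfTurn_dualTest, h2] at h
  linarith

end DualTestFunctions

/-! ### Uniqueness of the induced operators -/

section Uniqueness

/-- A combination of the test functions dual to the modes. -/
noncomputable def dualSum (s : Finset (ℕ+ × Fin 2)) (a : ℕ+ × Fin 2 → ℝ) : TestFun :=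
  ∑ i ∈ s, a i • dualTest i

/-- `1 + Var Φ(f)` for the radial test function `f`. -/
noncomputable def widthSq : ℝ := 1 + greenForm radialTest radialTest

/-- A functional of the field which is Gaussian in the constant mode and a character in finitely
many other modes. The free Dirichlet field only contributes constant factors to its image
under `U`. -/
noncomputable def gaussianFunctional (l : ℂ) (s : Finset (ℕ+ × Fin 2)) (a : ℕ+ × Fin 2 → ℝ)
    (φ : DiskField) : ℂ :=
  Complex.exp (-(φ radialTest - l) ^ 2 / 2) * phase (φ (dualSum s a))

@[fun_prop]
lemma measurable_gaussianFunctional (l : ℂ) (s : Finset (ℕ+ × Fin 2)) (a : ℕ+ × Fin 2 → ℝ) :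
    Measurable (gaussianFunctional l s a) := by
  unfold gaussianFunctional
  fun_prop

lemma harmPart_radialTest (x : Modes) : harmPart x radialTest = 0 := by
  simp [harmPart, coef_radialTest]

lemma harmPart_dualSum (x : Modes) (s : Finset (ℕ+ × Fin 2)) (a : ℕ+ × Fin 2 → ℝ) :
    harmPart x (dualSum s a) = ∑ i ∈ s, a i * x i := by
  classical
  have h : ∀ i, coef i (dualSum s a) = if i ∈ s then a i else 0 := by
    intro i
    rw [dualSum, coef_sum]
    simp [coef_dualTest]
  simp only [harmPart, h]
  rw [tsum_eq_sum (s := s) (fun i hi => by simp [hi])]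
  exact Finset.sum_congr rfl fun i hi => by simp [hi]

lemma integral_dualSum (s : Finset (ℕ+ × Fin 2)) (a : ℕ+ × Fin 2 → ℝ) :
    ∫ z, dualSum s a z = 0 := by
  rw [dualSum, integral_sum_testFun]
  simp [integral_dualTest]

lemma greenForm_radialTest_dualSum (s : Finset (ℕ+ × Fin 2)) (a : ℕ+ × Fin 2 → ℝ) :
    greenForm radialTest (dualSum s a) = 0 := by
  have h := greenForm_sum {((1 : ℕ+), (0 : Fin 2))} s (fun _ => radialTest) dualTest (fun _ => 1) a
  simpa [greenForm_radialTest_dualTest, dualSum] using h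

lemma greenForm_dualSum_radialTest (s : Finset (ℕ+ × Fin 2)) (a : ℕ+ × Fin 2 → ℝ) :
    greenForm (dualSum s a) radialTest = 0 := by
  have h := greenForm_sum s {((1 : ℕ+), (0 : Fin 2))} dualTest (fun _ => radialTest) a (fun _ => 1)
  simpa [greenForm_dualTest_radialTest, dualSum] using h

lemma gaussianFunctional_totalField' (l : ℂ) (s : Finset (ℕ+ × Fin 2)) (a : ℕ+ × Fin 2 → ℝ)
    {Ω : Type*} {Φ : Ω → DiskField} (p : Config) (ω : Ω) : gaussianFunctional l s a (totalField' Φ p ω) =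
      Complex.exp (-((p.1 + Φ ω radialTest : ℝ) - l) ^ 2 / 2) *
        (phase (∑ i ∈ s, a i * p.2 i) * phase (Φ ω (dualSum s a))) := by
  rw [gaussianFunctional, totalField', totalField', integral_radialTest, harmPart_radialTest,
    integral_dualSum, harmPart_dualSum, ← phase_add]
  congr 2
  · simp
  · ring

variable {Ω : Type*} [MeasurableSpace Ω] {μ : Measure Ω} {Φ : Ω → DiskField}

lemma greenForm_self_nonneg (hΦ : IsDirichletGFF Φ μ) (f : TestFun) : 0 ≤ greenForm f f := by
  rw [greenForm, ← hΦ.covariance]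
  exact integral_nonneg fun ω => mul_self_nonneg _

lemma widthSq_pos (hΦ : IsDirichletGFF Φ μ) : 0 < widthSq := by
  have := greenForm_self_nonneg hΦ radialTest
  unfold widthSq
  linarith

/-- The Gaussian left in the constant mode. -/
noncomputable def wideGaussian (c : ℝ) : ℂ := Real.exp (-c ^ 2 / (2 * widthSq))

/-- The centre for which the weight `e^{-Qc}` is absorbed and the frequency `k` is produced. -/
noncomputable def gaussianCentre (Q k : ℝ) : ℂ := widthSq * (Q + k * Complex.I)

lemma exp_mul_gaussian (hΦ : IsDirichletGFF Φ μ) (Q k c : ℝ) :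
    (Real.exp (-Q * c) : ℂ) * Complex.exp (-(c - gaussianCentre Q k) ^ 2 / (2 * widthSq)) =
      Complex.exp (-(widthSq * (Q + k * Complex.I) ^ 2) / 2) * (wideGaussian c * phase (k * c)) := by
  have hwc : (widthSq : ℂ) ≠ 0 := Complex.ofReal_ne_zero.2 (widthSq_pos hΦ).ne'
  rw [wideGaussian, phase, Complex.ofReal_exp, Complex.ofReal_exp, ← Complex.exp_add,
    ← Complex.exp_add, ← Complex.exp_add, gaussianCentre]
  congr 1
  push_cast
  field_simp
  ring

lemma memLp_wideGaussian (hΦ : IsDirichletGFF Φ μ) : MemLp wideGaussian 2 volume := by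
  have hw := widthSq_pos hΦ
  have hm : Measurable wideGaussian := by unfold wideGaussian; fun_prop
  rw [memLp_two_iff_integrable_sq_norm hm.aestronglyMeasurable]
  refine (integrable_exp_neg_mul_sq (b := 1 / widthSq) (by positivity)).congr
    (ae_of_all _ fun c => ?_)
  simp only [wideGaussian]
  rw [Complex.norm_real, Real.norm_of_nonneg (Real.exp_pos _).le, ← Real.exp_nat_mul]
  congr 1
  push_cast
  field_simp

variable [IsProbabilityMeasure μ]

lemma integral_phase_radialTest_add (hΦ : IsDirichletGFF Φ μ) (ξ b : ℝ)
    (s : Finset (ℕ+ × Fin 2)) (a : ℕ+ × Fin 2 → ℝ) :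
    ∫ ω, phase (ξ * Φ ω radialTest + b * Φ ω (dualSum s a)) ∂μ =
      Real.exp (-(b ^ 2 * greenForm (dualSum s a) (dualSum s a) / 2)) *
        Real.exp (-(greenForm radialTest radialTest * ξ ^ 2 / 2)) := by
  have h := integral_phase_gff hΦ Finset.univ ![ξ, b] ![radialTest, dualSum s a]
  simp only [Fin.sum_univ_two, Matrix.cons_val_zero, Matrix.cons_val_one] at h
  rw [h]
  have h2 := greenForm_sum Finset.univ Finset.univ ![radialTest, dualSum s a]
    ![radialTest, dualSum s a] ![ξ, b] ![ξ, b]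
  simp only [Fin.sum_univ_two, Matrix.cons_val_zero, Matrix.cons_val_one,
    greenForm_radialTest_dualSum, greenForm_dualSum_radialTest, mul_zero, add_zero, zero_add] at h2
  rw [h2, ← Complex.ofReal_mul, ← Real.exp_add]
  congr 2
  ring

/-- The Dirichlet field widens the Gaussian in the constant mode and contributes a constant. -/
lemma exists_integral_gaussian (hΦ : IsDirichletGFF Φ μ) (b : ℝ) (s : Finset (ℕ+ × Fin 2))
    (a : ℕ+ × Fin 2 → ℝ) : ∃ C : ℂ, C ≠ 0 ∧ ∀ (c : ℝ) (l : ℂ),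
      ∫ ω, Complex.exp (-((c + Φ ω radialTest : ℝ) - l) ^ 2 / 2) *
        phase (b * Φ ω (dualSum s a)) ∂μ = C * Complex.exp (-(c - l) ^ 2 / (2 * widthSq)) := by
  have hw := widthSq_pos hΦ
  have hpi : (Real.pi : ℂ) ≠ 0 := Complex.ofReal_ne_zero.2 Real.pi_ne_zero
  have hwc : (widthSq : ℂ) ≠ 0 := Complex.ofReal_ne_zero.2 hw.ne'
  set K : ℂ := ((Real.pi : ℂ) / (1 / 2)) ^ (1 / 2 : ℂ) with hK
  set K' : ℂ := ((Real.pi : ℂ) / (widthSq / 2)) ^ (1 / 2 : ℂ) with hK'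
  set E : ℂ := (Real.exp (-(b ^ 2 * greenForm (dualSum s a) (dualSum s a) / 2)) : ℂ) with hE
  have hK0 : K ≠ 0 := by
    rw [hK, Ne, Complex.cpow_eq_zero_iff, not_and_or]
    exact Or.inl (div_ne_zero hpi (by norm_num))
  have hK'0 : K' ≠ 0 := by
    rw [hK', Ne, Complex.cpow_eq_zero_iff, not_and_or]
    exact Or.inl (div_ne_zero hpi (div_ne_zero hwc two_ne_zero))
  have hE0 : E ≠ 0 := Complex.ofReal_ne_zero.2 (Real.exp_pos _).ne'
  refine ⟨K⁻¹ * (E * K'), mul_ne_zero (inv_ne_zero hK0) (mul_ne_zero hE0 hK'0), fun c l => ?_⟩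
  have hgauss : ∀ t : ℂ, Complex.exp (-t ^ 2 / 2) =
      K⁻¹ * ∫ ξ : ℝ, Complex.exp (Complex.I * t * ξ) * Complex.exp (-(1 / 2) * ξ ^ 2) := by
    intro t
    rw [fourierIntegral_gaussian (b := 1 / 2) (by norm_num), ← mul_assoc, inv_mul_cancel₀ hK0,
      one_mul]
    norm_num
  -- the Gaussian is written as a superposition of characters
  let g : ℝ → ℂ := fun ξ =>
    Complex.exp (Complex.I * (c - l) * ξ) * Complex.exp (-(1 / 2) * ξ ^ 2)
  have hg : Integrable g := by
    have h := integrable_cexp_quadratic (b := 1 / 2) (by norm_num) (Complex.I * (c - l)) 0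
    refine h.congr (ae_of_all _ fun ξ => ?_)
    simp only [g]
    rw [← Complex.exp_add]
    congr 1
    ring
  have hm0 : Measurable fun z : Ω × ℝ => Φ z.1 radialTest :=
    (hΦ.measurable _).comp measurable_fst
  have hm1 : Measurable fun z : Ω × ℝ => Φ z.1 (dualSum s a) :=
    (hΦ.measurable _).comp measurable_fst
  have hint : Integrable (fun z : Ω × ℝ =>
      phase (z.2 * Φ z.1 radialTest + b * Φ z.1 (dualSum s a)) * g z.2) (μ.prod volume) := by
    have hp : Measurable fun z : Ω × ℝ =>
      phase (z.2 * Φ z.1 radialTest + b * Φ z.1 (dualSum s a)) :=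
      measurable_phase.comp ((measurable_snd.mul hm0).add (hm1.const_mul b))
    exact (hg.comp_snd μ).bdd_mul (c := 1) hp.aestronglyMeasurable
      (ae_of_all _ fun z => (norm_phase _).le)
  calc _ = ∫ ω, (K⁻¹ * ∫ ξ : ℝ,
        phase (ξ * Φ ω radialTest + b * Φ ω (dualSum s a)) * g ξ) ∂μ := by
        congr 1
        ext ω
        rw [hgauss, mul_assoc, ← integral_mul_const]
        congr 2
        ext ξ
        simp only [g, phase, ← Complex.exp_add]
        congr 1
        push_cast
        ring
    _ = K⁻¹ * ∫ ξ : ℝ, ∫ ω,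
        phase (ξ * Φ ω radialTest + b * Φ ω (dualSum s a)) * g ξ ∂μ := by
        rw [integral_const_mul, integral_integral_swap hint]
    _ = K⁻¹ * ∫ ξ : ℝ, E * (Complex.exp (Complex.I * (c - l) * ξ) *
          Complex.exp (-((widthSq / 2 : ℂ)) * ξ ^ 2)) := by
        congr 2
        ext ξ
        rw [integral_mul_const, integral_phase_radialTest_add hΦ, ← hE, mul_assoc]
        congr 1
        simp only [g, widthSq]
        rw [Complex.ofReal_exp, ← Complex.exp_add, ← Complex.exp_add, ← Complex.exp_add]
        congr 1
        push_cast
        ring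
    _ = _ := by
        rw [integral_const_mul, fourierIntegral_gaussian (b := (widthSq / 2 : ℂ))
          (by rw [← Complex.ofReal_ofNat, ← Complex.ofReal_div, Complex.ofReal_re]; positivity),
          ← hK', mul_assoc, mul_assoc]
        congr 4
        ring

/-- The images under `U` of the Gaussian functionals. -/
lemma exists_U'_gaussianFunctional (hΦ : IsDirichletGFF Φ μ) (Q k : ℝ)
    (s : Finset (ℕ+ × Fin 2)) (a : ℕ+ × Fin 2 → ℝ) : ∃ C : ℂ, C ≠ 0 ∧ ∀ p : Config,
      U' μ Φ Q (gaussianFunctional (gaussianCentre Q k) s a) p =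
        C * (wideGaussian p.1 * phase (k * p.1 + ∑ i ∈ s, a i * p.2 i)) := by
  obtain ⟨C, hC, h⟩ := exists_integral_gaussian hΦ 1 s a
  refine ⟨C * Complex.exp (-(widthSq * (Q + k * Complex.I) ^ 2) / 2),
    mul_ne_zero hC (Complex.exp_ne_zero _), fun p => ?_⟩
  simp only [U', gaussianFunctional_totalField', mul_left_comm _ (phase (∑ i ∈ s, a i * p.2 i))]
  rw [integral_const_mul]
  have h1 := h p.1 (gaussianCentre Q k)
  simp only [one_mul] at h1
  rw [h1, phase_add]
  linear_combination (phase (∑ i ∈ s, a i * p.2 i) * C) * exp_mul_gaussian hΦ Q k p.1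

lemma enorm_gaussianFunctional (l : ℂ) (s : Finset (ℕ+ × Fin 2)) (a : ℕ+ × Fin 2 → ℝ)
    (φ : DiskField) : ‖gaussianFunctional l s a φ‖ₑ =
      ENNReal.ofReal (Real.exp (l.im ^ 2 / 2)) *
        ENNReal.ofReal (Real.exp (-(φ radialTest - l.re) ^ 2 / 2)) := by
  rw [gaussianFunctional, ← ofReal_norm, norm_mul, norm_phase, mul_one, Complex.norm_exp,
    ← ENNReal.ofReal_mul (Real.exp_pos _).le, ← Real.exp_add]
  congr 2
  have h : -(((φ radialTest : ℝ) : ℂ) - l) ^ 2 / 2 =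
    ((-(((φ radialTest : ℝ) : ℂ) - l) ^ 2) * ((1 / 2 : ℝ) : ℂ)) := by push_cast; ring
  rw [h, Complex.re_mul_ofReal, sq]
  simp [Complex.mul_re]
  ring

lemma admissible_gaussianFunctional (hΦ : IsDirichletGFF Φ μ) (Q k : ℝ)
    (s : Finset (ℕ+ × Fin 2)) (a : ℕ+ × Fin 2 → ℝ) :
    Admissible μ Φ Q (gaussianFunctional (gaussianCentre Q k) s a) := by
  rw [admissible_iff]
  refine ⟨measurable_gaussianFunctional _ s a, ?_⟩
  set l := gaussianCentre Q k with hl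
  have hlre : (l.re : ℂ) = gaussianCentre Q 0 := by
    simp [hl, gaussianCentre]
  obtain ⟨C, -, hC⟩ := exists_integral_gaussian hΦ 0 ∅ 0
  set M : ℝ := Real.exp (l.im ^ 2 / 2) with hM
  set C' : ℂ := M * C * Complex.exp (-(widthSq * (Q + (0 : ℝ) * Complex.I) ^ 2) / 2) with hC'
  have habs : ∀ p : Config, absU μ Φ Q (gaussianFunctional l s a) p =
      ‖C' * (wideGaussian p.1 * 1)‖ₑ := by
    intro p
    have hm : Measurable fun ω => Real.exp (-(p.1 + Φ ω radialTest - l.re) ^ 2 / 2) := by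
      have := hΦ.measurable radialTest
      fun_prop
    have hint : Integrable (fun ω => Real.exp (-(p.1 + Φ ω radialTest - l.re) ^ 2 / 2)) μ := by
      refine Integrable.mono' (integrable_const (1 : ℝ)) hm.aestronglyMeasurable
        (ae_of_all _ fun ω => ?_)
      rw [Real.norm_of_nonneg (Real.exp_pos _).le, Real.exp_le_one_iff]
      have := sq_nonneg (p.1 + Φ ω radialTest - l.re)
      linarith
    have h1 : ((∫ ω, Real.exp (-(p.1 + Φ ω radialTest - l.re) ^ 2 / 2) ∂μ : ℝ) : ℂ) =
        C * Complex.exp (-(p.1 - gaussianCentre Q 0) ^ 2 / (2 * widthSq)) := by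
      rw [← integral_complex_ofReal, ← hlre, ← hC]
      congr 1
      ext ω
      rw [zero_mul, phase_zero, mul_one]
      push_cast
      rfl
    have h2 : ∀ ω, totalField' Φ p ω radialTest = p.1 + Φ ω radialTest := by
      intro ω
      rw [totalField', integral_radialTest, harmPart_radialTest]
      ring
    rw [absU]
    simp only [enorm_gaussianFunctional, h2]
    rw [lintegral_const_mul _ hm.ennreal_ofReal,
      ← ofReal_integral_eq_lintegral_ofReal hint (ae_of_all _ fun ω => (Real.exp_pos _).le),
      ← ENNReal.ofReal_mul (Real.exp_pos _).le, ← ENNReal.ofReal_mul (Real.exp_pos _).le]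
    have h3 : C' * (wideGaussian p.1 * 1) = ((Real.exp (-Q * p.1) * (M *
        ∫ ω, Real.exp (-(p.1 + Φ ω radialTest - l.re) ^ 2 / 2) ∂μ) : ℝ) : ℂ) := by
      have h4 := exp_mul_gaussian hΦ Q 0 p.1
      rw [zero_mul, phase_zero] at h4
      rw [Complex.ofReal_mul, Complex.ofReal_mul, h1, hC']
      linear_combination (-(M : ℂ) * C) * h4
    rw [h3, ← ofReal_norm, Complex.norm_real, Real.norm_of_nonneg]
    exact mul_nonneg (Real.exp_pos _).le (mul_nonneg (Real.exp_pos _).le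
      (integral_nonneg fun ω => (Real.exp_pos _).le))
  have hL2 : MemLp (fun p : Config => C' * (wideGaussian p.1 * 1)) 2 configMeasure :=
    (memLp_tensor (memLp_wideGaussian hΦ) (memLp_const 1)).const_mul C'
  simp only [habs]
  exact (memLp_two_iff hL2.1).1 hL2

/-- A bounded operator is determined by its values on the range of `U`. -/
theorem isInduced_unique (hΦ : IsDirichletGFF Φ μ) (Q : ℝ) {q : Dilation}
    {A B : StateSpace →L[ℂ] StateSpace} (hA : IsInduced μ Φ Q q A) (hB : IsInduced μ Φ Q q B) :
    A = B := by
  set S : Set StateSpace := {ψ | ∃ (F : DiskField → ℂ) (_ : Admissible μ Φ Q F)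
    (h : MemLp (U μ Φ Q F) 2 configMeasure), ψ = h.toLp _} with hS
  refine ContinuousLinearMap.ext_on (s := S) ?_ ?_
  · rw [Submodule.dense_iff_topologicalClosure_eq_top, Submodule.topologicalClosure_eq_top_iff,
      Submodule.eq_bot_iff]
    intro ψ hψ
    have horth : ∀ (k : ℝ) (s : Finset (ℕ+ × Fin 2)) (a : ℕ+ × Fin 2 → ℝ), ∫ p, (ψ p * wideGaussian p.1) *
        phase (k * p.1 + ∑ i ∈ s, a i * p.2 i) ∂configMeasure = 0 := by
      intro k s a
      obtain ⟨C, hC, hU⟩ := exists_U'_gaussianFunctional hΦ Q (-k) s fun i => -a i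
      have hadm := admissible_gaussianFunctional hΦ Q (-k) s fun i => -a i
      have hL : MemLp (U μ Φ Q (gaussianFunctional (gaussianCentre Q (-k)) s fun i => -a i)) 2
        configMeasure := (memLp_U' hΦ hadm).ae_eq (U_ae_eq Q _).symm
      have h0 := (Submodule.mem_orthogonal _ _).1 hψ _
        (Submodule.subset_span ⟨_, hadm, hL, rfl⟩)
      rw [L2.inner_def] at h0
      have h1 : ∫ p, (starRingEnd ℂ) C * ((ψ p * wideGaussian p.1) *
          phase (k * p.1 + ∑ i ∈ s, a i * p.2 i)) ∂configMeasure = 0 := by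
        rw [← h0]
        refine integral_congr_ae ?_
        filter_upwards [hL.coeFn_toLp, U_ae_eq (μ := μ) (Φ := Φ) Q
          (gaussianFunctional (gaussianCentre Q (-k)) s fun i => -a i)] with p hp1 hp2
        have hneg : -k * p.1 + ∑ i ∈ s, -a i * p.2 i =
            -(k * p.1 + ∑ i ∈ s, a i * p.2 i) := by
          simp only [neg_mul, Finset.sum_neg_distrib]
          ring
        rw [hp1, hp2, hU, RCLike.inner_apply, hneg, phase_neg]
        simp only [map_mul, wideGaussian, Complex.conj_ofReal, Complex.conj_conj]
        ring
      rw [integral_const_mul] at h1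
      exact (mul_eq_zero.1 h1).resolve_left (by simpa using hC)
    have hint : Integrable (fun p => ψ p * wideGaussian p.1) configMeasure := by
      have h1 : MemLp (fun p : Config => wideGaussian p.1 * 1) 2 configMeasure :=
        memLp_tensor (memLp_wideGaussian hΦ) (memLp_const 1)
      simp only [mul_one] at h1
      exact (Lp.memLp ψ).integrable_mul h1
    have hz := ae_eq_zero_of_charFunctional hint horth
    refine Lp.ext ?_
    filter_upwards [hz, Lp.coeFn_zero ℂ 2 configMeasure] with p hp hp0
    rw [hp0]
    have hne : wideGaussian p.1 ≠ 0 := Complex.ofReal_ne_zero.2 (Real.exp_pos _).ne'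
    exact (mul_eq_zero.1 hp).resolve_right hne
  · rintro ψ ⟨F, hF, h, rfl⟩
    obtain ⟨-, h1, h1', hA'⟩ := hA F hF
    obtain ⟨-, h2, h2', hB'⟩ := hB F hF
    exact hA'.trans hB'.symm

end Uniqueness

/-! ### The differential expressions on the finite-particle domain -/

section Expressions

open MvPolynomial (pderiv)

/-- The function `u(c) p(φ)`. -/
noncomputable def tensor (u : SchwartzMap ℝ ℂ) (p : MvPolynomial (ℕ+ × Fin 2) ℂ) : Config → ℂ :=
  fun y => u y.1 * polyEval p y.2

lemma tensor_mem (u : SchwartzMap ℝ ℂ) (p : MvPolynomial (ℕ+ × Fin 2) ℂ) :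
    tensor u p ∈ finiteParticle := Submodule.subset_span ⟨u, p, rfl⟩

/-- Induction over the finite-particle domain. -/
lemma finiteParticle_induction {P : (Config → ℂ) → Prop} (h0 : P 0)
    (ht : ∀ u p, P (tensor u p))
    (hadd : ∀ f ∈ finiteParticle, ∀ g ∈ finiteParticle, P f → P g → P (f + g))
    (hsmul : ∀ (c : ℂ), ∀ f ∈ finiteParticle, P f → P (c • f)) {f : Config → ℂ}
    (hf : f ∈ finiteParticle) : P f := by
  induction hf using Submodule.span_induction with
  | mem f hf => obtain ⟨u, p, rfl⟩ := hf; exact ht u p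
  | zero => exact h0
  | add f g hf hg ihf ihg => exact hadd f hf g hg ihf ihg
  | smul c f hf ih => exact hsmul c f hf ih

lemma hasDerivAt_polyEval_update (p : MvPolynomial (ℕ+ × Fin 2) ℂ) (i : ℕ+ × Fin 2) (x : Modes)
    (s : ℝ) : HasDerivAt (fun r : ℝ => polyEval p (Function.update x i r))
      (polyEval (pderiv i p) (Function.update x i s)) s := by
  classical
  induction p using MvPolynomial.induction_on with
  | C a => simpa [polyEval] using hasDerivAt_const s a
  | add p q hp hq =>
    have h1 : (fun r : ℝ => polyEval (p + q) (Function.update x i r)) =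
        (fun r : ℝ => polyEval p (Function.update x i r)) +
          fun r : ℝ => polyEval q (Function.update x i r) := by
      ext r
      simp [polyEval]
    rw [h1]
    exact (hp.add hq).congr_deriv (by simp [polyEval])
  | mul_X p j hp =>
    have hX : HasDerivAt (fun r : ℝ => ((Function.update x i r j : ℝ) : ℂ))
        (if j = i then 1 else 0) s := by
      by_cases h : j = i
      · subst h
        simpa using (hasDerivAt_id s).ofReal_comp
      · simpa [h] using hasDerivAt_const s ((x j : ℝ) : ℂ)
    have h := hp.mul hX
    have h1 : (fun r : ℝ => polyEval (p * MvPolynomial.X j) (Function.update x i r)) =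
        (fun r : ℝ => polyEval p (Function.update x i r)) *
          fun r : ℝ => ((Function.update x i r j : ℝ) : ℂ) := by
      ext r
      simp [polyEval]
    rw [h1]
    refine h.congr_deriv ?_
    rw [MvPolynomial.pderiv_mul]
    by_cases hj : j = i
    · subst hj
      simp [polyEval]
    · simp [polyEval, MvPolynomial.pderiv_X_of_ne hj, hj]

lemma dCoord_tensor (i : ℕ+ × Fin 2) (u : SchwartzMap ℝ ℂ) (p : MvPolynomial (ℕ+ × Fin 2) ℂ) :
    dCoord i (tensor u p) = tensor u (pderiv i p) := by
  ext y
  have h := ((hasDerivAt_polyEval_update p i y.2 (y.2 i)).const_mul (u y.1)).deriv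
  rw [Function.update_eq_self] at h
  exact h

lemma dC_tensor (u : SchwartzMap ℝ ℂ) (p : MvPolynomial (ℕ+ × Fin 2) ℂ) :
    dC (tensor u p) = tensor (SchwartzMap.derivCLM ℂ ℂ u) p := by
  ext y
  have h := ((u.differentiable y.1).hasDerivAt.mul_const (polyEval p y.2)).deriv
  exact h

lemma differentiableAt_update {f : Config → ℂ} (hf : f ∈ finiteParticle) (i : ℕ+ × Fin 2)
    (y : Config) (s : ℝ) :
    DifferentiableAt ℝ (fun r : ℝ => f (y.1, Function.update y.2 i r)) s := by
  revert y s
  refine finiteParticle_induction (P := fun f => ∀ (y : Config) (s : ℝ), DifferentiableAt ℝ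
    (fun r : ℝ => f (y.1, Function.update y.2 i r)) s) ?_ ?_ ?_ ?_ hf
  · intro y s; exact differentiableAt_const _
  · intro u p y s
    exact ((hasDerivAt_polyEval_update p i y.2 s).const_mul (u y.1)).differentiableAt
  · intro f _ g _ ihf ihg y s; exact (ihf y s).add (ihg y s)
  · intro c f _ ih y s; exact (ih y s).const_mul c

lemma differentiableAt_fst {f : Config → ℂ} (hf : f ∈ finiteParticle) (y : Config) (s : ℝ) :
    DifferentiableAt ℝ (fun r : ℝ => f (r, y.2)) s := by
  revert y s
  refine finiteParticle_induction (P := fun f => ∀ (y : Config) (s : ℝ), DifferentiableAt ℝ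
    (fun r : ℝ => f (r, y.2)) s) ?_ ?_ ?_ ?_ hf
  · intro y s; exact differentiableAt_const _
  · intro u p y s; exact (u.differentiable s).mul_const (polyEval p y.2)
  · intro f _ g _ ihf ihg y s; exact (ihf y s).add (ihg y s)
  · intro c f _ ih y s; exact (ih y s).const_mul c

lemma dCoord_add {f g : Config → ℂ} (hf : f ∈ finiteParticle) (hg : g ∈ finiteParticle)
    (i : ℕ+ × Fin 2) : dCoord i (f + g) = dCoord i f + dCoord i g := by
  ext y
  exact deriv_add (differentiableAt_update hf i y _) (differentiableAt_update hg i y _)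

lemma dCoord_smul {f : Config → ℂ} (hf : f ∈ finiteParticle) (c : ℂ) (i : ℕ+ × Fin 2) :
    dCoord i (c • f) = c • dCoord i f := by
  ext y
  exact deriv_const_mul c (differentiableAt_update hf i y _)

lemma dC_add {f g : Config → ℂ} (hf : f ∈ finiteParticle) (hg : g ∈ finiteParticle) :
    dC (f + g) = dC f + dC g := by
  ext y
  exact deriv_add (differentiableAt_fst hf y _) (differentiableAt_fst hg y _)

lemma dC_smul {f : Config → ℂ} (hf : f ∈ finiteParticle) (c : ℂ) : dC (c • f) = c • dC f := by
  ext y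
  exact deriv_const_mul c (differentiableAt_fst hf y _)

lemma dCoord_zero (i : ℕ+ × Fin 2) : dCoord i 0 = 0 := by
  ext y
  exact deriv_const _ _

lemma dC_zero : dC 0 = 0 := by
  ext y
  exact deriv_const _ _

lemma dCoord_mem {f : Config → ℂ} (hf : f ∈ finiteParticle) (i : ℕ+ × Fin 2) :
    dCoord i f ∈ finiteParticle := by
  refine finiteParticle_induction (P := fun f => dCoord i f ∈ finiteParticle) ?_ ?_ ?_ ?_ hf
  · rw [dCoord_zero]; exact zero_mem _
  · intro u p; rw [dCoord_tensor]; exact tensor_mem u _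
  · intro f hf g hg ihf ihg; rw [dCoord_add hf hg]; exact add_mem ihf ihg
  · intro c f hf ih; rw [dCoord_smul hf]; exact Submodule.smul_mem _ c ih

lemma dC_mem {f : Config → ℂ} (hf : f ∈ finiteParticle) : dC f ∈ finiteParticle := by
  refine finiteParticle_induction (P := fun f => dC f ∈ finiteParticle) ?_ ?_ ?_ ?_ hf
  · rw [dC_zero]; exact zero_mem _
  · intro u p; rw [dC_tensor]; exact tensor_mem _ p
  · intro f hf g hg ihf ihg; rw [dC_add hf hg]; exact add_mem ihf ihg
  · intro c f hf ih; rw [dC_smul hf]; exact Submodule.smul_mem _ c ih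

lemma finite_dCoord_ne_zero {f : Config → ℂ} (hf : f ∈ finiteParticle) :
    {i | dCoord i f ≠ 0}.Finite := by
  refine finiteParticle_induction (P := fun f => {i | dCoord i f ≠ 0}.Finite) ?_ ?_ ?_ ?_ hf
  · simp [dCoord_zero]
  · intro u p
    refine p.vars.finite_toSet.subset fun i hi => ?_
    by_contra h
    refine hi ?_
    rw [dCoord_tensor, MvPolynomial.pderiv_eq_zero_of_notMem_vars h]
    ext y
    simp [tensor, polyEval]
  · intro f hf g hg ihf ihg
    refine (ihf.union ihg).subset fun i hi => ?_
    by_contra h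
    simp only [Set.mem_union, Set.mem_ofPred_eq, not_or, not_not] at h
    exact hi (by rw [dCoord_add hf hg, h.1, h.2, add_zero])
  · intro c f hf ih
    refine ih.subset fun i hi h => hi ?_
    rw [dCoord_smul hf, h, smul_zero]

lemma ann_mem {f : Config → ℂ} (hf : f ∈ finiteParticle) (n : ℕ+) : ann n f ∈ finiteParticle := by
  have h : ann n f = (1 / 2 * (Real.sqrt n : ℂ)) •
      (dCoord (n, 0) f + Complex.I • dCoord (n, 1) f) := by
    ext y; simp [ann, dPhiNeg, mul_assoc]
  rw [h]
  exact Submodule.smul_mem _ _ (add_mem (dCoord_mem hf _) (Submodule.smul_mem _ _ (dCoord_mem hf _)))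

lemma annTilde_mem {f : Config → ℂ} (hf : f ∈ finiteParticle) (n : ℕ+) :
    annTilde n f ∈ finiteParticle := by
  have h : annTilde n f = (1 / 2 * (Real.sqrt n : ℂ)) •
      (dCoord (n, 0) f - Complex.I • dCoord (n, 1) f) := by
    ext y; simp [annTilde, dPhiPos, mul_assoc]
  rw [h]
  exact Submodule.smul_mem _ _ (sub_mem (dCoord_mem hf _) (Submodule.smul_mem _ _ (dCoord_mem hf _)))

/-- The two parts `a_{-n} a_n` and `ã_{-n} ã_n` of the number operator of the mode `n`, combined
with coefficient `ε` (`ε = 1` for the Hamiltonian and `ε = -1` for the momentum). -/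
noncomputable def numberExpr (ε : ℂ) (n : ℕ+) (f : Config → ℂ) : Config → ℂ :=
  fun y => cre n (ann n f) y + ε * creTilde n (annTilde n f) y

lemma numberExpr_add (ε : ℂ) (n : ℕ+) {f g : Config → ℂ} (hf : f ∈ finiteParticle)
    (hg : g ∈ finiteParticle) : numberExpr ε n (f + g) = numberExpr ε n f + numberExpr ε n g := by
  have h1 : ann n (f + g) = ann n f + ann n g := by
    ext y
    simp only [ann, dPhiNeg, dCoord_add hf hg, Pi.add_apply]
    ring
  have h2 : annTilde n (f + g) = annTilde n f + annTilde n g := by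
    ext y
    simp only [annTilde, dPhiPos, dCoord_add hf hg, Pi.add_apply]
    ring
  ext y
  simp only [numberExpr, h1, h2, cre, creTilde, dPhiPos, dPhiNeg,
    dCoord_add (ann_mem hf n) (ann_mem hg n), dCoord_add (annTilde_mem hf n) (annTilde_mem hg n),
    Pi.add_apply]
  ring

lemma numberExpr_smul (ε : ℂ) (n : ℕ+) {f : Config → ℂ} (hf : f ∈ finiteParticle) (c : ℂ) :
    numberExpr ε n (c • f) = c • numberExpr ε n f := by
  have h1 : ann n (c • f) = c • ann n f := by
    ext y
    simp only [ann, dPhiNeg, dCoord_smul hf, Pi.smul_apply, smul_eq_mul]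
    ring
  have h2 : annTilde n (c • f) = c • annTilde n f := by
    ext y
    simp only [annTilde, dPhiPos, dCoord_smul hf, Pi.smul_apply, smul_eq_mul]
    ring
  ext y
  simp only [numberExpr, h1, h2, cre, creTilde, dPhiPos, dPhiNeg,
    dCoord_smul (ann_mem hf n), dCoord_smul (annTilde_mem hf n), Pi.smul_apply, smul_eq_mul]
  ring

lemma numberExpr_eq_zero (ε : ℂ) {n : ℕ+} {f : Config → ℂ} (h : ∀ j, dCoord (n, j) f = 0) :
    numberExpr ε n f = 0 := by
  have h1 : ann n f = 0 := by
    ext y; simp [ann, dPhiNeg, h]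
  have h2 : annTilde n f = 0 := by
    ext y; simp [annTilde, dPhiPos, h]
  ext y
  simp [numberExpr, h1, h2, cre, creTilde, dPhiPos, dPhiNeg, dCoord_zero]

lemma summable_numberExpr (ε : ℂ) {f : Config → ℂ} (hf : f ∈ finiteParticle) (y : Config) :
    Summable fun n => numberExpr ε n f y := by
  refine summable_of_hasFiniteSupport ?_
  refine ((finite_dCoord_ne_zero hf).image Prod.fst).subset fun n hn => ?_
  by_contra h
  refine hn ?_
  have : ∀ j, dCoord (n, j) f = 0 := fun j => by
    by_contra hj
    exact h ⟨(n, j), hj, rfl⟩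
  simp [numberExpr_eq_zero ε this]

lemma hamiltonianExpr_eq (Q : ℝ) (f : Config → ℂ) (y : Config) : hamiltonianExpr Q f y =
    (1 / 2) * (-dC (dC f) y + (Q : ℂ) ^ 2 * f y) + 2 * ∑' n : ℕ+, numberExpr 1 n f y := by
  simp [hamiltonianExpr, numberExpr]

lemma momentumExpr_eq (f : Config → ℂ) (y : Config) :
    momentumExpr f y = 2 * ∑' n : ℕ+, numberExpr (-1) n f y := by
  simp [momentumExpr, numberExpr, sub_eq_add_neg]

/-- Linearity of a differential expression on the finite-particle domain. -/
structure IsLinearOnDomain (L : (Config → ℂ) → Config → ℂ) : Prop where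
  add : ∀ f ∈ finiteParticle, ∀ g ∈ finiteParticle, L (f + g) = L f + L g
  smul : ∀ (c : ℂ), ∀ f ∈ finiteParticle, L (c • f) = c • L f

lemma isLinearOnDomain_momentumExpr : IsLinearOnDomain momentumExpr where
  add f hf g hg := by
    ext y
    simp only [momentumExpr_eq, numberExpr_add _ _ hf hg, Pi.add_apply]
    rw [(summable_numberExpr _ hf y).tsum_add (summable_numberExpr _ hg y)]
    ring
  smul c f hf := by
    ext y
    simp only [momentumExpr_eq, numberExpr_smul _ _ hf, Pi.smul_apply, smul_eq_mul, tsum_mul_left]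
    ring

lemma isLinearOnDomain_hamiltonianExpr (Q : ℝ) : IsLinearOnDomain (hamiltonianExpr Q) where
  add f hf g hg := by
    ext y
    simp only [hamiltonianExpr_eq, numberExpr_add _ _ hf hg, dC_add hf hg,
      dC_add (dC_mem hf) (dC_mem hg), Pi.add_apply]
    rw [(summable_numberExpr _ hf y).tsum_add (summable_numberExpr _ hg y)]
    ring
  smul c f hf := by
    ext y
    simp only [hamiltonianExpr_eq, numberExpr_smul _ _ hf, dC_smul hf, dC_smul (dC_mem hf),
      Pi.smul_apply, smul_eq_mul, tsum_mul_left]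
    ring

lemma pderiv_comm (i j : ℕ+ × Fin 2) (p : MvPolynomial (ℕ+ × Fin 2) ℂ) :
    pderiv i (pderiv j p) = pderiv j (pderiv i p) := by
  classical
  have h : ⁅(pderiv i : Derivation ℂ (MvPolynomial (ℕ+ × Fin 2) ℂ) _),
      (pderiv j : Derivation ℂ (MvPolynomial (ℕ+ × Fin 2) ℂ) _)⁆ = 0 := by
    refine MvPolynomial.derivation_ext fun k => ?_
    rw [Derivation.commutator_apply]
    by_cases hi : k = i <;> by_cases hj : k = j <;>
      simp [MvPolynomial.pderiv_X, Pi.single_apply, hi, hj, apply_ite]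
  have h2 := congrArg (fun D => D p) h
  simp only [Derivation.commutator_apply, Derivation.coe_zero, Pi.zero_apply] at h2
  exact sub_eq_zero.1 h2

lemma sqrt_pnat_sq (n : ℕ+) : (Real.sqrt n : ℂ) ^ 2 = n := by
  rw [← Complex.ofReal_pow, Real.sq_sqrt (by positivity)]
  simp

lemma cre_ann_tensor (n : ℕ+) (u : SchwartzMap ℝ ℂ) (p : MvPolynomial (ℕ+ × Fin 2) ℂ)
    (y : Config) : cre n (ann n (tensor u p)) y = (n / 4 : ℂ) * (u y.1 *
      (((y.2 (n, 0) : ℂ) - Complex.I * y.2 (n, 1)) *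
        (polyEval (pderiv (n, 0) p) y.2 + Complex.I * polyEval (pderiv (n, 1) p) y.2)
        - (polyEval (pderiv (n, 0) (pderiv (n, 0) p)) y.2 +
          polyEval (pderiv (n, 1) (pderiv (n, 1) p)) y.2))) := by
  have h : ann n (tensor u p) = tensor u (MvPolynomial.C (1 / 2 * (Real.sqrt n : ℂ)) *
      (pderiv (n, 0) p + MvPolynomial.C Complex.I * pderiv (n, 1) p)) := by
    ext y
    simp [ann, dPhiNeg, dCoord_tensor, tensor, polyEval]
    ring
  have hs : (Real.sqrt n : ℂ) ≠ 0 :=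
    Complex.ofReal_ne_zero.2 (zero_lt_one.trans_le (one_le_sqrt_pnat n)).ne'
  rw [h, cre, dPhiPos, dCoord_tensor, dCoord_tensor]
  simp only [MvPolynomial.pderiv_C_mul, map_add, pderiv_comm (n, 1) (n, 0)]
  simp only [map_add, phiNeg, phiPos, tensor,
    polyEval, map_mul, MvPolynomial.eval_C, map_div₀, Complex.conj_ofReal, Complex.conj_I,
    map_ofNat]
  rw [← sqrt_pnat_sq n]
  field_simp
  ring_nf
  simp only [Complex.I_sq]
  ring

lemma creTilde_annTilde_tensor (n : ℕ+) (u : SchwartzMap ℝ ℂ)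
    (p : MvPolynomial (ℕ+ × Fin 2) ℂ) (y : Config) :
    creTilde n (annTilde n (tensor u p)) y = (n / 4 : ℂ) * (u y.1 *
      (((y.2 (n, 0) : ℂ) + Complex.I * y.2 (n, 1)) *
        (polyEval (pderiv (n, 0) p) y.2 - Complex.I * polyEval (pderiv (n, 1) p) y.2)
        - (polyEval (pderiv (n, 0) (pderiv (n, 0) p)) y.2 +
          polyEval (pderiv (n, 1) (pderiv (n, 1) p)) y.2))) := by
  have h : annTilde n (tensor u p) = tensor u (MvPolynomial.C (1 / 2 * (Real.sqrt n : ℂ)) *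
      (pderiv (n, 0) p - MvPolynomial.C Complex.I * pderiv (n, 1) p)) := by
    ext y
    simp [annTilde, dPhiPos, dCoord_tensor, tensor, polyEval]
    ring
  have hs : (Real.sqrt n : ℂ) ≠ 0 :=
    Complex.ofReal_ne_zero.2 (zero_lt_one.trans_le (one_le_sqrt_pnat n)).ne'
  rw [h, creTilde, dPhiNeg, dCoord_tensor, dCoord_tensor]
  simp only [MvPolynomial.pderiv_C_mul, map_sub, pderiv_comm (n, 1) (n, 0)]
  simp only [map_sub, phiPos, tensor,
    polyEval, map_mul, MvPolynomial.eval_C]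
  rw [← sqrt_pnat_sq n]
  field_simp
  ring_nf
  simp only [Complex.I_sq]
  ring

/-- If `p` satisfies Hermite's equation of degree `k` in both variables of the mode `n`, the number
operators of the Hamiltonian act on `u ⊗ p` by multiplication with a multiple of the total degree. -/
lemma numberExpr_one_tensor {n : ℕ+} {p : MvPolynomial (ℕ+ × Fin 2) ℂ} {k : ℕ+ × Fin 2 → ℂ}
    (h : ∀ j, MvPolynomial.X (n, j) * pderiv (n, j) p - pderiv (n, j) (pderiv (n, j) p) =
      MvPolynomial.C (k (n, j)) * p) (u : SchwartzMap ℝ ℂ) (y : Config) :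
    numberExpr 1 n (tensor u p) y = (n / 2 : ℂ) * (k (n, 0) + k (n, 1)) * tensor u p y := by
  have h' : ∀ j, (y.2 (n, j) : ℂ) * polyEval (pderiv (n, j) p) y.2 -
      polyEval (pderiv (n, j) (pderiv (n, j) p)) y.2 = k (n, j) * polyEval p y.2 := fun j => by
    simpa [polyEval] using congrArg (fun q => polyEval q y.2) (h j)
  rw [numberExpr, cre_ann_tensor, creTilde_annTilde_tensor, tensor]
  linear_combination (norm := (ring_nf; simp only [Complex.I_sq]; ring))
    ((n : ℂ) / 2 * u y.1) * (h' 0 + h' 1)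

/-- If `p` has weight `w` under the rotations of the mode `n`, the number operators of the momentum
act on `u ⊗ p` by multiplication with a multiple of the weight. -/
lemma numberExpr_neg_one_tensor {n : ℕ+} {p : MvPolynomial (ℕ+ × Fin 2) ℂ} {w : ℂ}
    (h : MvPolynomial.X (n, 0) * pderiv (n, 1) p - MvPolynomial.X (n, 1) * pderiv (n, 0) p =
      MvPolynomial.C (Complex.I * w) * p) (u : SchwartzMap ℝ ℂ) (y : Config) :
    numberExpr (-1) n (tensor u p) y = -(n / 2 : ℂ) * w * tensor u p y := by
  have h' : (y.2 (n, 0) : ℂ) * polyEval (pderiv (n, 1) p) y.2 -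
      y.2 (n, 1) * polyEval (pderiv (n, 0) p) y.2 = Complex.I * w * polyEval p y.2 := by
    simpa [polyEval] using congrArg (fun q => polyEval q y.2) h
  rw [numberExpr, cre_ann_tensor, creTilde_annTilde_tensor, tensor]
  linear_combination (norm := (ring_nf; simp only [Complex.I_sq]; ring))
    ((n : ℂ) / 2 * u y.1 * Complex.I) * h'

end Expressions

/-! ### The finite-particle domain in the state space -/

section FiniteParticleVectors

lemma memLp_tensor_schwartz (u : SchwartzMap ℝ ℂ) (p : MvPolynomial (ℕ+ × Fin 2) ℂ) :
    MemLp (tensor u p) 2 configMeasure :=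
  memLp_tensor (u.memLp 2 volume) (memLp_polyEval p (by simp))

/-- The vector of the state space defined by `u(c) p(φ)`. -/
noncomputable def tensorLp (u : SchwartzMap ℝ ℂ) (p : MvPolynomial (ℕ+ × Fin 2) ℂ) : StateSpace :=
  (memLp_tensor_schwartz u p).toLp

lemma coeFn_tensorLp (u : SchwartzMap ℝ ℂ) (p : MvPolynomial (ℕ+ × Fin 2) ℂ) :
    tensorLp u p =ᵐ[configMeasure] tensor u p := (memLp_tensor_schwartz u p).coeFn_toLp

lemma tensorLp_eq {u : SchwartzMap ℝ ℂ} {p : MvPolynomial (ℕ+ × Fin 2) ℂ} {ψ : StateSpace}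
    (h : ψ =ᵐ[configMeasure] tensor u p) : ψ = tensorLp u p :=
  Lp.ext (h.trans (coeFn_tensorLp u p).symm)

lemma tensorLp_add_left (u v : SchwartzMap ℝ ℂ) (p : MvPolynomial (ℕ+ × Fin 2) ℂ) :
    tensorLp (u + v) p = tensorLp u p + tensorLp v p := by
  have h : tensor (u + v) p = tensor u p + tensor v p := by
    ext y; simp [tensor, add_mul]
  unfold tensorLp
  rw [← MemLp.toLp_add]
  simp only [h]

lemma tensorLp_smul_left (c : ℂ) (u : SchwartzMap ℝ ℂ) (p : MvPolynomial (ℕ+ × Fin 2) ℂ) :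
    tensorLp (c • u) p = c • tensorLp u p := by
  have h : tensor (c • u) p = c • tensor u p := by
    ext y; simp [tensor, mul_assoc]
  unfold tensorLp
  rw [← MemLp.toLp_const_smul]
  simp only [h]

lemma tensorLp_sub_left (u v : SchwartzMap ℝ ℂ) (p : MvPolynomial (ℕ+ × Fin 2) ℂ) :
    tensorLp (u - v) p = tensorLp u p - tensorLp v p := by
  have h : u - v = u + (-1 : ℂ) • v := by simp [sub_eq_add_neg]
  rw [h, tensorLp_add_left, tensorLp_smul_left]
  simp [sub_eq_add_neg]

/-- The function `u ⊗ p` depends continuously on `u` in the norm of `L²(ℝ)`. -/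
lemma exists_norm_tensorLp_le (p : MvPolynomial (ℕ+ × Fin 2) ℂ) :
    ∃ C : ℝ, ∀ u : SchwartzMap ℝ ℂ, ‖tensorLp u p‖ ≤ C * ‖u.toLp 2 (volume : Measure ℝ)‖ := by
  refine ⟨(eLpNorm (polyEval p) 2 modesLaw).toReal, fun u => ?_⟩
  have hp : eLpNorm (polyEval p) 2 modesLaw ≠ ∞ := (memLp_polyEval p (by simp)).eLpNorm_ne_top
  have hu : eLpNorm u 2 volume ≠ ∞ := (u.memLp 2 volume).eLpNorm_ne_top
  have h : eLpNorm (tensor u p) 2 configMeasure =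
      eLpNorm (polyEval p) 2 modesLaw * eLpNorm u 2 volume := by
    have h2 : ∀ {X : Type} [MeasurableSpace X] (ν : Measure X) (f : X → ℂ),
        eLpNorm f 2 ν ^ 2 = ∫⁻ x, ‖f x‖ₑ ^ 2 ∂ν := fun ν f => by
      simpa using eLpNorm_nnreal_pow_eq_lintegral (μ := ν) (f := f) (p := 2) (by simp)
    have h3 : eLpNorm (tensor u p) 2 configMeasure ^ 2 =
        (eLpNorm (polyEval p) 2 modesLaw * eLpNorm u 2 volume) ^ 2 := by
      rw [mul_pow, h2, h2, h2, mul_comm, configMeasure]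
      rw [← lintegral_prod_mul (by fun_prop) (by fun_prop)]
      simp [tensor, mul_pow, enorm_mul]
    exact (ENNReal.pow_right_strictMono (by norm_num : (2 : ℕ) ≠ 0)).injective h3
  rw [tensorLp, Lp.norm_toLp, h, ENNReal.toReal_mul, SchwartzMap.norm_toLp]

/-- The graph of an expression which is linear on the finite-particle domain is a subspace. -/
noncomputable def graphSubmodule {L : (Config → ℂ) → Config → ℂ} (hL : IsLinearOnDomain L) :
    Submodule ℂ (StateSpace × StateSpace) where
  carrier := graphOn L
  zero_mem' := by
    refine ⟨0, zero_mem _, Lp.coeFn_zero _ _ _, ?_⟩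
    have h : L 0 = 0 := by simpa using hL.smul 0 0 (zero_mem _)
    rw [h]
    exact Lp.coeFn_zero _ _ _
  add_mem' := by
    rintro y z ⟨f, hf, hf1, hf2⟩ ⟨g, hg, hg1, hg2⟩
    refine ⟨f + g, add_mem hf hg, (Lp.coeFn_add _ _).trans (hf1.add hg1), ?_⟩
    rw [hL.add f hf g hg]
    exact (Lp.coeFn_add _ _).trans (hf2.add hg2)
  smul_mem' := by
    rintro c y ⟨f, hf, hf1, hf2⟩
    refine ⟨c • f, Submodule.smul_mem _ c hf, (Lp.coeFn_smul _ _).trans (hf1.const_smul c), ?_⟩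
    rw [hL.smul c f hf]
    exact (Lp.coeFn_smul _ _).trans (hf2.const_smul c)

/-- `L` acts on the functions `u(c) e_k(φ)` through an operator `A k` on the factor `u`; the
polynomials `e_k` span all polynomials. -/
structure ActsDiagonally {K : Type*} (L : (Config → ℂ) → Config → ℂ)
    (e : K → MvPolynomial (ℕ+ × Fin 2) ℂ) (A : K → SchwartzMap ℝ ℂ → SchwartzMap ℝ ℂ) : Prop where
  linear : IsLinearOnDomain L
  span : Submodule.span ℂ (Set.range e) = ⊤
  apply : ∀ k u, L (tensor u (e k)) = tensor (A k u) (e k)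

section Diagonal

variable {K : Type*} {L : (Config → ℂ) → Config → ℂ} {e : K → MvPolynomial (ℕ+ × Fin 2) ℂ}
  {A : K → SchwartzMap ℝ ℂ → SchwartzMap ℝ ℂ}

lemma ActsDiagonally.mem_graph (h : ActsDiagonally L e A) (k : K) (u : SchwartzMap ℝ ℂ) :
    (tensorLp u (e k), tensorLp (A k u) (e k)) ∈ graphSubmodule h.linear :=
  ⟨tensor u (e k), tensor_mem u _, coeFn_tensorLp _ _, by rw [h.apply]; exact coeFn_tensorLp _ _⟩

/-- The graph of `L` is spanned by its elements over the functions `u(c) e_k(φ)`. -/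
lemma ActsDiagonally.graph_le (h : ActsDiagonally L e A)
    {M : Submodule ℂ (StateSpace × StateSpace)}
    (hM : ∀ k u, (tensorLp u (e k), tensorLp (A k u) (e k)) ∈ M) : graphSubmodule h.linear ≤ M := by
  have key : ∀ f ∈ finiteParticle, ∃ z ∈ M, z.1 =ᵐ[configMeasure] f ∧ z.2 =ᵐ[configMeasure] L f := by
    have hsmul : ∀ (c : ℂ), ∀ f ∈ finiteParticle,
        (∃ z ∈ M, z.1 =ᵐ[configMeasure] f ∧ z.2 =ᵐ[configMeasure] L f) →
        ∃ z ∈ M, z.1 =ᵐ[configMeasure] (c • f) ∧ z.2 =ᵐ[configMeasure] L (c • f) := by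
      rintro c f hf ⟨z, hz, h1, h2⟩
      refine ⟨c • z, M.smul_mem c hz, (Lp.coeFn_smul _ _).trans (h1.const_smul c), ?_⟩
      rw [h.linear.smul c f hf]
      exact (Lp.coeFn_smul _ _).trans (h2.const_smul c)
    have hadd : ∀ f ∈ finiteParticle, ∀ g ∈ finiteParticle,
        (∃ z ∈ M, z.1 =ᵐ[configMeasure] f ∧ z.2 =ᵐ[configMeasure] L f) →
        (∃ z ∈ M, z.1 =ᵐ[configMeasure] g ∧ z.2 =ᵐ[configMeasure] L g) →
        ∃ z ∈ M, z.1 =ᵐ[configMeasure] (f + g) ∧ z.2 =ᵐ[configMeasure] L (f + g) := by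
      rintro f hf g hg ⟨z, hz, h1, h2⟩ ⟨w, hw, h3, h4⟩
      refine ⟨z + w, M.add_mem hz hw, (Lp.coeFn_add _ _).trans (h1.add h3), ?_⟩
      rw [h.linear.add f hf g hg]
      exact (Lp.coeFn_add _ _).trans (h2.add h4)
    have hzero : ∃ z ∈ M, z.1 =ᵐ[configMeasure] (0 : Config → ℂ) ∧
        z.2 =ᵐ[configMeasure] L 0 := by
      refine ⟨0, M.zero_mem, Lp.coeFn_zero _ _ _, ?_⟩
      have h0 : L 0 = 0 := by simpa using h.linear.smul 0 0 (zero_mem _)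
      rw [h0]
      exact Lp.coeFn_zero _ _ _
    intro f hf
    refine finiteParticle_induction hzero (fun u p => ?_) hadd hsmul hf
    have hp : p ∈ Submodule.span ℂ (Set.range e) := by rw [h.span]; trivial
    induction hp using Submodule.span_induction with
    | mem p hp =>
      obtain ⟨k, rfl⟩ := hp
      exact ⟨_, hM k u, coeFn_tensorLp _ _, by rw [h.apply]; exact coeFn_tensorLp _ _⟩
    | zero =>
      have : tensor u 0 = 0 := by ext y; simp [tensor, polyEval]
      rw [this]; exact hzero
    | add p q _ _ hp hq =>
      have : tensor u (p + q) = tensor u p + tensor u q := by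
        ext y; simp [tensor, polyEval, mul_add]
      rw [this]; exact hadd _ (tensor_mem u p) _ (tensor_mem u q) hp hq
    | smul c p _ hp =>
      have : tensor u (c • p) = c • tensor u p := by
        ext y; simp [tensor, polyEval]; ring
      rw [this]; exact hsmul c _ (tensor_mem u p) hp
  rintro y ⟨f, hf, h1, h2⟩
  obtain ⟨z, hz, h3, h4⟩ := key f hf
  have : y = z := Prod.ext (Lp.ext (h1.trans h3.symm)) (Lp.ext (h2.trans h4.symm))
  exact this ▸ hz

/-- The vectors `u(c) e_k(φ)` are total. -/
lemma dense_of_tensorLp_mem (he : Submodule.span ℂ (Set.range e) = ⊤)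
    {W : Submodule ℂ StateSpace} (hW : ∀ k u, tensorLp u (e k) ∈ W) :
    Dense (W : Set StateSpace) := by
  have hW' : ∀ u p, tensorLp u p ∈ W := by
    intro u p
    have hp : p ∈ Submodule.span ℂ (Set.range e) := by rw [he]; trivial
    induction hp using Submodule.span_induction with
    | mem p hp => obtain ⟨k, rfl⟩ := hp; exact hW k u
    | zero =>
      have : tensorLp u 0 = 0 := (tensorLp_eq ((Lp.coeFn_zero _ _ _).trans
        (Filter.EventuallyEq.of_eq (by ext y; simp [tensor, polyEval])))).symm
      rw [this]; exact W.zero_mem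
    | add p q _ _ hp hq =>
      have : tensorLp u p + tensorLp u q = tensorLp u (p + q) := tensorLp_eq
        ((Lp.coeFn_add _ _).trans (((coeFn_tensorLp u p).add (coeFn_tensorLp u q)).trans
          (Filter.EventuallyEq.of_eq (by ext y; simp [tensor, polyEval, mul_add]))))
      rw [← this]; exact W.add_mem hp hq
    | smul c p _ hp =>
      have : c • tensorLp u p = tensorLp u (c • p) := tensorLp_eq
        ((Lp.coeFn_smul _ _).trans (((coeFn_tensorLp u p).const_smul c).trans
          (Filter.EventuallyEq.of_eq (by ext y; simp [tensor, polyEval]; ring))))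
      rw [← this]; exact W.smul_mem c hp
  rw [Submodule.dense_iff_topologicalClosure_eq_top, Submodule.topologicalClosure_eq_top_iff,
    Submodule.eq_bot_iff]
  intro ψ hψ
  rw [Submodule.mem_orthogonal'] at hψ
  have hmem : MemLp (fun y => (starRingEnd ℂ) (ψ y)) 2 configMeasure := (Lp.memLp ψ).star
  have h := ae_eq_zero_of_integral_tensor hmem fun u p => by
    have h1 := hψ _ (hW' u p)
    rw [L2.inner_def] at h1
    rw [← h1]
    refine integral_congr_ae ?_
    filter_upwards [coeFn_tensorLp u p] with y hy
    rw [hy, RCLike.inner_apply, tensor]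
    ring
  refine Lp.ext (Filter.EventuallyEq.trans ?_ (Lp.coeFn_zero _ _ _).symm)
  filter_upwards [h] with y hy
  simpa using hy

end Diagonal

end FiniteParticleVectors

/-! ### Hermite polynomials and the Ornstein-Uhlenbeck semigroup -/

section Hermite

open Polynomial

/-- The probabilists' Hermite polynomial of degree `m`, over `ℂ`. -/
noncomputable def hermiteC (m : ℕ) : ℂ[X] := (hermite m).map (Int.castRingHom ℂ)

lemma hermiteC_zero : hermiteC 0 = 1 := by simp [hermiteC]

lemma hermiteC_succ (m : ℕ) : hermiteC (m + 1) = X * hermiteC m - derivative (hermiteC m) := by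
  simp [hermiteC, hermite_succ, Polynomial.derivative_map]

lemma derivative_hermiteC (m : ℕ) : derivative (hermiteC m) = C (m : ℂ) * hermiteC (m - 1) := by
  induction m with
  | zero => simp [hermiteC_zero]
  | succ m ih =>
    rw [hermiteC_succ, derivative_sub, derivative_mul, derivative_X, Nat.add_sub_cancel]
    cases m with
    | zero => simp [hermiteC_zero]
    | succ m =>
      rw [ih, Nat.add_sub_cancel, derivative_C_mul]
      have h := hermiteC_succ m
      push_cast
      simp only [map_add, map_one]
      linear_combination (-(C (m : ℂ) + 1)) * h

lemma X_mul_derivative_hermiteC (m : ℕ) :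
    X * derivative (hermiteC m) - derivative (derivative (hermiteC m)) =
      C (m : ℂ) * hermiteC m := by
  cases m with
  | zero => simp [hermiteC_zero]
  | succ m =>
    rw [derivative_hermiteC, Nat.add_sub_cancel, derivative_C_mul, hermiteC_succ]
    ring

lemma integrable_eval_gaussianReal (P : ℂ[X]) :
    Integrable (fun y : ℝ => P.eval (y : ℂ)) (gaussianReal 0 1) := by
  simp only [eval_eq_sum_range]
  refine integrable_finsetSum _ fun i _ => Integrable.const_mul ?_ _
  have h := (memLp_id_gaussianReal (μ := 0) (v := 1) (i : ℝ≥0)).integrable_norm_pow'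
  have h2 : AEStronglyMeasurable (fun y : ℝ => (y : ℂ) ^ i) (gaussianReal 0 1) := by fun_prop
  exact (integrable_norm_iff h2).1 (by simpa using h)

/-- Gaussian integration by parts. -/
lemma integral_mul_eval_gaussianReal (P : ℂ[X]) :
    ∫ y : ℝ, (y : ℂ) * P.eval (y : ℂ) ∂gaussianReal 0 1 =
      ∫ y : ℝ, (derivative P).eval (y : ℂ) ∂gaussianReal 0 1 := by
  have hint : ∀ R : ℂ[X], Integrable (fun y : ℝ => gaussianPDFReal 0 1 y • R.eval (y : ℂ)) :=
    fun R => by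
      have h := integrable_eval_gaussianReal R
      rw [gaussianReal_of_var_ne_zero 0 one_ne_zero,
        integrable_withDensity_iff_integrable_smul' (measurable_gaussianPDF 0 1)
          (ae_of_all _ fun _ => gaussianPDF_lt_top)] at h
      simpa only [toReal_gaussianPDF] using h
  have hpdf : ∀ y, HasDerivAt (gaussianPDFReal 0 1) (-y * gaussianPDFReal 0 1 y) y := fun y => by
    have h1 : HasDerivAt (fun y : ℝ => -(y - 0) ^ 2 / (2 * ((1 : ℝ≥0) : ℝ))) (-y) y := by
      have h := (((hasDerivAt_id y).sub_const 0).pow 2).neg.div_const (2 * ((1 : ℝ≥0) : ℝ))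
      refine h.congr_deriv ?_
      simp; ring
    have h2 := (h1.exp).const_mul (√(2 * Real.pi * ((1 : ℝ≥0) : ℝ)))⁻¹
    have h3 : gaussianPDFReal 0 1 = fun y => (√(2 * Real.pi * ((1 : ℝ≥0) : ℝ)))⁻¹ *
        Real.exp (-(y - 0) ^ 2 / (2 * ((1 : ℝ≥0) : ℝ))) := rfl
    rw [h3]
    refine h2.congr_deriv ?_
    ring
  have hP : ∀ y : ℝ, HasDerivAt (fun y : ℝ => P.eval (y : ℂ)) ((derivative P).eval (y : ℂ)) y :=
    fun y => (P.hasDerivAt (y : ℂ)).comp_ofReal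
  have h0 := integral_eq_zero_of_hasDerivAt_of_integrable
    (f := fun y => gaussianPDFReal 0 1 y • P.eval (y : ℂ)) (fun y => (hpdf y).smul (hP y))
    ((hint (derivative P)).add (by
      refine (hint (-(X * P))).congr (Filter.Eventually.of_forall fun y => ?_)
      simp; ring)) (hint P)
  rw [integral_add (hint _) ((hint (-(X * P))).congr (Filter.Eventually.of_forall fun y => by
      simp; ring))] at h0
  rw [integral_gaussianReal_eq_integral_smul one_ne_zero,
    integral_gaussianReal_eq_integral_smul one_ne_zero, eq_comm, ← sub_eq_zero, ← h0,
    sub_eq_add_neg, ← integral_neg]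
  congr 1
  refine integral_congr_ae (Filter.Eventually.of_forall fun y => ?_)
  simp; ring

/-- The Hermite polynomials are the eigenfunctions of the Ornstein-Uhlenbeck semigroup in one
variable. -/
lemma integral_hermiteC {a b : ℝ} (h : a ^ 2 + b ^ 2 = 1) (m : ℕ) (x : ℝ) :
    ∫ y : ℝ, (hermiteC m).eval ((a * x + b * y : ℝ) : ℂ) ∂gaussianReal 0 1 =
      (a : ℂ) ^ m * (hermiteC m).eval (x : ℂ) := by
  have hab : (a : ℂ) ^ 2 + (b : ℂ) ^ 2 = 1 := by exact_mod_cast h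
  have hcomp : ∀ (P : ℂ[X]) (y : ℝ), P.eval ((a * x + b * y : ℝ) : ℂ) =
      (P.comp (C ((a : ℂ) * x) + C (b : ℂ) * X)).eval (y : ℂ) := fun P y => by
    simp [eval_comp]
  have hint : ∀ P : ℂ[X], Integrable (fun y : ℝ => P.eval ((a * x + b * y : ℝ) : ℂ))
      (gaussianReal 0 1) := fun P => by
    simp only [hcomp]
    exact integrable_eval_gaussianReal _
  have hibp : ∀ P : ℂ[X], ∫ y : ℝ, (y : ℂ) * P.eval ((a * x + b * y : ℝ) : ℂ) ∂gaussianReal 0 1 =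
      b * ∫ y : ℝ, (derivative P).eval ((a * x + b * y : ℝ) : ℂ) ∂gaussianReal 0 1 := fun P => by
    simp only [hcomp]
    rw [integral_mul_eval_gaussianReal, ← integral_const_mul]
    simp [derivative_comp]
  have hstep : ∀ m, ∫ y : ℝ, (hermiteC (m + 1)).eval ((a * x + b * y : ℝ) : ℂ) ∂gaussianReal 0 1 =
      a * x * (∫ y : ℝ, (hermiteC m).eval ((a * x + b * y : ℝ) : ℂ) ∂gaussianReal 0 1) -
      (a : ℂ) ^ 2 * m *
        ∫ y : ℝ, (hermiteC (m - 1)).eval ((a * x + b * y : ℝ) : ℂ) ∂gaussianReal 0 1 := by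
    intro m
    have h1 : ∀ y : ℝ, (hermiteC (m + 1)).eval ((a * x + b * y : ℝ) : ℂ) =
        a * x * (hermiteC m).eval ((a * x + b * y : ℝ) : ℂ) +
          b * (y * (hermiteC m).eval ((a * x + b * y : ℝ) : ℂ)) -
          (derivative (hermiteC m)).eval ((a * x + b * y : ℝ) : ℂ) := fun y => by
      rw [hermiteC_succ]
      simp
      ring
    have hi : Integrable (fun y : ℝ => (y : ℂ) * (hermiteC m).eval ((a * x + b * y : ℝ) : ℂ))
        (gaussianReal 0 1) := by
      simp only [hcomp]
      refine (integrable_eval_gaussianReal (X * (hermiteC m).comp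
        (C ((a : ℂ) * x) + C (b : ℂ) * X))).congr (Filter.Eventually.of_forall fun y => ?_)
      simp
    simp only [h1]
    have hsum : Integrable (fun y : ℝ => a * x * (hermiteC m).eval ((a * x + b * y : ℝ) : ℂ) +
        b * (y * (hermiteC m).eval ((a * x + b * y : ℝ) : ℂ))) (gaussianReal 0 1) :=
      ((hint _).const_mul _).add (hi.const_mul _)
    rw [integral_sub hsum (hint _),
      integral_add ((hint _).const_mul _) (hi.const_mul _), integral_const_mul, integral_const_mul,
      hibp, derivative_hermiteC]
    simp only [eval_mul, eval_C]
    rw [integral_const_mul]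
    linear_combination ((m : ℂ) *
      ∫ y : ℝ, (hermiteC (m - 1)).eval ((a * x + b * y : ℝ) : ℂ) ∂gaussianReal 0 1) * hab
  induction m using Nat.strong_induction_on with
  | _ m ih =>
    match m with
    | 0 => simp [hermiteC_zero]
    | 1 =>
      rw [hstep 0, ih 0 one_pos, hermiteC_succ]
      simp [hermiteC_zero]
    | m + 2 =>
      rw [hstep, ih (m + 1) (by omega), Nat.add_sub_cancel, ih m (by omega),
        hermiteC_succ (m + 1), derivative_hermiteC, Nat.add_sub_cancel]
      simp
      ring

/-- A span that contains `1` and is stable under multiplication by the coordinates is the whole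
polynomial ring. -/
lemma span_range_eq_top {K : Type*} {e : K → MvPolynomial (ℕ+ × Fin 2) ℂ}
    (h1 : 1 ∈ Submodule.span ℂ (Set.range e))
    (hX : ∀ k i, e k * MvPolynomial.X i ∈ Submodule.span ℂ (Set.range e)) :
    Submodule.span ℂ (Set.range e) = ⊤ := by
  rw [Submodule.eq_top_iff']
  intro p
  induction p using MvPolynomial.induction_on with
  | C a =>
    rw [← mul_one (MvPolynomial.C a), ← MvPolynomial.smul_eq_C_mul]
    exact Submodule.smul_mem _ _ h1
  | add p q hp hq => exact add_mem hp hq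
  | mul_X p i hp =>
    induction hp using Submodule.span_induction with
    | mem p hp => obtain ⟨k, rfl⟩ := hp; exact hX k i
    | zero => simp
    | add p q _ _ hp hq => rw [add_mul]; exact add_mem hp hq
    | smul c p _ hp => rw [smul_mul_assoc]; exact Submodule.smul_mem _ c hp

/-- The product `∏ He_{k i}(x_i)` of Hermite polynomials with multi-index `k`. -/
noncomputable def hermitePoly (k : ℕ+ × Fin 2 →₀ ℕ) : MvPolynomial (ℕ+ × Fin 2) ℂ :=
  k.prod fun i m => aeval (MvPolynomial.X i) (hermiteC m)

lemma hermitePoly_eq (k : ℕ+ × Fin 2 →₀ ℕ) (i : ℕ+ × Fin 2) : hermitePoly k =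
    aeval (MvPolynomial.X i) (hermiteC (k i)) * hermitePoly (k.erase i) :=
  (Finsupp.mul_prod_erase' k i _ fun _ => by simp [hermiteC_zero]).symm

lemma hermitePoly_update (k : ℕ+ × Fin 2 →₀ ℕ) (i : ℕ+ × Fin 2) (m : ℕ) :
    hermitePoly (k.update i m) =
      aeval (MvPolynomial.X i) (hermiteC m) * hermitePoly (k.erase i) := by
  rw [hermitePoly_eq _ i, Finsupp.erase_update_eq_erase]
  simp

lemma pderiv_hermitePoly_erase (k : ℕ+ × Fin 2 →₀ ℕ) (i : ℕ+ × Fin 2) :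
    MvPolynomial.pderiv i (hermitePoly (k.erase i)) = 0 := by
  rw [hermitePoly, Finsupp.prod]
  refine Finset.prod_induction _ (fun q => MvPolynomial.pderiv i q = 0) ?_ ?_ ?_
  · intro p q hp hq
    rw [MvPolynomial.pderiv_mul, hp, hq]
    simp
  · simp
  · intro j hj
    have hji : j ≠ i := by
      rintro rfl
      simp at hj
    rw [Derivation.map_aeval, MvPolynomial.pderiv_X_of_ne hji, smul_zero]

lemma pderiv_aeval_mul (P : ℂ[X]) (k : ℕ+ × Fin 2 →₀ ℕ) (i : ℕ+ × Fin 2) :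
    MvPolynomial.pderiv i (aeval (MvPolynomial.X i) P * hermitePoly (k.erase i)) =
      aeval (MvPolynomial.X i) (derivative P) * hermitePoly (k.erase i) := by
  rw [MvPolynomial.pderiv_mul, pderiv_hermitePoly_erase, Derivation.map_aeval,
    MvPolynomial.pderiv_X_self]
  simp

/-- Hermite's equation `x y' - y'' = k y` in each of the variables. -/
lemma hermitePoly_eigen (k : ℕ+ × Fin 2 →₀ ℕ) (i : ℕ+ × Fin 2) :
    MvPolynomial.X i * MvPolynomial.pderiv i (hermitePoly k) -
      MvPolynomial.pderiv i (MvPolynomial.pderiv i (hermitePoly k)) =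
        MvPolynomial.C (k i : ℂ) * hermitePoly k := by
  have h := congrArg (aeval (MvPolynomial.X i : MvPolynomial (ℕ+ × Fin 2) ℂ))
    (X_mul_derivative_hermiteC (k i))
  simp only [map_sub, map_mul, aeval_X, aeval_C] at h
  rw [hermitePoly_eq k i, pderiv_aeval_mul, pderiv_aeval_mul]
  rw [MvPolynomial.algebraMap_eq] at h
  linear_combination hermitePoly (k.erase i) * h

/-- Every polynomial is a combination of products of Hermite polynomials, by the three-term
recursion `x He_k = He_{k+1} + k He_{k-1}`. -/
lemma span_hermitePoly : Submodule.span ℂ (Set.range hermitePoly) = ⊤ := by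
  refine span_range_eq_top (Submodule.subset_span ⟨0, by simp [hermitePoly]⟩) fun k i => ?_
  have h : hermitePoly k * MvPolynomial.X i = hermitePoly (k.update i (k i + 1)) +
      (k i : ℂ) • hermitePoly (k.update i (k i - 1)) := by
    rw [hermitePoly_update, hermitePoly_update, hermitePoly_eq k i, hermiteC_succ,
      derivative_hermiteC]
    simp only [map_sub, map_mul, aeval_X, aeval_C, MvPolynomial.smul_eq_C_mul,
      MvPolynomial.algebraMap_eq]
    ring
  rw [h]
  exact add_mem (Submodule.subset_span ⟨_, rfl⟩)
    (Submodule.smul_mem _ _ (Submodule.subset_span ⟨_, rfl⟩))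

lemma polyEval_hermitePoly (k : ℕ+ × Fin 2 →₀ ℕ) (x : Modes) :
    polyEval (hermitePoly k) x = ∏ i ∈ k.support, (hermiteC (k i)).eval (x i : ℂ) := by
  rw [polyEval, hermitePoly, Finsupp.prod, map_prod]
  refine Finset.prod_congr rfl fun i _ => ?_
  induction hermiteC (k i) using Polynomial.induction_on' with
  | add P R hP hR => simp [hP, hR]
  | monomial n a => simp

/-- The number `∑ n k_{(n, j)}` of quanta, weighted with the frequencies. -/
noncomputable def energy (k : ℕ+ × Fin 2 →₀ ℕ) : ℝ := k.sum fun i m => (i.1 : ℝ) * m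

lemma energy_nonneg (k : ℕ+ × Fin 2 →₀ ℕ) : 0 ≤ energy k :=
  Finset.sum_nonneg fun _ _ => by positivity

/-- The products of Hermite polynomials are the eigenfunctions of the Ornstein-Uhlenbeck
semigroup of the modes. -/
lemma integral_hermitePoly (k : ℕ+ × Fin 2 →₀ ℕ) {t : ℝ} (ht : 0 ≤ t) (x : Modes) :
    ∫ y, polyEval (hermitePoly k) (fun i => damp t i * x i + noiseSize t i * y i) ∂modesLaw =
      (Real.exp (-(energy k * t)) : ℂ) * polyEval (hermitePoly k) x := by
  simp only [polyEval_hermitePoly]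
  rw [integral_prod_modesLaw k.support (g := fun i r => (hermiteC (k i)).eval
    ((damp t i * x i + noiseSize t i * r : ℝ) : ℂ)) fun i =>
      ((hermiteC (k i)).continuous.comp (by fun_prop)).measurable]
  have h : ∀ i, ∫ r : ℝ, (hermiteC (k i)).eval ((damp t i * x i + noiseSize t i * r : ℝ) : ℂ)
      ∂gaussianReal 0 1 = (damp t i : ℂ) ^ k i * (hermiteC (k i)).eval (x i : ℂ) := fun i =>
    integral_hermiteC (damp_sq_add_noiseSize_sq ht i) _ _
  simp only [h]
  rw [Finset.prod_mul_distrib]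
  congr 1
  rw [energy, Finsupp.sum, Finset.sum_mul, ← Finset.sum_neg_distrib, Real.exp_sum]
  push_cast
  refine Finset.prod_congr rfl fun i _ => ?_
  rw [damp, ← Complex.ofReal_pow, ← Real.exp_nat_mul]
  push_cast
  congr 1
  ring

end Hermite

/-! ### Diagonal action of the Hamiltonian and of the momentum -/

section EigenBases

open MvPolynomial (pderiv X C)

/-- The operator `½ (-d²/dc² + Q²) + E` on Schwartz functions of the zero mode. -/
noncomputable def zeroModeHamiltonian (Q E : ℝ) (u : SchwartzMap ℝ ℂ) : SchwartzMap ℝ ℂ :=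
  (1 / 2 : ℂ) • (-SchwartzMap.derivCLM ℂ ℂ (SchwartzMap.derivCLM ℂ ℂ u) + (Q : ℂ) ^ 2 • u) +
    (E : ℂ) • u

lemma energy_eq_tsum (k : ℕ+ × Fin 2 →₀ ℕ) :
    (energy k : ℂ) = ∑' n : ℕ+, (n : ℂ) * (k (n, 0) + k (n, 1)) := by
  have hs : Function.HasFiniteSupport fun i : ℕ+ × Fin 2 => (i.1 : ℂ) * k i := by
    refine k.hasFiniteSupport.subset fun i hi => ?_
    simp only [Function.mem_support, ne_eq, mul_eq_zero, not_or] at hi ⊢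
    exact_mod_cast hi.2
  have h1 : (energy k : ℂ) = ∑' i : ℕ+ × Fin 2, (i.1 : ℂ) * k i := by
    rw [energy, Finsupp.sum, tsum_eq_sum (s := k.support) fun i hi => by
      simp [Finsupp.notMem_support_iff.1 hi]]
    push_cast
    rfl
  rw [h1, (summable_of_hasFiniteSupport hs).tsum_prod]
  refine tsum_congr fun n => ?_
  rw [tsum_fintype, Fin.sum_univ_two]
  ring

lemma actsDiagonally_hamiltonianExpr (Q : ℝ) : ActsDiagonally (hamiltonianExpr Q) hermitePoly
    (fun k => zeroModeHamiltonian Q (energy k)) where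
  linear := isLinearOnDomain_hamiltonianExpr Q
  span := span_hermitePoly
  apply k u := by
    ext y
    have h : ∀ n : ℕ+, numberExpr 1 n (tensor u (hermitePoly k)) y =
        (n : ℂ) * (k (n, 0) + k (n, 1)) * (tensor u (hermitePoly k) y / 2) := fun n => by
      rw [numberExpr_one_tensor (k := fun i => (k i : ℂ)) fun j => hermitePoly_eigen k (n, j)]
      ring
    rw [hamiltonianExpr_eq, dC_tensor, dC_tensor]
    simp only [h]
    rw [tsum_mul_right, ← energy_eq_tsum]
    simp only [tensor, zeroModeHamiltonian, add_apply, smul_apply,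
      neg_apply, smul_eq_mul]
    ring

/-- `p` has the weights `w` under the rotations of the single modes: it is homogeneous of degree
`-w n`, the number of factors `φ_{-n}` minus the number of factors `φ_n`. -/
structure HasWeight (p : MvPolynomial (ℕ+ × Fin 2) ℂ) (w : ℕ+ →₀ ℤ) : Prop where
  pderiv_eq : ∀ n, X (n, 0) * pderiv (n, 1) p - X (n, 1) * pderiv (n, 0) p =
    C (Complex.I * w n) * p
  rotModes_eq : ∀ α x, polyEval p (rotModes α x) =
    Complex.exp (Complex.I * α * w.sum fun n m => -((n : ℂ) * m)) * polyEval p x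

lemma hasWeight_one : HasWeight 1 0 where
  pderiv_eq n := by simp
  rotModes_eq α x := by simp [polyEval]

lemma HasWeight.mul {p q : MvPolynomial (ℕ+ × Fin 2) ℂ} {w v : ℕ+ →₀ ℤ} (hp : HasWeight p w)
    (hq : HasWeight q v) : HasWeight (p * q) (w + v) where
  pderiv_eq n := by
    have h1 := hp.pderiv_eq n
    have h2 := hq.pderiv_eq n
    rw [MvPolynomial.pderiv_mul, MvPolynomial.pderiv_mul]
    simp only [Finsupp.add_apply, Int.cast_add, mul_add, map_add]
    linear_combination q * h1 + p * h2
  rotModes_eq α x := by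
    have h : polyEval (p * q) = fun x => polyEval p x * polyEval q x := by
      ext x; simp [polyEval]
    rw [h]
    simp only
    rw [hp.rotModes_eq, hq.rotModes_eq, Finsupp.sum_add_index' (by simp) (by intros; push_cast; ring),
      mul_add, Complex.exp_add]
    ring

/-- The complex coordinate `α_n + iβ_n` (for `s = 1`) or `α_n - iβ_n` (for `s = -1`). -/
lemma hasWeight_coordinate (n : ℕ+) {s : ℤ} (hs : s = 1 ∨ s = -1) :
    HasWeight (X (n, 0) + C (s * Complex.I) * X (n, 1)) (Finsupp.single n s) where
  pderiv_eq m := by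
    have hs2 : (C ((s : ℂ) * Complex.I) * C (s * Complex.I) : MvPolynomial (ℕ+ × Fin 2) ℂ) =
        C (-1) := by
      rw [← map_mul]
      congr 1
      rcases hs with rfl | rfl <;> · push_cast; linear_combination Complex.I_sq
    rw [map_add, map_add, MvPolynomial.pderiv_C_mul, MvPolynomial.pderiv_C_mul]
    by_cases h : m = n
    · subst h
      have h1 : (C (Complex.I * s) : MvPolynomial (ℕ+ × Fin 2) ℂ) = C (s * Complex.I) := by
        rw [mul_comm]
      rw [MvPolynomial.pderiv_X_self, MvPolynomial.pderiv_X_self,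
        MvPolynomial.pderiv_X_of_ne (by simp), MvPolynomial.pderiv_X_of_ne (by simp),
        Finsupp.single_eq_same, h1]
      rw [map_neg, map_one] at hs2
      linear_combination (-X (m, 1)) * hs2
    · have h' : n ≠ m := fun e => h e.symm
      rw [MvPolynomial.pderiv_X_of_ne (by simp [h']), MvPolynomial.pderiv_X_of_ne (by simp [h']),
        MvPolynomial.pderiv_X_of_ne (by simp [h']), MvPolynomial.pderiv_X_of_ne (by simp [h']),
        Finsupp.single_eq_of_ne h]
      simp
  rotModes_eq α x := by
    have h1 : Complex.exp (Complex.I * α * (Finsupp.single n s).sum fun n m => -((n : ℂ) * m)) =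
        Complex.cos (n * α) - s * Complex.I * Complex.sin (n * α) := by
      rw [Finsupp.sum_single_index (by simp)]
      have h2 : Complex.I * α * -((n : ℂ) * s) = (-(s * (n * α)) : ℂ) * Complex.I := by ring
      rw [h2, Complex.exp_mul_I]
      rcases hs with rfl | rfl
      · push_cast; rw [one_mul, Complex.cos_neg, Complex.sin_neg]; ring
      · push_cast; rw [neg_one_mul, neg_neg]; ring
    rw [h1]
    simp only [polyEval, map_add, map_mul, MvPolynomial.eval_X, MvPolynomial.eval_C,
      rotModes_apply_zero, rotModes_apply_one]
    push_cast
    have hs2 : ((s : ℂ) * Complex.I) * (s * Complex.I) = -1 := by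
      rcases hs with rfl | rfl <;> · push_cast; linear_combination Complex.I_sq
    linear_combination (Complex.sin (n * α) * x (n, 1)) * hs2

/-- The polynomials with a weight. -/
abbrev Weighted : Type := {pw : MvPolynomial (ℕ+ × Fin 2) ℂ × (ℕ+ →₀ ℤ) // HasWeight pw.1 pw.2}

lemma span_weighted : Submodule.span ℂ (Set.range fun k : Weighted => k.1.1) = ⊤ := by
  refine span_range_eq_top (Submodule.subset_span ⟨⟨(1, 0), hasWeight_one⟩, rfl⟩) ?_
  rintro ⟨⟨p, w⟩, hp⟩ ⟨n, j⟩
  have h1 := hp.mul (hasWeight_coordinate n (s := 1) (Or.inl rfl))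
  have h2 := hp.mul (hasWeight_coordinate n (s := -1) (Or.inr rfl))
  have m1 : _ ∈ Submodule.span ℂ (Set.range fun k : Weighted => k.1.1) :=
    Submodule.subset_span ⟨⟨(_, _), h1⟩, rfl⟩
  have m2 : _ ∈ Submodule.span ℂ (Set.range fun k : Weighted => k.1.1) :=
    Submodule.subset_span ⟨⟨(_, _), h2⟩, rfl⟩
  have hC : ∀ a b : ℂ, (C (a * b) : MvPolynomial (ℕ+ × Fin 2) ℂ) = C a * C b := fun a b => map_mul _ _ _
  have hh : (C (1 / 2 : ℂ) : MvPolynomial (ℕ+ × Fin 2) ℂ) * 2 = 1 := by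
    rw [show (2 : MvPolynomial (ℕ+ × Fin 2) ℂ) = C 2 from (map_ofNat C 2).symm, ← map_mul]
    norm_num
  have hI : (C Complex.I * C Complex.I : MvPolynomial (ℕ+ × Fin 2) ℂ) = -1 := by
    rw [← map_mul, Complex.I_mul_I]; simp
  fin_cases j
  · have h : p * X (n, 0) = (1 / 2 : ℂ) • (p * (X (n, 0) + C (((1 : ℤ) : ℂ) * Complex.I) * X (n, 1)) +
        p * (X (n, 0) + C (((-1 : ℤ) : ℂ) * Complex.I) * X (n, 1))) := by
      rw [MvPolynomial.smul_eq_C_mul, hC, hC]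
      push_cast
      simp only [map_neg, map_one]
      linear_combination (-(p * X (n, 0))) * hh
    exact h ▸ Submodule.smul_mem _ _ (add_mem m1 m2)
  · have h : p * X (n, 1) = (-(1 / 2) * Complex.I : ℂ) •
        (p * (X (n, 0) + C (((1 : ℤ) : ℂ) * Complex.I) * X (n, 1)) -
        p * (X (n, 0) + C (((-1 : ℤ) : ℂ) * Complex.I) * X (n, 1))) := by
      rw [MvPolynomial.smul_eq_C_mul, hC, hC, hC]
      push_cast
      simp only [map_neg, map_one]
      linear_combination (-(p * X (n, 1))) * hh +
        (2 * C (1 / 2 : ℂ) * p * X (n, 1)) * hI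
    exact h ▸ Submodule.smul_mem _ _ (sub_mem m1 m2)

/-- The momentum `-∑ n w_n` of a weighted polynomial. -/
noncomputable def weightMomentum (k : Weighted) : ℝ := k.1.2.sum fun n m => -((n : ℝ) * m)

lemma ofReal_weightMomentum (k : Weighted) :
    (weightMomentum k : ℂ) = k.1.2.sum fun n m => -((n : ℂ) * m) := by
  simp [weightMomentum, Finsupp.sum]

lemma actsDiagonally_momentumExpr : ActsDiagonally momentumExpr (fun k : Weighted => k.1.1)
    (fun k u => (weightMomentum k : ℂ) • u) where
  linear := isLinearOnDomain_momentumExpr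
  span := span_weighted
  apply k u := by
    ext y
    have h : ∀ n : ℕ+, numberExpr (-1) n (tensor u k.1.1) y =
        -((n : ℂ) * k.1.2 n) * (tensor u k.1.1 y / 2) := fun n => by
      rw [numberExpr_neg_one_tensor (k.2.pderiv_eq n)]
      ring
    rw [momentumExpr_eq]
    simp only [h]
    rw [tsum_mul_right, tsum_eq_sum (s := k.1.2.support) fun n hn => by
      simp [Finsupp.notMem_support_iff.1 hn]]
    simp only [tensor, smul_apply, smul_eq_mul, ofReal_weightMomentum, Finsupp.sum]
    ring

end EigenBases

/-! ### The rotation group -/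

/-- For a family of contractions, strong continuity has to be checked on a dense set only. -/
lemma continuous_apply_of_dense {S E : Type*} [TopologicalSpace S] [NormedAddCommGroup E]
    [InnerProductSpace ℂ E] {T : S → E →L[ℂ] E} (hT : ∀ t ψ, ‖T t ψ‖ ≤ ‖ψ‖) {W : Set E}
    (hW : Dense W) (hc : ∀ ψ ∈ W, Continuous fun t => T t ψ) (ψ : E) :
    Continuous fun t => T t ψ := by
  refine continuous_of_uniform_approx_of_continuous fun s hs => ?_
  obtain ⟨ε, hε, hs⟩ := Metric.mem_uniformity_dist.1 hs
  obtain ⟨χ, hχ, hd⟩ := Metric.dense_iff.1 hW ψ ε hε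
  refine ⟨fun t => T t χ, hc χ hd, fun t => hs ?_⟩
  rw [dist_eq_norm, ← map_sub]
  refine (hT t _).trans_lt ?_
  rw [← dist_eq_norm, dist_comm]
  exact hχ

/-- The vectors with continuous orbits form a subspace. -/
def continuousOrbits {S E : Type*} [TopologicalSpace S] [NormedAddCommGroup E]
    [InnerProductSpace ℂ E] (T : S → E →L[ℂ] E) : Submodule ℂ E where
  carrier := {ψ | Continuous fun t => T t ψ}
  zero_mem' := by simpa using continuous_const
  add_mem' {ψ χ} hψ hχ := by
    change Continuous fun t => T t (ψ + χ)
    simp only [map_add]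
    exact Continuous.add hψ hχ
  smul_mem' c ψ hψ := by
    change Continuous fun t => T t (c • ψ)
    simp only [map_smul]
    exact Continuous.const_smul hψ c

/-- The pairs `(ψ, χ)` with `B t ψ → χ` form a subspace. -/
def limitGraph {S E : Type*} [NormedAddCommGroup E] [InnerProductSpace ℂ E] (l : Filter S)
    (B : S → E →ₗ[ℂ] E) : Submodule ℂ (E × E) where
  carrier := {y | Tendsto (fun t => B t y.1) l (𝓝 y.2)}
  zero_mem' := by simpa using tendsto_const_nhds
  add_mem' {y z} hy hz := by simpa using Tendsto.add hy hz
  smul_mem' c y hy := by simpa using Tendsto.const_smul hy c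

lemma rotationGroup_tensorLp (α : ℝ) (k : Weighted) (u : SchwartzMap ℝ ℂ) :
    rotationGroup α (tensorLp u k.1.1) =
      Complex.exp (Complex.I * α * weightMomentum k) • tensorLp u k.1.1 := by
  rw [← tensorLp_smul_left]
  refine tensorLp_eq ?_
  rw [rotationGroup_apply, tensorLp, rotate_toLp]
  refine (MemLp.coeFn_toLp _).trans (Filter.EventuallyEq.of_eq ?_)
  ext y
  simp only [Function.comp_apply, tensor, smul_apply, smul_eq_mul, k.2.rotModes_eq,
    ofReal_weightMomentum]
  ring

lemma isUnitaryGroup_rotationGroup : IsUnitaryGroup rotationGroup where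
  zero := by ext1 ψ; exact rotate_zero ψ
  add s t ψ := rotate_add s t ψ
  continuous := by
    refine continuous_apply_of_dense (T := fun α => (rotationGroup α : StateSpace →L[ℂ] StateSpace))
      (fun α ψ => ((rotationGroup α).norm_map ψ).le) (dense_of_tensorLp_mem
        (W := continuousOrbits fun α => (rotationGroup α : StateSpace →L[ℂ] StateSpace))
        span_weighted fun k u => ?_) fun ψ hψ => hψ
    change Continuous fun α => rotationGroup α (tensorLp u k.1.1)
    simp only [rotationGroup_tensorLp]
    fun_prop

/-- The generator of the rotation group is the closure of the momentum. -/
theorem exists_momentum : ∃ P : StateSpace →ₗ.[ℂ] StateSpace,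
    GeneratesGroup P rotationGroup ∧ IsSelfAdjoint P ∧
      (P.graph : Set (StateSpace × StateSpace)) = closure (graphOn momentumExpr) := by
  have hd := actsDiagonally_momentumExpr
  have hrange : ∀ z : ℂ, (∀ r : ℝ, (r : ℂ) + z ≠ 0) →
      Dense ((fun y : StateSpace × StateSpace => y.2 + z • y.1) '' graphSubmodule hd.linear) := by
    intro z hz
    have h := dense_of_tensorLp_mem (W := (graphSubmodule hd.linear).map
      (LinearMap.snd ℂ StateSpace StateSpace + z • LinearMap.fst ℂ StateSpace StateSpace))
      span_weighted fun k u => by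
        refine ⟨_, hd.mem_graph k (((weightMomentum k : ℂ) + z)⁻¹ • u), ?_⟩
        simp only [LinearMap.add_apply, LinearMap.smul_apply, LinearMap.snd_apply,
          LinearMap.fst_apply]
        rw [← tensorLp_smul_left, ← tensorLp_add_left, ← add_smul, smul_inv_smul₀ (hz _)]
    exact h
  refine exists_generator_of_unitaryGroup isUnitaryGroup_rotationGroup (graphSubmodule hd.linear)
    ?_ ?_ (hrange _ fun r h => ?_) (hrange _ fun r h => ?_)
  · have h := hd.graph_le (M := limitGraph (𝓝[≠] (0 : ℝ)) fun α : ℝ =>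
      ((Complex.I * (α : ℂ))⁻¹) • ((rotationGroup α).toLinearEquiv.toLinearMap - LinearMap.id))
      fun k u => ?_
    · exact fun y hy => h hy
    · change Tendsto (fun α : ℝ => (Complex.I * (α : ℂ))⁻¹ •
        (rotationGroup α (tensorLp u k.1.1) - tensorLp u k.1.1)) (𝓝[≠] 0) _
      simp only [rotationGroup_tensorLp, tensorLp_smul_left]
      have h1 : HasDerivAt (fun α : ℝ => Complex.exp (Complex.I * α * weightMomentum k))
          (Complex.I * weightMomentum k) 0 := by
        have h2 : HasDerivAt (fun α : ℂ => Complex.exp (Complex.I * α * weightMomentum k))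
            (Complex.I * weightMomentum k) ((0 : ℝ) : ℂ) := by
          have h3 := (((hasDerivAt_id ((0 : ℝ) : ℂ)).const_mul Complex.I).mul_const
            (weightMomentum k : ℂ)).cexp
          simpa using h3
        exact h2.comp_ofReal
      have h2 := (hasDerivAt_iff_tendsto_slope.1 h1).const_mul (Complex.I⁻¹)
      rw [inv_mul_cancel_left₀ Complex.I_ne_zero] at h2
      refine (h2.smul_const (tensorLp u k.1.1)).congr fun α => ?_
      have h3 : Complex.exp (Complex.I * α * weightMomentum k) • tensorLp u k.1.1 -
          tensorLp u k.1.1 =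
          (Complex.exp (Complex.I * α * weightMomentum k) - 1) • tensorLp u k.1.1 := by
        rw [sub_smul, one_smul]
      rw [h3, smul_smul, slope_def_module]
      simp [mul_assoc, mul_left_comm]
  · have h := dense_of_tensorLp_mem (W := (graphSubmodule hd.linear).map
      (LinearMap.fst ℂ StateSpace StateSpace)) span_weighted fun k u =>
        ⟨_, hd.mem_graph k u, rfl⟩
    exact h
  · simpa using congrArg Complex.im h
  · simpa using congrArg Complex.im h

/-! ### Fourier multipliers and the zero mode -/

section ZeroMode

open scoped FourierTransform SchwartzMap LineDeriv ContDiff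

/-- The Fourier multiplier with a real symbol. -/
noncomputable def multiplier (g : ℝ → ℝ) (u : 𝓢(ℝ, ℂ)) : 𝓢(ℝ, ℂ) :=
  SchwartzMap.fourierMultiplierCLM ℂ g u

lemma fourier_multiplier {g : ℝ → ℝ} (hg : g.HasTemperateGrowth) (u : 𝓢(ℝ, ℂ)) (k : ℝ) :
    (𝓕 (multiplier g u)) k = (g k : ℂ) * (𝓕 u) k := by
  rw [multiplier, SchwartzMap.fourierMultiplierCLM_apply, FourierTransform.fourier_fourierInv_eq,
    SchwartzMap.smulLeftCLM_apply_apply hg, Complex.real_smul]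

lemma fourier_ext {u v : 𝓢(ℝ, ℂ)} (h : ∀ k, (𝓕 u) k = (𝓕 v) k) : u = v := by
  have h1 : (𝓕 u : 𝓢(ℝ, ℂ)) = 𝓕 v := by
    ext k
    exact h k
  have hinv : ∀ w : 𝓢(ℝ, ℂ), 𝓕⁻ (𝓕 w : 𝓢(ℝ, ℂ)) = w := FourierTransform.fourierInv_fourier_eq
  rw [← hinv u, h1, hinv v]

lemma norm_toLp_le_of_fourier {u v : 𝓢(ℝ, ℂ)} {C : ℝ}
    (h : ∀ k, ‖(𝓕 u) k‖ ≤ C * ‖(𝓕 v) k‖) :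
    ‖u.toLp 2 (volume : Measure ℝ)‖ ≤ C * ‖v.toLp 2 (volume : Measure ℝ)‖ := by
  rw [← SchwartzMap.norm_fourier_toL2_eq u, ← SchwartzMap.norm_fourier_toL2_eq v]
  refine Lp.norm_le_mul_norm_of_ae_le_mul ?_
  filter_upwards [SchwartzMap.coeFn_toLp (𝓕 u) 2 (volume : Measure ℝ),
    SchwartzMap.coeFn_toLp (𝓕 v) 2 (volume : Measure ℝ)] with k h1 h2
  rw [h1, h2]
  exact h k

lemma fourier_deriv (u : 𝓢(ℝ, ℂ)) (k : ℝ) :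
    (𝓕 (SchwartzMap.derivCLM ℂ ℂ u)) k = 2 * Real.pi * Complex.I * k * (𝓕 u) k := by
  have h : SchwartzMap.derivCLM ℂ ℂ u = ∂_{(1 : ℝ)} u := by
    ext x
    rw [SchwartzMap.derivCLM_apply, SchwartzMap.lineDerivOp_apply_eq_fderiv,
      fderiv_apply_one_eq_deriv]
  rw [h, SchwartzMap.fourier_lineDerivOp_eq, smul_apply,
    SchwartzMap.smulLeftCLM_apply_apply (by fun_prop)]
  simp
  ring

/-- The symbol of `½ (-d²/dc² + Q²) + E`. -/
noncomputable def zeroModeSymbol (Q E : ℝ) (k : ℝ) : ℝ :=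
  2 * Real.pi ^ 2 * k ^ 2 + (Q ^ 2 / 2 + E)

variable {Q E : ℝ}

lemma zeroModeSymbol_nonneg (hE : 0 ≤ E) (k : ℝ) : 0 ≤ zeroModeSymbol Q E k := by
  unfold zeroModeSymbol; positivity

lemma hasTemperateGrowth_zeroModeSymbol : (zeroModeSymbol Q E).HasTemperateGrowth := by
  unfold zeroModeSymbol; fun_prop

lemma fourier_zeroModeHamiltonian (u : 𝓢(ℝ, ℂ)) (k : ℝ) :
    (𝓕 (zeroModeHamiltonian Q E u)) k = (zeroModeSymbol Q E k : ℂ) * (𝓕 u) k := by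
  rw [zeroModeHamiltonian]
  simp only [FourierTransform.fourier_add, FourierTransform.fourier_smul,
    FourierTransform.fourier_neg, add_apply, smul_apply, neg_apply, fourier_deriv, smul_eq_mul,
    zeroModeSymbol]
  push_cast
  linear_combination (-2 * Real.pi ^ 2 * k ^ 2 * (𝓕 u) k) * Complex.I_sq

/-- The symbol is nonnegative, and on `(-∞, 0]` the exponential is bounded with all its
derivatives. -/
lemma hasTemperateGrowth_exp_neg (hE : 0 ≤ E) (t : ℝ≥0) :
    (fun k => Real.exp (-(t * zeroModeSymbol Q E k))).HasTemperateGrowth := by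
  have h := Function.HasTemperateGrowth.comp' (g := Real.exp)
    (f := fun k => -(t * zeroModeSymbol Q E k)) (t := Set.Iic 0) ?_ (uniqueDiffOn_Iic 0)
    Real.contDiff_exp.contDiffOn (fun N => ⟨0, 1, zero_le_one, fun n _ x hx => ?_⟩) ?_
  · exact h
  · rintro _ ⟨k, rfl⟩
    exact neg_nonpos.2 (mul_nonneg t.coe_nonneg (zeroModeSymbol_nonneg hE k))
  · rw [norm_iteratedFDerivWithin_eq_norm_iteratedDerivWithin,
      iteratedDerivWithin_eq_iteratedDeriv (uniqueDiffOn_Iic 0) Real.contDiff_exp.contDiffAt hx,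
      iteratedDeriv_eq_iterate, Real.iter_deriv_exp]
    simpa using hx
  · have := hasTemperateGrowth_zeroModeSymbol (Q := Q) (E := E)
    fun_prop

/-- The heat semigroup of the zero mode. -/
noncomputable def heat (Q E : ℝ) (t : ℝ≥0) (u : 𝓢(ℝ, ℂ)) : 𝓢(ℝ, ℂ) :=
  multiplier (fun k => Real.exp (-(t * zeroModeSymbol Q E k))) u

lemma fourier_heat (hE : 0 ≤ E) (t : ℝ≥0) (u : 𝓢(ℝ, ℂ)) (k : ℝ) :
    (𝓕 (heat Q E t u)) k = (Real.exp (-(t * zeroModeSymbol Q E k)) : ℂ) * (𝓕 u) k :=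
  fourier_multiplier (hasTemperateGrowth_exp_neg hE t) u k

lemma heat_add (hE : 0 ≤ E) (s t : ℝ≥0) (u : 𝓢(ℝ, ℂ)) :
    heat Q E (s + t) u = heat Q E s (heat Q E t u) := by
  refine fourier_ext fun k => ?_
  rw [fourier_heat hE, fourier_heat hE, fourier_heat hE, ← mul_assoc, ← Complex.ofReal_mul,
    ← Real.exp_add]
  congr 3
  push_cast
  ring

/-- The heat semigroup is given by averaging over Gaussian increments of the zero mode. -/
lemma heat_apply (hE : 0 ≤ E) (t : ℝ≥0) (u : 𝓢(ℝ, ℂ)) (c : ℝ) :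
    heat Q E t u c = (Real.exp (-((Q ^ 2 / 2 + E) * t)) : ℂ) *
      ∫ b, u (c + Real.sqrt t * b) ∂gaussianReal 0 1 := by
  have hinv : ∀ (v : 𝓢(ℝ, ℂ)) (x : ℝ), v x = ∫ k, phase (2 * Real.pi * k * x) * (𝓕 v) k := by
    intro v x
    have h : 𝓕⁻ (𝓕 v : 𝓢(ℝ, ℂ)) = v := FourierTransform.fourierInv_fourier_eq v
    conv_lhs => rw [← h]
    rw [SchwartzMap.fourierInv_coe, Real.fourierInv_eq']
    refine integral_congr_ae (ae_of_all _ fun k => ?_)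
    simp [phase]
    left
    congr 1
    ring
  have hint : Integrable (fun z : ℝ × ℝ => phase (2 * Real.pi * z.2 * (c + Real.sqrt t * z.1)) *
      (𝓕 u) z.2) ((gaussianReal 0 1).prod volume) := by
    have h1 : Integrable (fun z : ℝ × ℝ => (𝓕 u) z.2) ((gaussianReal 0 1).prod volume) :=
      (𝓕 u).integrable.comp_snd _
    refine h1.bdd_mul (c := 1) (by
      have := continuous_phase
      exact (this.comp (by fun_prop)).aestronglyMeasurable) (ae_of_all _ fun z => ?_)
    rw [norm_phase]
  have hgauss : ∀ k, ∫ b, phase (2 * Real.pi * k * (c + Real.sqrt t * b)) * (𝓕 u) k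
      ∂gaussianReal 0 1 = (Real.exp (-(2 * Real.pi ^ 2 * k ^ 2 * t)) : ℂ) *
        (phase (2 * Real.pi * k * c) * (𝓕 u) k) := by
    intro k
    have h1 : ∀ b, phase (2 * Real.pi * k * (c + Real.sqrt t * b)) * (𝓕 u) k =
        (phase (2 * Real.pi * k * c) * (𝓕 u) k) * phase ((2 * Real.pi * k * Real.sqrt t) * b) := by
      intro b
      rw [mul_add, phase_add]
      ring_nf
    simp only [h1]
    rw [integral_const_mul, integral_phase_gaussianReal, mul_comm]
    congr 3
    rw [mul_pow, Real.sq_sqrt t.coe_nonneg, NNReal.coe_one]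
    ring
  simp only [hinv u]
  rw [integral_integral_swap hint]
  simp only [hgauss]
  rw [hinv, ← integral_const_mul]
  refine integral_congr_ae (ae_of_all _ fun k => ?_)
  simp only [fourier_heat hE]
  have h2 : Real.exp (-(t * zeroModeSymbol Q E k)) =
      Real.exp (-((Q ^ 2 / 2 + E) * t)) * Real.exp (-(2 * Real.pi ^ 2 * k ^ 2 * t)) := by
    rw [← Real.exp_add, zeroModeSymbol]
    congr 1
    ring
  rw [h2]
  push_cast
  ring

lemma abs_exp_neg_sub_exp_neg_le {a b : ℝ} (ha : 0 ≤ a) (hb : 0 ≤ b) :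
    |Real.exp (-a) - Real.exp (-b)| ≤ |a - b| := by
  wlog h : a ≤ b generalizing a b
  · rw [abs_sub_comm, abs_sub_comm a]
    exact this hb ha (le_of_not_ge h)
  rw [abs_of_nonneg (sub_nonneg.2 (Real.exp_le_exp.2 (neg_le_neg h))), abs_sub_comm,
    abs_of_nonneg (sub_nonneg.2 h)]
  have h1 := Real.one_sub_le_exp_neg (b - a)
  have h2 : Real.exp (-b) = Real.exp (-a) * Real.exp (-(b - a)) := by
    rw [← Real.exp_add]; congr 1; ring
  have h3 : Real.exp (-a) ≤ 1 := Real.exp_le_one_iff.2 (by linarith)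
  rw [h2]
  nlinarith [Real.exp_pos (-a), sub_nonneg.2 h]

lemma abs_one_sub_exp_neg_sub_le {a : ℝ} (ha : 0 ≤ a) : |1 - Real.exp (-a) - a| ≤ a ^ 2 := by
  rcases le_total a 1 with h | h
  · have := Real.abs_exp_sub_one_sub_id_le (x := -a) (by rwa [abs_neg, abs_of_nonneg ha])
    rw [neg_sq, ← abs_neg] at this
    convert this using 2
    ring
  · have h1 := Real.one_sub_le_exp_neg a
    have h2 := Real.exp_pos (-a)
    have h3 : Real.exp (-a) ≤ 1 := Real.exp_le_one_iff.2 (by linarith)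
    rw [abs_le]
    constructor <;> nlinarith

lemma norm_heat_sub_le (hE : 0 ≤ E) (s t : ℝ≥0) (u : 𝓢(ℝ, ℂ)) :
    ‖(heat Q E s u - heat Q E t u).toLp 2 (volume : Measure ℝ)‖ ≤
      |(s : ℝ) - t| * ‖(zeroModeHamiltonian Q E u).toLp 2 (volume : Measure ℝ)‖ := by
  refine norm_toLp_le_of_fourier fun k => ?_
  rw [sub_eq_add_neg, FourierTransform.fourier_add, FourierTransform.fourier_neg, add_apply,
    neg_apply, fourier_heat hE, fourier_heat hE, fourier_zeroModeHamiltonian, ← sub_eq_add_neg,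
    ← sub_mul, ← Complex.ofReal_sub, norm_mul, norm_mul, ← mul_assoc]
  have h0 := zeroModeSymbol_nonneg (Q := Q) hE k
  refine mul_le_mul_of_nonneg_right ?_ (norm_nonneg _)
  rw [Complex.norm_real, Complex.norm_real, Real.norm_eq_abs, Real.norm_eq_abs, ← abs_mul, sub_mul]
  exact abs_exp_neg_sub_exp_neg_le (mul_nonneg s.coe_nonneg h0) (mul_nonneg t.coe_nonneg h0)

/-- The difference quotient at time `0` of the heat semigroup converges to its generator, at the
rate that `|(1 - exp (-x)) - x| ≤ x²` gives for the symbols. -/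
lemma norm_heat_quotient_sub_le (hE : 0 ≤ E) {t : ℝ≥0} (ht : 0 < t) (u : 𝓢(ℝ, ℂ)) :
    ‖((((t : ℝ) : ℂ)⁻¹ • (u - heat Q E t u)) - zeroModeHamiltonian Q E u).toLp 2
        (volume : Measure ℝ)‖ ≤
      t * ‖(zeroModeHamiltonian Q E (zeroModeHamiltonian Q E u)).toLp 2 (volume : Measure ℝ)‖ := by
  refine norm_toLp_le_of_fourier fun k => ?_
  have h0 := zeroModeSymbol_nonneg (Q := Q) hE k
  have ht' : (0 : ℝ) < t := ht
  have h1 : (𝓕 ((((t : ℝ) : ℂ)⁻¹ • (u - heat Q E t u)) - zeroModeHamiltonian Q E u)) k =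
      (((t : ℝ)⁻¹ * (1 - Real.exp (-(t * zeroModeSymbol Q E k)) - t * zeroModeSymbol Q E k) : ℝ)
        : ℂ) * (𝓕 u) k := by
    simp only [sub_eq_add_neg, FourierTransform.fourier_add, FourierTransform.fourier_neg,
      FourierTransform.fourier_smul, add_apply, neg_apply, smul_apply, smul_eq_mul,
      fourier_heat hE, fourier_zeroModeHamiltonian]
    have : (((t : ℝ) : ℂ)) ≠ 0 := Complex.ofReal_ne_zero.2 ht'.ne'
    push_cast
    field_simp
  rw [h1, fourier_zeroModeHamiltonian, fourier_zeroModeHamiltonian, ← mul_assoc,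
    ← Complex.ofReal_mul, norm_mul, norm_mul, ← mul_assoc]
  refine mul_le_mul_of_nonneg_right ?_ (norm_nonneg _)
  rw [Complex.norm_real, Complex.norm_real, Real.norm_eq_abs, Real.norm_eq_abs, abs_mul,
    abs_of_pos (inv_pos.2 ht'), abs_of_nonneg (mul_nonneg h0 h0), inv_mul_le_iff₀ ht']
  refine (abs_one_sub_exp_neg_sub_le (mul_nonneg t.coe_nonneg h0)).trans (le_of_eq ?_)
  ring

/-- `½ (-d²/dc² + Q²) + E + 1` maps the Schwartz space onto itself. -/
lemma exists_zeroModeHamiltonian_add_eq (hE : 0 ≤ E) (v : 𝓢(ℝ, ℂ)) :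
    ∃ u, zeroModeHamiltonian Q E u + u = v := by
  set m : ℝ := Q ^ 2 / 2 + E + 1 with hm
  have hm0 : 0 < m := by positivity
  -- the reciprocal of the symbol plus one, written as a rescaled Bessel potential, whose
  -- temperate growth is known
  set g : ℝ → ℝ := fun k => m⁻¹ * (1 + ‖Real.sqrt (2 / m) * Real.pi * k‖ ^ 2) ^ (-1 : ℝ) with hgdef
  have hg : g.HasTemperateGrowth := by
    have h := (Function.hasTemperateGrowth_one_add_norm_sq_rpow ℝ (-1)).comp
      (f := fun k : ℝ => Real.sqrt (2 / m) * Real.pi * k) (by fun_prop)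
    exact (Function.HasTemperateGrowth.const m⁻¹).mul h
  refine ⟨multiplier g v, fourier_ext fun k => ?_⟩
  rw [FourierTransform.fourier_add, add_apply, fourier_zeroModeHamiltonian,
    fourier_multiplier hg, ← add_one_mul, ← mul_assoc]
  have h1 : (zeroModeSymbol Q E k + 1) * g k = 1 := by
    rw [hgdef]
    simp only
    rw [Real.rpow_neg_one, Real.norm_eq_abs, sq_abs, mul_pow, mul_pow,
      Real.sq_sqrt (by positivity)]
    have h2 : zeroModeSymbol Q E k + 1 = m * (1 + 2 / m * Real.pi ^ 2 * k ^ 2) := by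
      rw [zeroModeSymbol]
      field_simp
      rw [hm]
      ring
    have h3 : 1 + 2 / m * Real.pi ^ 2 * k ^ 2 ≠ 0 := by positivity
    rw [h2]
    field_simp
  have h4 := congrArg (fun r : ℝ => (r : ℂ)) h1
  push_cast at h4 ⊢
  rw [h4, one_mul]

end ZeroMode

/-! ### The dilation semigroup -/

/-- The semigroup leaves the functions `u ⊗ He_k` product functions: the Ornstein-Uhlenbeck motion
of the modes multiplies `He_k` by `exp (-t * energy k)`, the Brownian motion of the constant mode
convolves `u` with the heat kernel. -/
lemma semigroup_tensorLp (Q : ℝ) (t : ℝ≥0) (k : ℕ+ × Fin 2 →₀ ℕ) (u : SchwartzMap ℝ ℂ) :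
    semigroup Q t (tensorLp u (hermitePoly k)) =
      tensorLp (heat Q (energy k) t u) (hermitePoly k) := by
  refine tensorLp_eq ?_
  rw [tensorLp]
  filter_upwards [semigroup_toLp Q t (memLp_tensor_schwartz u (hermitePoly k))] with p hp
  rw [hp]
  have h1 : ∀ η : ℝ × Modes, tensor u (hermitePoly k) (flow t 0 p η) =
      u (p.1 + Real.sqrt t * η.1) *
        polyEval (hermitePoly k) (fun i => damp t i * p.2 i + noiseSize t i * η.2 i) := fun η => by
    simp only [tensor, flow, rotModes_zero]
  simp only [h1]
  rw [noiseLaw, integral_prod_mul (fun b : ℝ => u (p.1 + Real.sqrt t * b)) (fun y : Modes =>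
    polyEval (hermitePoly k) (fun i => damp t i * p.2 i + noiseSize t i * y i)),
    integral_hermitePoly k t.coe_nonneg, tensor, heat_apply (energy_nonneg k)]
  have h2 : Real.exp (-((Q ^ 2 / 2 + energy k) * t)) =
      Real.exp (-(Q ^ 2 * t / 2)) * Real.exp (-(energy k * t)) := by
    rw [← Real.exp_add]
    congr 1
    ring
  rw [h2]
  push_cast
  ring_nf

lemma isContractionSemigroup_semigroup (Q : ℝ) : IsContractionSemigroup (semigroup Q) where
  zero := semigroup_zero Q
  add s t := by
    have h := dense_of_tensorLp_mem (W := LinearMap.eqLocus (semigroup Q (s + t)).toLinearMap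
      ((semigroup Q s).comp (semigroup Q t)).toLinearMap) span_hermitePoly fun k u => by
        change semigroup Q (s + t) _ = semigroup Q s (semigroup Q t _)
        rw [semigroup_tensorLp, semigroup_tensorLp, semigroup_tensorLp,
          heat_add (energy_nonneg k)]
    exact ContinuousLinearMap.ext fun ψ => congrFun (Continuous.ext_on h
      (semigroup Q (s + t)).continuous ((semigroup Q s).comp (semigroup Q t)).continuous
      fun ψ hψ => hψ) ψ
  contraction := norm_semigroup_le Q
  continuous := by
    refine continuous_apply_of_dense (norm_semigroup_le Q) (dense_of_tensorLp_mem
      (W := continuousOrbits (semigroup Q)) span_hermitePoly fun k u => ?_) fun ψ hψ => hψ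
    change Continuous fun t => semigroup Q t (tensorLp u (hermitePoly k))
    simp only [semigroup_tensorLp]
    obtain ⟨C, hC⟩ := exists_norm_tensorLp_le (hermitePoly k)
    refine (LipschitzWith.of_dist_le_mul (K := (|C| * ‖(zeroModeHamiltonian Q (energy k) u).toLp 2
      (volume : Measure ℝ)‖).toNNReal) fun s t => ?_).continuous
    rw [dist_eq_norm, ← tensorLp_sub_left, Real.coe_toNNReal _ (by positivity), NNReal.dist_eq]
    refine (hC _).trans ((mul_le_mul_of_nonneg_right (le_abs_self C) (norm_nonneg _)).trans ?_)
    have := norm_heat_sub_le (Q := Q) (energy_nonneg k) s t u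
    calc _ ≤ |C| * _ := mul_le_mul_of_nonneg_left this (abs_nonneg C)
      _ = _ := by ring

/-- The generator of the dilation semigroup is the closure of the Hamiltonian. -/
theorem exists_hamiltonian (Q : ℝ) : ∃ H : StateSpace →ₗ.[ℂ] StateSpace,
    GeneratesSemigroup H (semigroup Q) ∧ IsSelfAdjoint H ∧
      (∀ ψ : H.domain, 0 ≤ (inner ℂ (ψ : StateSpace) (H ψ)).re) ∧
      (H.graph : Set (StateSpace × StateSpace)) = closure (graphOn (hamiltonianExpr Q)) := by
  have hd := actsDiagonally_hamiltonianExpr Q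
  refine exists_generator_of_semigroup (isContractionSemigroup_semigroup Q) (inner_semigroup Q)
    (graphSubmodule hd.linear) ?_ ?_ ?_
  · have h := hd.graph_le (M := limitGraph (𝓝[>] (0 : ℝ≥0)) fun t : ℝ≥0 =>
      (((t : ℝ) : ℂ)⁻¹) • (LinearMap.id - (semigroup Q t).toLinearMap)) fun k u => ?_
    · exact fun y hy => h hy
    · change Tendsto (fun t : ℝ≥0 => (((t : ℝ) : ℂ)⁻¹) • (tensorLp u (hermitePoly k) -
        semigroup Q t (tensorLp u (hermitePoly k)))) (𝓝[>] 0) _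
      obtain ⟨C, hC⟩ := exists_norm_tensorLp_le (hermitePoly k)
      rw [tendsto_iff_norm_sub_tendsto_zero]
      set B := ‖(zeroModeHamiltonian Q (energy k) (zeroModeHamiltonian Q (energy k) u)).toLp 2
        (volume : Measure ℝ)‖
      have hlim : Tendsto (fun t : ℝ≥0 => |C| * ((t : ℝ) * B)) (𝓝[>] 0) (𝓝 0) := by
        have : Continuous fun t : ℝ≥0 => |C| * ((t : ℝ) * B) := by fun_prop
        simpa using (this.tendsto 0).mono_left nhdsWithin_le_nhds
      refine squeeze_zero' (Filter.Eventually.of_forall fun _ => norm_nonneg _) ?_ hlim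
      filter_upwards [self_mem_nhdsWithin] with t ht
      rw [semigroup_tensorLp, ← tensorLp_sub_left, ← tensorLp_smul_left, ← tensorLp_sub_left]
      refine (hC _).trans ((mul_le_mul_of_nonneg_right (le_abs_self C) (norm_nonneg _)).trans ?_)
      exact mul_le_mul_of_nonneg_left (norm_heat_quotient_sub_le (energy_nonneg k) ht u)
        (abs_nonneg C)
  · have h := dense_of_tensorLp_mem (W := (graphSubmodule hd.linear).map
      (LinearMap.fst ℂ StateSpace StateSpace)) span_hermitePoly fun k u =>
        ⟨_, hd.mem_graph k u, rfl⟩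
    exact h
  · have h := dense_of_tensorLp_mem (W := (graphSubmodule hd.linear).map
      (LinearMap.snd ℂ StateSpace StateSpace + LinearMap.fst ℂ StateSpace StateSpace))
      span_hermitePoly fun k v => by
        obtain ⟨u, rfl⟩ := exists_zeroModeHamiltonian_add_eq (Q := Q) (energy_nonneg k) v
        refine ⟨_, hd.mem_graph k u, ?_⟩
        simp only [LinearMap.add_apply, LinearMap.snd_apply, LinearMap.fst_apply]
        rw [← tensorLp_add_left]
    exact h

end QFreeField

open QFreeField
theorem proposition8 {Ω : Type*} [MeasurableSpace Ω] (μ : Measure Ω) [IsProbabilityMeasure μ]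
    (Φ : Ω → DiskField) (hΦ : IsDirichletGFF Φ μ) (Q : ℝ) :
    -- the dilation semigroup `e^{-tH}` and the Hamiltonian
    (∃ (T : ℝ≥0 → StateSpace →L[ℂ] StateSpace) (H : StateSpace →ₗ.[ℂ] StateSpace),
      (∀ t, IsInduced μ Φ Q (dil t) (T t) ∧ ∀ A, IsInduced μ Φ Q (dil t) A → A = T t) ∧
      IsContractionSemigroup T ∧
      GeneratesSemigroup H T ∧
      IsSelfAdjoint H ∧ (∀ ψ : H.domain, 0 ≤ (inner ℂ (ψ : StateSpace) (H ψ)).re) ∧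
      (H.graph : Set (StateSpace × StateSpace)) = closure (graphOn (hamiltonianExpr Q))) ∧
    -- the rotation group `e^{iαP}` and the momentum
    (∃ (V : ℝ → StateSpace ≃ₗᵢ[ℂ] StateSpace) (P : StateSpace →ₗ.[ℂ] StateSpace),
      (∀ α, IsInduced μ Φ Q (rot α) (V α : StateSpace →L[ℂ] StateSpace) ∧
        ∀ A, IsInduced μ Φ Q (rot α) A → A = (V α : StateSpace →L[ℂ] StateSpace)) ∧
      IsUnitaryGroup V ∧
      GeneratesGroup P V ∧
      IsSelfAdjoint P ∧
      (P.graph : Set (StateSpace × StateSpace)) = closure (graphOn momentumExpr)) := by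
  obtain ⟨H, hH, hHsa, hHpos, hHgraph⟩ := exists_hamiltonian Q
  obtain ⟨P, hP, hPsa, hPgraph⟩ := exists_momentum
  exact ⟨⟨semigroup Q, H, fun t => ⟨isInduced_semigroup hΦ Q t,
      fun A hA => isInduced_unique hΦ Q hA (isInduced_semigroup hΦ Q t)⟩,
      isContractionSemigroup_semigroup Q, hH, hHsa, hHpos, hHgraph⟩,
    ⟨rotationGroup, P, fun α => ⟨isInduced_rotationGroup hΦ Q α,
      fun A hA => isInduced_unique hΦ Q hA (isInduced_rotationGroup hΦ Q α)⟩,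
      isUnitaryGroup_rotationGroup, hP, hPsa, hPgraph⟩⟩
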